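/- Let $\mathbb{R}^3_1\times\mathbb{R}$ carry the metric $dx_1^2+dx_2^2-dx_3^2+dt^2$, let $\mathbb{H}^2=\{x_1^2+x_2^2-x_3^2=-1,\ x_3>0\}$, and let $F:M\to\mathbb{H}^2\times\mathbb{R}$ be a smooth isometric immersion of a connected surface with smooth unit normal field $\xi$ (tangent to $\mathbb{H}^2\times\mathbb{R}$). Write $\partial_t=T+\cos\theta\,\xi$ with $T$ tangent to $M$ and $\theta\in[0,\pi]$, and suppose that $\theta\neq 0,\frac{\pi}{2}$ everywhere. Then the induced metric of $M$ is flat and $T$ is a principal direction at every point (that is, $T\neq 0$ and $T$ is an eigenvector of the shape operator) if and only if there are a constant $c\in\mathbb{R}$ and an isometry $\Phi$ of $\mathbb{H}^2\times\mathbb{R}$ such that, around every point of $M$, there are local coordinates $(x,y)$ with $x>0$ and $x^2+c>0$ in which $F=\Phi\circ F_c$, where $F_c$ is (7.a) if $c>-1$: $\displaystyle F_c(x,y)=\Big(\frac{x}{\sqrt{c+1}}\cos y,\ \frac{x}{\sqrt{c+1}}\sin y,\ \frac{\sqrt{x^2+c+1}}{\sqrt{c+1}},\ \chi(x)\Big)$;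 (7.b) if $c<-1$: $\displaystyle F_c(x,y)=\Big(\frac{\sqrt{x^2+c+1}}{\sqrt{-c-1}},\ \frac{x}{\sqrt{-c-1}}\sinh y,\ \frac{x}{\sqrt{-c-1}}\cosh y,\ \chi(x)\Big)$; (7.c) if $c=-1$: $\displaystyle F_c(x,y)=\Big(xy,\ \frac{x}{2}(1-y^2)-\frac{1}{2x},\ \frac{x}{2}(1+y^2)+\frac{1}{2x},\ \chi(x)\Big)$; and $\displaystyle \chi(x)=\int_{\sqrt{\max(0,-c)}}^x\frac{\sqrt{\tau^2+c}}{\sqrt{\tau^2+c+1}}\,d\tau$. Moreover, in any such coordinates $\theta=\arctan\sqrt{x^2+c}$ or $\theta=\pi-\arctan\sqrt{x^2+c}$, according to the choice of the unit normal $\xi$. -/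

import Mathlib

open scoped Manifold ContDiff

noncomputable section

/-! ### The ambient space `ℍ² × ℝ ⊂ ℝ³₁ × ℝ` -/

/-- The scalar product `dx₁² + dx₂² - dx₃² + dt²` of `ℝ³₁ × ℝ`. -/
def lorentz (u v : Fin 4 → ℝ) : ℝ :=
  u 0 * v 0 + u 1 * v 1 - u 2 * v 2 + u 3 * v 3

/-- `ℍ² × ℝ`, with `ℍ²` the upper sheet of the hyperboloid `x₁² + x₂² - x₃² = -1`. -/
def H2R : Set (Fin 4 → ℝ) :=
  {P | P 0 ^ 2 + P 1 ^ 2 - P 2 ^ 2 = -1 ∧ 0 < P 2}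

/-- The unit vector field `∂_t` tangent to the `ℝ`-direction. -/
def dt : Fin 4 → ℝ := ![0, 0, 0, 1]

/-- The position vector `(P₁, P₂, P₃, 0)`, which is normal to `ℍ² × ℝ` at `P` and satisfies
`⟨ξ̃, ξ̃⟩ = -1`. -/
def ambientNormal (P : Fin 4 → ℝ) : Fin 4 → ℝ := ![P 0, P 1, P 2, 0]

/-- Orthogonal projection of `ℝ³₁ × ℝ` onto the tangent space of `ℍ² × ℝ` at `P`. -/
def ambientProj (P V : Fin 4 → ℝ) : Fin 4 → ℝ :=
  V + lorentz V (ambientNormal P) • ambientNormal P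

/-- Hyperbolic distance in `ℍ²` (of the first three coordinates): `cosh d = -⟨p, q⟩`. -/
def hypDist (P Q : Fin 4 → ℝ) : ℝ :=
  Real.arcosh (-(P 0 * Q 0 + P 1 * Q 1 - P 2 * Q 2))

/-- Riemannian distance of the product `ℍ² × ℝ`. -/
def ambientDist (P Q : Fin 4 → ℝ) : ℝ :=
  Real.sqrt (hypDist P Q ^ 2 + (P 3 - Q 3) ^ 2)

/-- `Φ` restricts to an isometry of `ℍ² × ℝ` onto itself (its values elsewhere are irrelevant). -/
def IsAmbientIsometry (Φ : (Fin 4 → ℝ) → (Fin 4 → ℝ)) : Prop :=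
  Set.BijOn Φ H2R H2R ∧ ∀ P ∈ H2R, ∀ Q ∈ H2R, ambientDist (Φ P) (Φ Q) = ambientDist P Q

/-! ### Gaussian curvature of a metric in coordinates -/

/-- Partial derivative in the `i`-th coordinate of the plane. -/
def pd {V : Type*} [NormedAddCommGroup V] [NormedSpace ℝ V] (i : Fin 2)
    (f : EuclideanSpace ℝ (Fin 2) → V) (u : EuclideanSpace ℝ (Fin 2)) : V :=
  fderiv ℝ f u (EuclideanSpace.single i 1)

/-- Christoffel symbols `Γᵏᵢⱼ` of the metric with coefficients `g`. -/
def christoffel (g : EuclideanSpace ℝ (Fin 2) → Matrix (Fin 2) (Fin 2) ℝ) (k i j : Fin 2)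
    (u : EuclideanSpace ℝ (Fin 2)) : ℝ :=
  (1 / 2) * ∑ l, (g u)⁻¹ k l *
    (pd i (fun w => g w j l) u + pd j (fun w => g w i l) u - pd l (fun w => g w i j) u)

/-- The `l`-th component of `R(∂ᵢ, ∂ⱼ)∂ₖ`, where `R(X, Y) = [∇_X, ∇_Y] - ∇_[X,Y]`. -/
def riemann (g : EuclideanSpace ℝ (Fin 2) → Matrix (Fin 2) (Fin 2) ℝ) (l k i j : Fin 2)
    (u : EuclideanSpace ℝ (Fin 2)) : ℝ :=
  pd i (christoffel g l j k) u - pd j (christoffel g l i k) u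
    + ∑ m, (christoffel g l i m u * christoffel g m j k u
      - christoffel g l j m u * christoffel g m i k u)

/-- Gaussian curvature `K = g(R(∂₁, ∂₂)∂₂, ∂₁) / det g`. -/
def gaussCurvature (g : EuclideanSpace ℝ (Fin 2) → Matrix (Fin 2) (Fin 2) ℝ)
    (u : EuclideanSpace ℝ (Fin 2)) : ℝ :=
  (∑ l, riemann g l 1 0 1 u * g u l 0) / (g u).det

/-! ### Surfaces in `ℍ² × ℝ` -/

section Surface

variable {M : Type*} [TopologicalSpace M] [ChartedSpace (EuclideanSpace ℝ (Fin 2)) M]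

/-- The differential at `p` of a map from the surface to `ℝ³₁ × ℝ`. -/
def diffAt (F : M → Fin 4 → ℝ) (p : M) : TangentSpace (𝓡 2) p →L[ℝ] (Fin 4 → ℝ) :=
  mfderiv (𝓡 2) 𝓘(ℝ, Fin 4 → ℝ) F p

/-- `F` is a smooth immersion of the surface `M` into `ℍ² × ℝ`. -/
def IsImmersedSurface (F : M → Fin 4 → ℝ) : Prop :=
  ContMDiff (𝓡 2) 𝓘(ℝ, Fin 4 → ℝ) ∞ F ∧ (∀ p, F p ∈ H2R) ∧
    ∀ p, Function.Injective (diffAt F p)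

/-- `ξ` is a smooth unit normal field along `F`, tangent to `ℍ² × ℝ`. -/
def IsUnitNormal (F ξ : M → Fin 4 → ℝ) : Prop :=
  ContMDiff (𝓡 2) 𝓘(ℝ, Fin 4 → ℝ) ∞ ξ ∧
    ∀ p, lorentz (ξ p) (ξ p) = 1 ∧ lorentz (ξ p) (ambientNormal (F p)) = 0 ∧
      ∀ X : TangentSpace (𝓡 2) p, lorentz (ξ p) (diffAt F p X) = 0

/-- The angle function `θ ∈ [0, π]`, determined by `cos θ = ⟨∂_t, ξ⟩`. -/
def angle (ξ : M → Fin 4 → ℝ) (p : M) : ℝ :=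
  Real.arccos (lorentz dt (ξ p))

/-- The tangential part of `∂_t`: `T = ∂_t - cos θ ξ`, as a vector of `ℝ³₁ × ℝ`. -/
def tangentPart (ξ : M → Fin 4 → ℝ) (p : M) : Fin 4 → ℝ :=
  dt - Real.cos (angle ξ p) • ξ p

/-- The shape operator `A X = -∇̃_X ξ`, with values in `ℝ³₁ × ℝ`; here `∇̃`, the Levi-Civita
connection of `ℍ² × ℝ`, is the tangential part of the flat connection. -/
def shapeOperator (F ξ : M → Fin 4 → ℝ) (p : M) (X : TangentSpace (𝓡 2) p) : Fin 4 → ℝ :=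
  -ambientProj (F p) (diffAt ξ p X)

/-- `T` is a principal direction: at each point it is an eigenvector of the shape operator. -/
def IsPrincipalT (F ξ : M → Fin 4 → ℝ) : Prop :=
  ∀ p, ∃ (X : TangentSpace (𝓡 2) p) (κ : ℝ), X ≠ 0 ∧ diffAt F p X = tangentPart ξ p ∧
    shapeOperator F ξ p X = κ • diffAt F p X

/-- Coefficients `g(∂ᵢ, ∂ⱼ)` of the induced metric in the chart `e`. -/
def metricCoeff (F : M → Fin 4 → ℝ) (e : OpenPartialHomeomorph M (EuclideanSpace ℝ (Fin 2)))
    (u : EuclideanSpace ℝ (Fin 2)) : Matrix (Fin 2) (Fin 2) ℝ :=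
  Matrix.of fun i j => lorentz (pd i (F ∘ e.symm) u) (pd j (F ∘ e.symm) u)

/-- The induced metric is flat: its Gaussian curvature vanishes, in every chart. -/
def IsFlatSurface (F : M → Fin 4 → ℝ) : Prop :=
  ∀ e ∈ IsManifold.maximalAtlas (𝓡 2) ∞ M, ∀ u ∈ e.target, gaussCurvature (metricCoeff F e) u = 0

end Surface

/-! ### The explicit immersions -/

/-- The indefinite integral of `√(τ² + c) / √(τ² + c + 1)`, taken from the left end of the
interval `x > 0`, `x² + c > 0`. Another primitive changes the immersions below by a translation
along `ℝ`. -/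
def chi (c x : ℝ) : ℝ :=
  ∫ τ in (Real.sqrt (max 0 (-c)))..x, Real.sqrt (τ ^ 2 + c) / Real.sqrt (τ ^ 2 + c + 1)

/-- The immersion used for `c > -1`. -/
def immersionA (c x y : ℝ) : Fin 4 → ℝ :=
  ![x / Real.sqrt (c + 1) * Real.cos y, x / Real.sqrt (c + 1) * Real.sin y,
    Real.sqrt (x ^ 2 + c + 1) / Real.sqrt (c + 1), chi c x]

/-- The immersion used for `c < -1`. -/
def immersionB (c x y : ℝ) : Fin 4 → ℝ :=
  ![Real.sqrt (x ^ 2 + c + 1) / Real.sqrt (-c - 1), x / Real.sqrt (-c - 1) * Real.sinh y,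
    x / Real.sqrt (-c - 1) * Real.cosh y, chi c x]

/-- The immersion used for `c = -1`. -/
def immersionC (c x y : ℝ) : Fin 4 → ℝ :=
  ![x * y, x / 2 * (1 - y ^ 2) - 1 / (2 * x), x / 2 * (1 + y ^ 2) + 1 / (2 * x), chi c x]

/-- `G` is the explicit immersion belonging to the constant `c`. -/
def IsModel (c : ℝ) (G : ℝ → ℝ → Fin 4 → ℝ) : Prop :=
  (-1 < c ∧ G = immersionA c) ∨ (c < -1 ∧ G = immersionB c) ∨ (c = -1 ∧ G = immersionC c)

section Representation

variable {M : Type*} [TopologicalSpace M] [ChartedSpace (EuclideanSpace ℝ (Fin 2)) M]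

/-- In the local coordinates `(x, y)` given by the chart `e`, which take values in
`{x > 0, x² + c > 0}`, the map `F` is `(x, y) ↦ Φ (G x y)`. -/
def IsRepresentation (F : M → Fin 4 → ℝ) (c : ℝ) (Φ : (Fin 4 → ℝ) → (Fin 4 → ℝ))
    (G : ℝ → ℝ → Fin 4 → ℝ) (e : OpenPartialHomeomorph M (EuclideanSpace ℝ (Fin 2))) : Prop :=
  e ∈ IsManifold.maximalAtlas (𝓡 2) ∞ M ∧
    ∀ q ∈ e.source, 0 < e q 0 ∧ 0 < e q 0 ^ 2 + c ∧ F q = Φ (G (e q 0) (e q 1))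

end Representation

end

noncomputable section

/-! ### Algebra of the scalar product -/

/-! Write C = cos θ, let N be the horizontal position vector and let κ be the principal curvature of
T. The Gauss equation reads K = det A - C². If T is principal and K = 0, the other principal
curvature is λ = C²/κ; in particular κ ≠ 0 because C ≠ 0. The shape operator is then known
completely: the differential of C is -κ times that of the height (`deriv_cos`), and symmetry of the
second derivatives of ξ yields the differential of λ (`codazzi`).

With μ = (κ - λ)/(1 - C²), both the vector λN + ξ - C∂_t and the scalar λC satisfy du = μC u dt.
Their quotient W, a vector of ℝ³₁, is therefore constant on the connected surface
(`hasFDerivAt_axisVector`), and it is the axis of symmetry. Put c = -⟨W,W⟩ - 1: the cases c > -1, c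
< -1 and c = -1 say that W is timelike, spacelike or lightlike. From ⟨N,W⟩ = -1/C and the value of
⟨W,W⟩ one gets x² := 1/C² - c - 1 = (1 - C²)κ²/C⁶ > 0 and x² + c = tan²θ > 0. The derivative of χ at
x is sin θ, so the height equals ±χ(x) up to a constant, the sign being that of κC
(`hasFDerivAt_height_sub_chi`).

A Lorentz frame carries W, up to sign, to the axis of the model (`exists_lorentzFrame`). The points
of ℍ² with a given product with the axis form an orbit of its stabilizer, a circle, an equidistant
curve or a horocycle, and y is the parameter along it (`exists_modelCoordinate`). Since F is an
immersion factoring through (x, y), the pair (x, y) is a chart by the inverse function theorem.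

For the converse Φ is only known to preserve distances. Vertical lines have a purely metric
description, equality in the semi-parallelogram law, so Φ splits as a product and is affine
(`IsAmbientIsometry.exists_lorentzMap`). A moving frame on the models then exhibits ∂_x as the
direction of T and principal curvatures whose product is cos²θ, hence flatness; it also gives the
formula for θ. -/

theorem lorentz_comm (u v : Fin 4 → ℝ) : lorentz u v = lorentz v u := by
  simp only [lorentz]; ring

@[simp] theorem lorentz_add_left (u v w : Fin 4 → ℝ) :
    lorentz (u + v) w = lorentz u w + lorentz v w := by
  simp only [lorentz, Pi.add_apply]; ring

@[simp] theorem lorentz_add_right (u v w : Fin 4 → ℝ) :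
    lorentz u (v + w) = lorentz u v + lorentz u w := by
  simp only [lorentz, Pi.add_apply]; ring

@[simp] theorem lorentz_sub_left (u v w : Fin 4 → ℝ) :
    lorentz (u - v) w = lorentz u w - lorentz v w := by
  simp only [lorentz, Pi.sub_apply]; ring

@[simp] theorem lorentz_sub_right (u v w : Fin 4 → ℝ) :
    lorentz u (v - w) = lorentz u v - lorentz u w := by
  simp only [lorentz, Pi.sub_apply]; ring

@[simp] theorem lorentz_neg_left (u v : Fin 4 → ℝ) : lorentz (-u) v = -lorentz u v := by
  simp only [lorentz, Pi.neg_apply]; ring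

@[simp] theorem lorentz_neg_right (u v : Fin 4 → ℝ) : lorentz u (-v) = -lorentz u v := by
  simp only [lorentz, Pi.neg_apply]; ring

@[simp] theorem lorentz_smul_left (a : ℝ) (u v : Fin 4 → ℝ) :
    lorentz (a • u) v = a * lorentz u v := by
  simp only [lorentz, Pi.smul_apply, smul_eq_mul]; ring

@[simp] theorem lorentz_smul_right (a : ℝ) (u v : Fin 4 → ℝ) :
    lorentz u (a • v) = a * lorentz u v := by
  simp only [lorentz, Pi.smul_apply, smul_eq_mul]; ring

@[simp] theorem lorentz_zero_left (v : Fin 4 → ℝ) : lorentz 0 v = 0 := by simp [lorentz]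

theorem lorentz_dt_left (v : Fin 4 → ℝ) : lorentz dt v = v 3 := by simp [lorentz, dt]

theorem lorentz_dt_right (v : Fin 4 → ℝ) : lorentz v dt = v 3 := by simp [lorentz, dt]

@[simp] theorem lorentz_dt_dt : lorentz dt dt = 1 := by simp [lorentz, dt]

@[simp] theorem lorentz_dt_ambientNormal (P : Fin 4 → ℝ) : lorentz dt (ambientNormal P) = 0 := by
  simp [lorentz, dt, ambientNormal]

@[simp] theorem lorentz_ambientNormal_dt (P : Fin 4 → ℝ) : lorentz (ambientNormal P) dt = 0 := by
  simp [lorentz, dt, ambientNormal]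

theorem ambientNormal_eq (P : Fin 4 → ℝ) : ambientNormal P = P - P 3 • dt := by
  ext i; fin_cases i <;> simp [ambientNormal, dt]

theorem lorentz_ambientNormal_self {P : Fin 4 → ℝ} (hP : P ∈ H2R) :
    lorentz (ambientNormal P) (ambientNormal P) = -1 := by
  have := hP.1
  simp [lorentz, ambientNormal]; linarith

theorem mem_H2R_iff (P : Fin 4 → ℝ) :
    P ∈ H2R ↔ lorentz (ambientNormal P) (ambientNormal P) = -1 ∧ 0 < P 2 := by
  simp only [H2R, Set.mem_ofPred_eq, lorentz, ambientNormal]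
  simp
  intro _
  constructor <;> intro h <;> linarith

/-- The scalar product is positive on the tangent spaces of `ℍ² × ℝ`. -/
theorem lorentz_tangent_bound {P u : Fin 4 → ℝ} (hP : P ∈ H2R)
    (hu : lorentz u (ambientNormal P) = 0) :
    u 0 ^ 2 + u 1 ^ 2 ≤ (u 0 ^ 2 + u 1 ^ 2 - u 2 ^ 2) * P 2 ^ 2 := by
  obtain ⟨h1, h2⟩ := hP
  simp [lorentz, ambientNormal] at hu
  have h3 : u 2 * P 2 = u 0 * P 0 + u 1 * P 1 := by linarith
  have h4 : u 2 ^ 2 * P 2 ^ 2 = (u 0 * P 0 + u 1 * P 1) ^ 2 := by rw [← h3]; ring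
  have h5 : P 2 ^ 2 = 1 + P 0 ^ 2 + P 1 ^ 2 := by linarith
  have h6 : (u 0 ^ 2 + u 1 ^ 2 - u 2 ^ 2) * P 2 ^ 2
    = (u 0 ^ 2 + u 1 ^ 2) * (1 + P 0 ^ 2 + P 1 ^ 2) - (u 0 * P 0 + u 1 * P 1) ^ 2 := by
    rw [sub_mul, h4, h5]
  rw [h6]
  -- The right side exceeds the left side by exactly this square.
  nlinarith [sq_nonneg (u 0 * P 1 - u 1 * P 0)]

theorem horizontal_nonneg {P u : Fin 4 → ℝ} (hP : P ∈ H2R)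
    (hu : lorentz u (ambientNormal P) = 0) : 0 ≤ u 0 ^ 2 + u 1 ^ 2 - u 2 ^ 2 := by
  have h := lorentz_tangent_bound hP hu
  have h2 : 0 < P 2 ^ 2 := pow_pos hP.2 2
  by_contra! hneg
  nlinarith [sq_nonneg (u 0), sq_nonneg (u 1), mul_pos_of_neg_of_neg hneg (neg_lt_zero.mpr h2)]

theorem lorentz_tangent_pos {P u : Fin 4 → ℝ} (hP : P ∈ H2R)
    (hu : lorentz u (ambientNormal P) = 0) (h0 : u ≠ 0) : 0 < lorentz u u := by
  have h := lorentz_tangent_bound hP hu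
  have hn := horizontal_nonneg hP hu
  have hl : lorentz u u = (u 0 ^ 2 + u 1 ^ 2 - u 2 ^ 2) + u 3 ^ 2 := by simp only [lorentz]; ring
  by_contra! hle
  rw [hl] at hle
  have e3 : u 3 = 0 := by
    have : u 3 ^ 2 ≤ 0 := by linarith
    exact pow_eq_zero_iff (two_ne_zero) |>.1 (le_antisymm this (sq_nonneg _))
  have e4 : u 0 ^ 2 + u 1 ^ 2 - u 2 ^ 2 = 0 := by nlinarith [sq_nonneg (u 3)]
  rw [e4, zero_mul] at h
  have e0 : u 0 = 0 := by nlinarith [sq_nonneg (u 0), sq_nonneg (u 1)]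
  have e1 : u 1 = 0 := by nlinarith [sq_nonneg (u 0), sq_nonneg (u 1)]
  have e2 : u 2 = 0 := by
    rw [e0, e1] at e4; nlinarith
  apply h0
  ext i; fin_cases i <;> simpa

/-- Expansion of a vector in an orthogonal basis. -/
theorem orthogonal_expansion (a b c d u : Fin 4 → ℝ)
    (hab : lorentz a b = 0) (hac : lorentz a c = 0) (had : lorentz a d = 0)
    (hbc : lorentz b c = 0) (hbd : lorentz b d = 0) (hcd : lorentz c d = 0)
    (ha : lorentz a a ≠ 0) (hb : lorentz b b ≠ 0) (hc : lorentz c c ≠ 0) (hd : lorentz d d ≠ 0) :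
    u = (lorentz u a / lorentz a a) • a + (lorentz u b / lorentz b b) • b
      + (lorentz u c / lorentz c c) • c + (lorentz u d / lorentz d d) • d := by
  have hli : LinearIndependent ℝ ![a, b, c, d] := by
    rw [Fintype.linearIndependent_iff]
    intro g hg
    simp only [Fin.sum_univ_four, Matrix.cons_val] at hg
    have key : ∀ w, g 0 * lorentz a w + g 1 * lorentz b w + g 2 * lorentz c w
        + g 3 * lorentz d w = 0 := by
      intro w
      have := congrArg (fun z => lorentz z w) hg
      simpa using this
    have ka := key a
    have kb := key b
    have kc := key c
    have kd := key d
    rw [lorentz_comm b a, lorentz_comm c a, lorentz_comm d a, hab, hac, had] at ka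
    rw [lorentz_comm c b, lorentz_comm d b, hab, hbc, hbd] at kb
    rw [lorentz_comm d c, hac, hbc, hcd] at kc
    rw [had, hbd, hcd] at kd
    simp only [mul_zero, add_zero, zero_add, mul_eq_zero] at ka kb kc kd
    intro i
    fin_cases i
    · exact ka.resolve_right ha
    · exact kb.resolve_right hb
    · exact kc.resolve_right hc
    · exact kd.resolve_right hd
  have hspan : u ∈ Submodule.span ℝ (Set.range ![a, b, c, d]) := by
    rw [hli.span_eq_top_of_card_eq_finrank (by simp)]; trivial
  obtain ⟨g, hg⟩ := (Submodule.mem_span_range_iff_exists_fun ℝ).1 hspan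
  simp only [Fin.sum_univ_four, Matrix.cons_val] at hg
  subst hg
  simp only [lorentz_add_left, lorentz_smul_left, lorentz_comm b a, lorentz_comm c a,
    lorentz_comm d a, lorentz_comm c b, lorentz_comm d b, lorentz_comm d c, hab, hac, had, hbc,
    hbd, hcd, mul_zero, add_zero, zero_add]
  rw [mul_div_cancel_right₀ _ ha, mul_div_cancel_right₀ _ hb, mul_div_cancel_right₀ _ hc,
    mul_div_cancel_right₀ _ hd]

theorem lorentz_nondegenerate {u : Fin 4 → ℝ} (h : ∀ v, lorentz u v = 0) : u = 0 := by
  have h0 := h ![1, 0, 0, 0]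
  have h1 := h ![0, 1, 0, 0]
  have h2 := h ![0, 0, 1, 0]
  have h3 := h ![0, 0, 0, 1]
  simp [lorentz] at h0 h1 h2 h3
  ext i; fin_cases i <;> simpa

/-! ### The scalar product as a continuous bilinear map -/

/-- The scalar product as a continuous bilinear map. -/
def lorentzL : (Fin 4 → ℝ) →L[ℝ] (Fin 4 → ℝ) →L[ℝ] ℝ :=
  LinearMap.toContinuousLinearMap
    ((LinearMap.toContinuousLinearMap : _ ≃ₗ[ℝ] _).toLinearMap ∘ₗ
      LinearMap.mk₂ ℝ lorentz lorentz_add_left lorentz_smul_left lorentz_add_right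
        lorentz_smul_right)

@[simp] theorem lorentzL_apply (u v : Fin 4 → ℝ) : lorentzL u v = lorentz u v := rfl

theorem HasFDerivAt.lorentz {E : Type*} [NormedAddCommGroup E] [NormedSpace ℝ E]
    {f g : E → Fin 4 → ℝ} {f' g' : E →L[ℝ] (Fin 4 → ℝ)} {u : E}
    (hf : HasFDerivAt f f' u) (hg : HasFDerivAt g g' u) :
    HasFDerivAt (fun w => _root_.lorentz (f w) (g w))
      ((lorentzL (f u)).comp g' + (lorentzL (g u)).comp f') u := by
  have := lorentzL.hasFDerivAt_of_bilinear hf hg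
  refine HasFDerivAt.congr_fderiv this ?_
  ext X
  simp [lorentz_comm _ (g u)]

theorem ContDiffOn.lorentz {E : Type*} [NormedAddCommGroup E] [NormedSpace ℝ E]
    {f g : E → Fin 4 → ℝ} {s : Set E} {n : WithTop ℕ∞}
    (hf : ContDiffOn ℝ n f s) (hg : ContDiffOn ℝ n g s) :
    ContDiffOn ℝ n (fun w => _root_.lorentz (f w) (g w)) s := by
  have := (lorentzL.isBoundedBilinearMap.contDiff (n := n)).comp_contDiffOn (hf.prodMk hg)
  exact this

/-- The projection `P ↦ (P₁, P₂, P₃, 0)` as a continuous linear map. -/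
def ambientNormalL : (Fin 4 → ℝ) →L[ℝ] (Fin 4 → ℝ) :=
  ContinuousLinearMap.id ℝ _ - (ContinuousLinearMap.proj (R := ℝ) (φ := fun _ : Fin 4 => ℝ) 3).smulRight
    dt

@[simp] theorem ambientNormalL_apply (P : Fin 4 → ℝ) : ambientNormalL P = ambientNormal P := by
  rw [ambientNormal_eq]; rfl


/-! ### Calculus in the coordinate plane -/

/-- The coordinate plane. -/
abbrev Plane := EuclideanSpace ℝ (Fin 2)

section Calculus

variable {V : Type*} [NormedAddCommGroup V] [NormedSpace ℝ V] {U : Set Plane} {u : Plane}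

theorem plane_eq (X : Plane) :
    X = X 0 • EuclideanSpace.single 0 1 + X 1 • EuclideanSpace.single 1 1 := by
  ext i; fin_cases i <;> simp

theorem fderiv_apply_eq_pd (f : Plane → V) (u X : Plane) :
    fderiv ℝ f u X = X 0 • pd 0 f u + X 1 • pd 1 f u := by
  conv_lhs => rw [plane_eq X]
  rw [map_add, map_smul, map_smul]; rfl

theorem HasFDerivAt.pd {f : Plane → V} {f' : Plane →L[ℝ] V} (h : HasFDerivAt f f' u) (i : Fin 2) :
    _root_.pd i f u = f' (EuclideanSpace.single i 1) := by
  rw [_root_.pd, h.fderiv]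

theorem ContDiffOn.hasFDerivAt' {f : Plane → V} (hU : IsOpen U) (hf : ContDiffOn ℝ ∞ f U)
    (hu : u ∈ U) : HasFDerivAt f (fderiv ℝ f u) u :=
  ((hf.contDiffAt (hU.mem_nhds hu)).differentiableAt (by simp)).hasFDerivAt

theorem ContDiffOn.pd {f : Plane → V} (hU : IsOpen U) (hf : ContDiffOn ℝ ∞ f U) (i : Fin 2) :
    ContDiffOn ℝ ∞ (_root_.pd i f) U :=
  (hf.fderiv_of_isOpen (m := ∞) hU (by simp)).clm_apply contDiffOn_const

theorem pd_congr {f g : Plane → V} (hU : IsOpen U) (hu : u ∈ U) (h : Set.EqOn f g U) (i : Fin 2) :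
    pd i f u = pd i g u := by
  have : f =ᶠ[nhds u] g := Filter.eventuallyEq_of_mem (hU.mem_nhds hu) h
  rw [pd, pd, this.fderiv_eq]

theorem pd_comm {f : Plane → V} (hU : IsOpen U) (hf : ContDiffOn ℝ ∞ f U) (hu : u ∈ U)
    (i j : Fin 2) : pd i (pd j f) u = pd j (pd i f) u := by
  have hs : IsSymmSndFDerivAt ℝ f u :=
    (hf.contDiffAt (hU.mem_nhds hu)).isSymmSndFDerivAt (by
      rw [minSmoothness_of_isRCLikeNormedField]; exact ENat.LEInfty.out)
  have hd : DifferentiableAt ℝ (fderiv ℝ f) u :=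
    ((hf.fderiv_of_isOpen (m := ∞) hU (by simp)).contDiffAt (hU.mem_nhds hu)).differentiableAt
      (by simp)
  have key : ∀ a b : Fin 2, pd a (pd b f) u
      = fderiv ℝ (fderiv ℝ f) u (EuclideanSpace.single a 1) (EuclideanSpace.single b 1) := by
    intro a b
    have h := (hd.hasFDerivAt.clm_apply
      (hasFDerivAt_const (EuclideanSpace.single b (1 : ℝ)) u)).pd a
    exact h.trans (by simp)
  rw [key, key, hs.eq]

theorem pd_lorentz {f g : Plane → Fin 4 → ℝ} (hf : DifferentiableAt ℝ f u)
    (hg : DifferentiableAt ℝ g u) (i : Fin 2) :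
    pd i (fun w => lorentz (f w) (g w)) u = lorentz (pd i f u) (g u) + lorentz (f u) (pd i g u) := by
  rw [(hf.hasFDerivAt.lorentz hg.hasFDerivAt).pd i]
  simp [lorentz_comm (g u), pd, add_comm]

theorem pd_mul {f g : Plane → ℝ} (hf : DifferentiableAt ℝ f u)
    (hg : DifferentiableAt ℝ g u) (i : Fin 2) :
    pd i (fun w => f w * g w) u = pd i f u * g u + f u * pd i g u := by
  have h := (hf.hasFDerivAt.mul hg.hasFDerivAt).pd i
  refine h.trans ?_
  simp [pd]; ring

theorem pd_smul {f : Plane → ℝ} {g : Plane → V} (hf : DifferentiableAt ℝ f u)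
    (hg : DifferentiableAt ℝ g u) (i : Fin 2) :
    pd i (fun w => f w • g w) u = pd i f u • g u + f u • pd i g u := by
  have h := (hf.hasFDerivAt.smul hg.hasFDerivAt).pd i
  refine h.trans ?_
  simp [pd, add_comm]

theorem pd_add {f g : Plane → V} (hf : DifferentiableAt ℝ f u)
    (hg : DifferentiableAt ℝ g u) (i : Fin 2) :
    pd i (fun w => f w + g w) u = pd i f u + pd i g u :=
  (hf.hasFDerivAt.add hg.hasFDerivAt).pd i

theorem pd_sub {f g : Plane → V} (hf : DifferentiableAt ℝ f u)
    (hg : DifferentiableAt ℝ g u) (i : Fin 2) :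
    pd i (fun w => f w - g w) u = pd i f u - pd i g u :=
  (hf.hasFDerivAt.sub hg.hasFDerivAt).pd i

end Calculus

/-! ### Surfaces in coordinates -/

/-- Gram matrix of the coordinate vector fields. -/
def gram (f : Plane → Fin 4 → ℝ) (u : Plane) : Matrix (Fin 2) (Fin 2) ℝ :=
  Matrix.of fun i j => lorentz (pd i f u) (pd j f u)

theorem gram_apply (f : Plane → Fin 4 → ℝ) (u : Plane) (i j : Fin 2) :
    gram f u i j = lorentz (pd i f u) (pd j f u) := rfl

theorem gram_comm (f : Plane → Fin 4 → ℝ) (u : Plane) (i j : Fin 2) :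
    gram f u i j = gram f u j i := lorentz_comm _ _

/-- `f` is an immersion of the open set `U` into `ℍ² × ℝ` with unit normal field `n`. -/
structure IsLocalSurface (U : Set Plane) (f n : Plane → Fin 4 → ℝ) : Prop where
  isOpen : IsOpen U
  contDiffOn : ContDiffOn ℝ ∞ f U
  contDiffOn_normal : ContDiffOn ℝ ∞ n U
  mem : ∀ u ∈ U, f u ∈ H2R
  injective : ∀ u ∈ U, Function.Injective (fderiv ℝ f u)
  unit : ∀ u ∈ U, lorentz (n u) (n u) = 1
  normal_ambient : ∀ u ∈ U, lorentz (n u) (ambientNormal (f u)) = 0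
  normal_tangent : ∀ u ∈ U, ∀ X, lorentz (n u) (fderiv ℝ f u X) = 0

namespace IsLocalSurface

variable {U : Set Plane} {f n : Plane → Fin 4 → ℝ} (S : IsLocalSurface U f n) {u : Plane}
include S

theorem hasFDerivAt (hu : u ∈ U) : HasFDerivAt f (fderiv ℝ f u) u :=
  S.contDiffOn.hasFDerivAt' S.isOpen hu

theorem hasFDerivAt_normal (hu : u ∈ U) : HasFDerivAt n (fderiv ℝ n u) u :=
  S.contDiffOn_normal.hasFDerivAt' S.isOpen hu

theorem hasFDerivAt_ambientNormal (hu : u ∈ U) :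
    HasFDerivAt (fun w => ambientNormal (f w)) (ambientNormalL.comp (fderiv ℝ f u)) u := by
  simpa [Function.comp_def] using ambientNormalL.hasFDerivAt.comp u (S.hasFDerivAt hu)

theorem hasFDerivAt_height (hu : u ∈ U) (j : Fin 4) :
    HasFDerivAt (fun w => f w j) ((ContinuousLinearMap.proj j).comp (fderiv ℝ f u)) u :=
  (hasFDerivAt_pi'.1 (S.hasFDerivAt hu)) j

theorem hasFDerivAt_normal_apply (hu : u ∈ U) (j : Fin 4) :
    HasFDerivAt (fun w => n w j) ((ContinuousLinearMap.proj j).comp (fderiv ℝ n u)) u :=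
  (hasFDerivAt_pi'.1 (S.hasFDerivAt_normal hu)) j

theorem tangent_ambient (hu : u ∈ U) (X : Plane) :
    lorentz (fderiv ℝ f u X) (ambientNormal (f u)) = 0 := by
  have h1 := (S.hasFDerivAt_ambientNormal hu).lorentz (S.hasFDerivAt_ambientNormal hu)
  have h2 : HasFDerivAt (fun w => lorentz (ambientNormal (f w)) (ambientNormal (f w)))
      (0 : Plane →L[ℝ] ℝ) u := by
    refine (hasFDerivAt_const (-1 : ℝ) u).congr_of_eventuallyEq ?_
    exact Filter.eventuallyEq_of_mem (S.isOpen.mem_nhds hu)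
      fun w hw => lorentz_ambientNormal_self (S.mem w hw)
  have h3 := congrArg (fun L => L X) (h1.unique h2)
  simp only [add_apply, ContinuousLinearMap.comp_apply, lorentzL_apply,
    ambientNormalL_apply, zero_apply] at h3
  rw [ambientNormal_eq (fderiv ℝ f u X)] at h3
  simp only [lorentz_sub_right, lorentz_smul_right, lorentz_ambientNormal_dt] at h3
  rw [lorentz_comm]; linarith

theorem tangent_pos (hu : u ∈ U) {X : Plane} (hX : X ≠ 0) :
    0 < lorentz (fderiv ℝ f u X) (fderiv ℝ f u X) := by
  apply lorentz_tangent_pos (S.mem u hu) (S.tangent_ambient hu X)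
  intro h
  exact hX (S.injective u hu (by rw [h, map_zero]))

theorem deriv_normal_normal (hu : u ∈ U) (X : Plane) :
    lorentz (fderiv ℝ n u X) (n u) = 0 := by
  have h1 := (S.hasFDerivAt_normal hu).lorentz (S.hasFDerivAt_normal hu)
  have h2 : HasFDerivAt (fun w => lorentz (n w) (n w)) (0 : Plane →L[ℝ] ℝ) u := by
    refine (hasFDerivAt_const (1 : ℝ) u).congr_of_eventuallyEq ?_
    exact Filter.eventuallyEq_of_mem (S.isOpen.mem_nhds hu) fun w hw => S.unit w hw
  have h3 := congrArg (fun L => L X) (h1.unique h2)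
  simp only [add_apply, ContinuousLinearMap.comp_apply, lorentzL_apply,
    zero_apply] at h3
  rw [lorentz_comm]; linarith

theorem deriv_normal_ambient (hu : u ∈ U) (X : Plane) :
    lorentz (fderiv ℝ n u X) (ambientNormal (f u)) = n u 3 * fderiv ℝ f u X 3 := by
  have h1 := (S.hasFDerivAt_normal hu).lorentz (S.hasFDerivAt_ambientNormal hu)
  have h2 : HasFDerivAt (fun w => lorentz (n w) (ambientNormal (f w))) (0 : Plane →L[ℝ] ℝ) u := by
    refine (hasFDerivAt_const (0 : ℝ) u).congr_of_eventuallyEq ?_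
    exact Filter.eventuallyEq_of_mem (S.isOpen.mem_nhds hu) fun w hw => S.normal_ambient w hw
  have h3 := congrArg (fun L => L X) (h1.unique h2)
  simp only [add_apply, ContinuousLinearMap.comp_apply, lorentzL_apply,
    ambientNormalL_apply, zero_apply] at h3
  rw [ambientNormal_eq (fderiv ℝ f u X), lorentz_sub_right, lorentz_smul_right,
    S.normal_tangent u hu, lorentz_dt_right] at h3
  rw [lorentz_comm]; linarith

theorem differentiableAt_pd (hu : u ∈ U) (i : Fin 2) : DifferentiableAt ℝ (pd i f) u :=
  ((S.contDiffOn.pd S.isOpen i).hasFDerivAt' S.isOpen hu).differentiableAt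

theorem differentiableAt_pd_pd (hu : u ∈ U) (i j : Fin 2) :
    DifferentiableAt ℝ (pd i (pd j f)) u :=
  (((S.contDiffOn.pd S.isOpen j).pd S.isOpen i).hasFDerivAt' S.isOpen hu).differentiableAt

/-- The normal and timelike components of the second derivatives come from differentiating the
orthogonality relations; here ⟨∂ⱼf, n⟩ = 0, in the next lemma ⟨∂ⱼf, N⟩ = 0. -/
theorem pd_pd_normal (hu : u ∈ U) (i j : Fin 2) :
    lorentz (pd i (pd j f) u) (n u) = -lorentz (pd i n u) (pd j f u) := by
  have h := pd_lorentz (S.differentiableAt_pd hu j) (S.hasFDerivAt_normal hu).differentiableAt i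
  have h2 : pd i (fun w => lorentz (pd j f w) (n w)) u = pd i (fun _ => (0 : ℝ)) u :=
    pd_congr S.isOpen hu (fun w hw =>
      (lorentz_comm _ _).trans (S.normal_tangent w hw (EuclideanSpace.single j 1))) i
  rw [h2] at h
  simp only [pd, fderiv_fun_const, Pi.zero_apply, zero_apply] at h
  rw [lorentz_comm (pd i n u)]
  simp only [pd]
  linarith

theorem pd_pd_ambient (hu : u ∈ U) (i j : Fin 2) :
    lorentz (pd i (pd j f) u) (ambientNormal (f u))
      = -(gram f u i j - pd i f u 3 * pd j f u 3) := by
  have h := pd_lorentz (S.differentiableAt_pd hu j)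
    (S.hasFDerivAt_ambientNormal hu).differentiableAt i
  have h2 : pd i (fun w => lorentz (pd j f w) (ambientNormal (f w))) u
      = pd i (fun _ => (0 : ℝ)) u :=
    pd_congr S.isOpen hu (fun w hw => S.tangent_ambient hw (EuclideanSpace.single j 1)) i
  rw [h2, (S.hasFDerivAt_ambientNormal hu).pd i] at h
  have h3 : pd i (fun _ : Plane => (0 : ℝ)) u = 0 := by simp [pd]
  rw [h3] at h
  simp only [ContinuousLinearMap.comp_apply, ambientNormalL_apply] at h
  rw [ambientNormal_eq (fderiv ℝ f u _), lorentz_sub_right, lorentz_smul_right,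
    lorentz_dt_right, ← pd.eq_1, lorentz_comm (pd j f u)] at h
  rw [gram_apply]; linarith

theorem normal_symm (hu : u ∈ U) (X Y : Plane) :
    lorentz (fderiv ℝ n u X) (fderiv ℝ f u Y) = lorentz (fderiv ℝ n u Y) (fderiv ℝ f u X) := by
  have h01 : lorentz (pd 0 n u) (pd 1 f u) = lorentz (pd 1 n u) (pd 0 f u) := by
    have h := S.pd_pd_normal hu 0 1
    rw [pd_comm S.isOpen S.contDiffOn hu, S.pd_pd_normal hu 1 0] at h
    linarith
  simp only [fderiv_apply_eq_pd, lorentz_add_left, lorentz_add_right, lorentz_smul_left,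
    lorentz_smul_right]
  rw [h01]; ring

theorem gram_det_pos (hu : u ∈ U) : 0 < (gram f u).det := by
  have ne0 : (EuclideanSpace.single 0 1 : Plane) ≠ 0 := by simp
  have h00 : 0 < gram f u 0 0 := S.tangent_pos hu ne0
  -- The image of X is g₀₀ times the part of ∂₁f orthogonal to ∂₀f, so its squared length is g₀₀ det
  -- g.
  let X : Plane := (gram f u 0 0) • EuclideanSpace.single 1 1
    - (gram f u 0 1) • EuclideanSpace.single 0 1
  have hX : X ≠ 0 := by
    intro h
    have := congrArg (fun Z : Plane => Z 1) h
    simp [X] at this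
    exact h00.ne' this
  have h := S.tangent_pos hu hX
  have e : fderiv ℝ f u X = (gram f u 0 0) • pd 1 f u - (gram f u 0 1) • pd 0 f u := by
    simp [X, pd]
  rw [e] at h
  simp only [lorentz_sub_left, lorentz_sub_right, lorentz_smul_left, lorentz_smul_right,
    ← gram_apply, gram_comm f u 1 0] at h
  rw [Matrix.det_fin_two, gram_comm f u 1 0]
  by_contra! hn
  nlinarith

/-- A vector orthogonal to the surface is a combination of the two normals. -/
theorem eq_normal_part (hu : u ∈ U) {v : Fin 4 → ℝ} (h0 : lorentz v (pd 0 f u) = 0)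
    (h1 : lorentz v (pd 1 f u) = 0) :
    v = lorentz v (n u) • n u - lorentz v (ambientNormal (f u)) • ambientNormal (f u) := by
  have hg : 0 < gram f u 0 0 := S.tangent_pos hu (by simp)
  have hd := S.gram_det_pos hu
  have hta : ∀ i, lorentz (pd i f u) (ambientNormal (f u)) = 0 := fun i => S.tangent_ambient hu _
  have htn : ∀ i, lorentz (pd i f u) (n u) = 0 := fun i => by
    rw [lorentz_comm]; exact S.normal_tangent u hu _
  have hN := lorentz_ambientNormal_self (S.mem u hu)
  have hn := S.unit u hu
  have h := orthogonal_expansion (pd 0 f u)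
    ((gram f u 0 0) • pd 1 f u - (gram f u 0 1) • pd 0 f u) (n u) (ambientNormal (f u)) v
    (by simp only [lorentz_sub_right, lorentz_smul_right, ← gram_apply]; ring)
    (htn 0) (hta 0) (by simp [htn]) (by simp [hta]) (S.normal_ambient u hu)
    hg.ne' (by
      simp only [lorentz_sub_left, lorentz_sub_right, lorentz_smul_left, lorentz_smul_right,
        ← gram_apply, gram_comm f u 1 0]
      rw [Matrix.det_fin_two, gram_comm f u 1 0] at hd
      have := mul_pos hg hd
      apply ne_of_gt
      linarith) (by rw [hn]; norm_num) (by rw [hN]; norm_num)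
  rw [hN, hn] at h
  simp only [lorentz_sub_right, lorentz_smul_right, h0, h1] at h
  conv_lhs => rw [h]
  simp [div_neg, sub_eq_add_neg]

/-- This is |T|² = sin²θ with T written in the coordinate basis by the cofactors of the Gram matrix.
It is what turns the horizontal terms of the Gauss equation into cos²θ. -/
theorem angle_gram (hu : u ∈ U) :
    (gram f u).det * (1 - n u 3 ^ 2) = gram f u 1 1 * pd 0 f u 3 ^ 2
      - 2 * gram f u 0 1 * pd 0 f u 3 * pd 1 f u 3 + gram f u 0 0 * pd 1 f u 3 ^ 2 := by
  have hta : ∀ i, lorentz (pd i f u) (ambientNormal (f u)) = 0 := fun i => S.tangent_ambient hu _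
  have hnt : ∀ i, lorentz (n u) (pd i f u) = 0 := fun i => S.normal_tangent u hu _
  have htn : ∀ i, lorentz (pd i f u) (n u) = 0 := fun i => by rw [lorentz_comm]; exact hnt i
  -- det g times the difference between T and its cofactor expansion. It is orthogonal to both
  -- tangent vectors and to both normals, hence zero; its vertical component is the claim.
  let v := (gram f u).det • (dt - n u 3 • n u)
    - ((pd 0 f u 3 * gram f u 1 1 - pd 1 f u 3 * gram f u 0 1) • pd 0 f u
      + (pd 1 f u 3 * gram f u 0 0 - pd 0 f u 3 * gram f u 0 1) • pd 1 f u)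
  have hv : v = 0 := by
    have h := S.eq_normal_part hu (v := v)
      (by simp only [v, lorentz_sub_left, lorentz_smul_left, lorentz_add_left, hnt,
            lorentz_dt_left, ← gram_apply, Matrix.det_fin_two, gram_comm f u 1 0]
          ring)
      (by simp only [v, lorentz_sub_left, lorentz_smul_left, lorentz_add_left, hnt,
            lorentz_dt_left, ← gram_apply, Matrix.det_fin_two, gram_comm f u 1 0]
          ring)
    have e1 : lorentz v (n u) = 0 := by
      simp [v, htn, lorentz_dt_left, S.unit u hu]
    have e2 : lorentz v (ambientNormal (f u)) = 0 := by
      simp [v, hta, S.normal_ambient u hu]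
    rw [h, e1, e2]; simp
  have h := congrArg (fun z => lorentz z dt) hv
  simp only [v, lorentz_dt_right, Pi.sub_apply, Pi.add_apply, Pi.smul_apply, Pi.zero_apply,
    smul_eq_mul, show dt 3 = 1 from rfl] at h
  linear_combination h

end IsLocalSurface

/-! ### The Gauss equation -/

namespace IsLocalSurface

variable {U : Set Plane} {f n : Plane → Fin 4 → ℝ} (S : IsLocalSurface U f n) {u : Plane}
include S

theorem pd_gram (hu : u ∈ U) (l i j : Fin 2) :
    pd l (fun w => gram f w i j) u
      = lorentz (pd l (pd i f) u) (pd j f u) + lorentz (pd i f u) (pd l (pd j f) u) :=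
  pd_lorentz (S.differentiableAt_pd hu i) (S.differentiableAt_pd hu j) l

theorem contDiffOn_gram (i j : Fin 2) : ContDiffOn ℝ ∞ (fun w => gram f w i j) U :=
  (S.contDiffOn.pd S.isOpen i).lorentz (S.contDiffOn.pd S.isOpen j)

theorem contDiffOn_gram_inv (i j : Fin 2) : ContDiffOn ℝ ∞ (fun w => (gram f w)⁻¹ i j) U := by
  have hd : ContDiffOn ℝ ∞ (fun w => ((gram f w).det)⁻¹) U := by
    refine ContDiffOn.inv ?_ fun w hw => (S.gram_det_pos hw).ne'
    simp only [Matrix.det_fin_two]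
    exact ((S.contDiffOn_gram 0 0).mul (S.contDiffOn_gram 1 1)).sub
      ((S.contDiffOn_gram 0 1).mul (S.contDiffOn_gram 1 0))
  simp only [Matrix.inv_def, Ring.inverse_eq_inv', Matrix.smul_apply, smul_eq_mul,
    Matrix.adjugate_fin_two]
  refine hd.mul ?_
  fin_cases i <;> fin_cases j
  · exact S.contDiffOn_gram 1 1
  · exact (S.contDiffOn_gram 0 1).neg
  · exact (S.contDiffOn_gram 1 0).neg
  · exact S.contDiffOn_gram 0 0

/-- In the three-term Koszul combination the product rule and the symmetry of second partials leave
twice a single term. -/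
theorem christoffel_eq (hu : u ∈ U) (k i j : Fin 2) :
    christoffel (gram f) k i j u
      = ∑ l, (gram f u)⁻¹ k l * lorentz (pd i (pd j f) u) (pd l f u) := by
  rw [christoffel, Finset.mul_sum]
  refine Finset.sum_congr rfl fun l _ => ?_
  rw [S.pd_gram hu, S.pd_gram hu, S.pd_gram hu, pd_comm S.isOpen S.contDiffOn hu j i,
    pd_comm S.isOpen S.contDiffOn hu l i, pd_comm S.isOpen S.contDiffOn hu l j,
    lorentz_comm (pd j f u), lorentz_comm (pd i f u)]
  ring

theorem differentiableAt_christoffel (hu : u ∈ U) (k i j : Fin 2) :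
    DifferentiableAt ℝ (christoffel (gram f) k i j) u := by
  have h : ContDiffOn ℝ ∞
      (fun w => ∑ l, (gram f w)⁻¹ k l * lorentz (pd i (pd j f) w) (pd l f w)) U :=
    ContDiffOn.sum fun l _ => (S.contDiffOn_gram_inv k l).mul
      (((S.contDiffOn.pd S.isOpen j).pd S.isOpen i).lorentz (S.contDiffOn.pd S.isOpen l))
  have h2 := (h.hasFDerivAt' S.isOpen hu).differentiableAt
  refine h2.congr_of_eventuallyEq ?_
  exact Filter.eventuallyEq_of_mem (S.isOpen.mem_nhds hu) fun w hw => S.christoffel_eq hw k i j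

theorem gram_mul_christoffel (hu : u ∈ U) (l i j : Fin 2) :
    ∑ k, christoffel (gram f) k i j u * gram f u k l
      = lorentz (pd i (pd j f) u) (pd l f u) := by
  have hdet : IsUnit (gram f u).det := (S.gram_det_pos hu).ne'.isUnit
  have h := Matrix.mul_nonsing_inv _ hdet
  have e : ∀ m, ∑ k, gram f u l k * (gram f u)⁻¹ k m = (1 : Matrix (Fin 2) (Fin 2) ℝ) l m := by
    intro m; rw [← h, Matrix.mul_apply]
  calc ∑ k, christoffel (gram f) k i j u * gram f u k l
      = ∑ k, ∑ m, (gram f u l k * (gram f u)⁻¹ k m) * lorentz (pd i (pd j f) u) (pd m f u) := by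
        refine Finset.sum_congr rfl fun k _ => ?_
        rw [S.christoffel_eq hu, Finset.sum_mul, gram_comm f u k l]
        exact Finset.sum_congr rfl fun m _ => by ring
    _ = ∑ m, (1 : Matrix (Fin 2) (Fin 2) ℝ) l m * lorentz (pd i (pd j f) u) (pd m f u) := by
        rw [Finset.sum_comm]
        refine Finset.sum_congr rfl fun m _ => ?_
        rw [← e, Finset.sum_mul]
    _ = _ := by simp [Matrix.one_apply]

theorem pd_gram_mul_christoffel (hu : u ∈ U) (a i j : Fin 2) :
    ∑ l, (pd a (christoffel (gram f) l i j) u * gram f u l 0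
        + christoffel (gram f) l i j u * pd a (fun w => gram f w l 0) u)
      = lorentz (pd a (pd i (pd j f)) u) (pd 0 f u)
        + lorentz (pd i (pd j f) u) (pd a (pd 0 f) u) := by
  have h := pd_lorentz (S.differentiableAt_pd_pd hu i j) (S.differentiableAt_pd hu 0) a
  have hg : ∀ l, DifferentiableAt ℝ (fun w => gram f w l 0) u := fun l =>
    ((S.contDiffOn_gram l 0).hasFDerivAt' S.isOpen hu).differentiableAt
  have hc := fun l => S.differentiableAt_christoffel hu l i j
  rw [← h, ← pd_congr S.isOpen hu (fun w hw => S.gram_mul_christoffel hw 0 i j) a]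
  simp only [Fin.sum_univ_two]
  rw [pd_add ((hc 0).fun_mul (hg 0)) ((hc 1).fun_mul (hg 1)), pd_mul (hc 0) (hg 0),
    pd_mul (hc 1) (hg 1)]

/-- The connection of ℝ³₁ × ℝ is flat: the third derivatives of f cancel by symmetry, and what is
left pairs second derivatives with their parts normal to the surface. -/
theorem riemann_lowered (hu : u ∈ U) :
    ∑ l, riemann (gram f) l 1 0 1 u * gram f u l 0
      = lorentz (pd 0 (pd 0 f) u) (pd 1 (pd 1 f) u
          - ∑ l, christoffel (gram f) l 1 1 u • pd l f u)
        - lorentz (pd 0 (pd 1 f) u) (pd 0 (pd 1 f) u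
          - ∑ l, christoffel (gram f) l 0 1 u • pd l f u) := by
  have h1 := S.pd_gram_mul_christoffel hu 0 1 1
  have h2 := S.pd_gram_mul_christoffel hu 1 0 1
  have c3 : pd 0 (pd 1 (pd 1 f)) u = pd 1 (pd 0 (pd 1 f)) u :=
    pd_comm S.isOpen (S.contDiffOn.pd S.isOpen 1) hu 0 1
  have c2 : pd 1 (pd 0 f) u = pd 0 (pd 1 f) u := pd_comm S.isOpen S.contDiffOn hu 1 0
  have g00 := S.gram_mul_christoffel hu 0 0 0
  have g01 := S.gram_mul_christoffel hu 0 0 1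
  have g10 := S.gram_mul_christoffel hu 0 1 0
  have g11 := S.gram_mul_christoffel hu 0 1 1
  rw [c2] at g10
  simp only [Fin.sum_univ_two, S.pd_gram hu, c2, c3] at h1 h2 g00 g01 g10 g11 ⊢
  simp only [riemann, Fin.sum_univ_two, lorentz_sub_right, lorentz_add_right,
    lorentz_smul_right]
  rw [lorentz_comm (pd 0 f u) (pd 0 (pd 0 f) u),
    lorentz_comm (pd 1 f u) (pd 0 (pd 0 f) u)] at h1
  rw [lorentz_comm (pd 0 f u) (pd 0 (pd 1 f) u),
    lorentz_comm (pd 1 f u) (pd 0 (pd 1 f) u)] at h2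
  rw [lorentz_comm (pd 1 (pd 1 f) u) (pd 0 (pd 0 f) u)] at h1
  linear_combination h1 - h2 + christoffel (gram f) 0 1 1 u * g00
    + christoffel (gram f) 1 1 1 u * g01 - christoffel (gram f) 0 0 1 u * g10
    - christoffel (gram f) 1 0 1 u * g11

theorem second_derivative_normal_part (hu : u ∈ U) (i j : Fin 2) :
    pd i (pd j f) u - ∑ l, christoffel (gram f) l i j u • pd l f u
      = -lorentz (pd i n u) (pd j f u) • n u
        + (gram f u i j - pd i f u 3 * pd j f u 3) • ambientNormal (f u) := by
  have hta : ∀ i, lorentz (pd i f u) (ambientNormal (f u)) = 0 := fun i => S.tangent_ambient hu _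
  have htn : ∀ i, lorentz (pd i f u) (n u) = 0 := fun i => by
    rw [lorentz_comm]; exact S.normal_tangent u hu _
  have h0 : ∀ m, lorentz (pd i (pd j f) u - ∑ l, christoffel (gram f) l i j u • pd l f u)
      (pd m f u) = 0 := by
    intro m
    have h := S.gram_mul_christoffel hu m i j
    simp only [Fin.sum_univ_two] at h ⊢
    simp only [lorentz_sub_left, lorentz_add_left, lorentz_smul_left, ← gram_apply, ← h]
    ring
  rw [S.eq_normal_part hu (h0 0) (h0 1)]
  simp only [Fin.sum_univ_two, lorentz_sub_left, lorentz_add_left, lorentz_smul_left, hta, htn,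
    S.pd_pd_normal hu, S.pd_pd_ambient hu]
  simp only [mul_zero, add_zero, sub_zero, neg_smul, sub_neg_eq_add]

/-- Gauss equation. -/
theorem gaussCurvature_mul_det (hu : u ∈ U) :
    gaussCurvature (gram f) u * (gram f u).det
      = lorentz (pd 0 n u) (pd 0 f u) * lorentz (pd 1 n u) (pd 1 f u)
        - lorentz (pd 0 n u) (pd 1 f u) * lorentz (pd 1 n u) (pd 0 f u)
        - n u 3 ^ 2 * (gram f u).det := by
  rw [gaussCurvature, div_mul_cancel₀ _ (S.gram_det_pos hu).ne', S.riemann_lowered hu,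
    S.second_derivative_normal_part hu, S.second_derivative_normal_part hu]
  simp only [lorentz_add_right, lorentz_smul_right, S.pd_pd_normal hu, S.pd_pd_ambient hu]
  have hs := S.normal_symm hu (EuclideanSpace.single 0 1) (EuclideanSpace.single 1 1)
  have ha := S.angle_gram hu
  simp only [← pd.eq_1] at hs
  rw [← hs]
  rw [Matrix.det_fin_two, gram_comm f u 1 0] at ha ⊢
  -- The N-terms contribute minus the determinant of the horizontal form g - dt ⊗ dt, which
  -- `angle_gram` identifies with cos²θ det g.
  linear_combination -ha

/-- A surface is flat at a point iff its extrinsic curvature in the principal frame is `cos² θ`. -/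
theorem gaussCurvature_eq_zero_iff (hu : u ∈ U) {X Y : Plane} (hXY : X 0 * Y 1 - X 1 * Y 0 ≠ 0) :
    gaussCurvature (gram f) u = 0 ↔
      lorentz (fderiv ℝ n u X) (fderiv ℝ f u X) * lorentz (fderiv ℝ n u Y) (fderiv ℝ f u Y)
        - lorentz (fderiv ℝ n u X) (fderiv ℝ f u Y) * lorentz (fderiv ℝ n u Y) (fderiv ℝ f u X)
      = n u 3 ^ 2 * (lorentz (fderiv ℝ f u X) (fderiv ℝ f u X)
          * lorentz (fderiv ℝ f u Y) (fderiv ℝ f u Y)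
        - lorentz (fderiv ℝ f u X) (fderiv ℝ f u Y) ^ 2) := by
  have h := S.gaussCurvature_mul_det hu
  have hd := (S.gram_det_pos hu).ne'
  have key : (gaussCurvature (gram f) u * (gram f u).det) * (X 0 * Y 1 - X 1 * Y 0) ^ 2
      = (lorentz (fderiv ℝ n u X) (fderiv ℝ f u X) * lorentz (fderiv ℝ n u Y) (fderiv ℝ f u Y)
        - lorentz (fderiv ℝ n u X) (fderiv ℝ f u Y) * lorentz (fderiv ℝ n u Y) (fderiv ℝ f u X))
        - n u 3 ^ 2 * (lorentz (fderiv ℝ f u X) (fderiv ℝ f u X)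
          * lorentz (fderiv ℝ f u Y) (fderiv ℝ f u Y)
        - lorentz (fderiv ℝ f u X) (fderiv ℝ f u Y) ^ 2) := by
    rw [h, Matrix.det_fin_two]
    simp only [fderiv_apply_eq_pd, lorentz_add_left, lorentz_add_right, lorentz_smul_left,
      lorentz_smul_right, gram_apply, lorentz_comm (pd 1 f u) (pd 0 f u)]
    ring
  constructor
  · intro hK
    rw [hK, zero_mul, zero_mul] at key
    linarith
  · intro hE
    rw [hE, sub_self] at key
    simpa [hd, hXY] using key

end IsLocalSurface

/-! ### Flat surfaces with principal `T`, in coordinates -/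

theorem lorentz_ambientProj (P V : Fin 4 → ℝ) :
    ambientProj P V = V + lorentz V (ambientNormal P) • ambientNormal P := rfl

theorem differentiableAt_div_real {f g : Plane → ℝ} {u : Plane} (hf : DifferentiableAt ℝ f u)
    (hg : DifferentiableAt ℝ g u) (h : g u ≠ 0) : DifferentiableAt ℝ (fun w => f w / g w) u := by
  simpa only [div_eq_mul_inv] using hf.fun_mul (hg.fun_inv h)

theorem pd_apply_three {g : Plane → Fin 4 → ℝ} {u : Plane} (hg : DifferentiableAt ℝ g u)
    (i : Fin 2) : pd i (fun w => g w 3) u = pd i g u 3 := by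
  have h := ((hasFDerivAt_pi'.1 hg.hasFDerivAt) 3).pd i
  exact h

/-- `f` is a local surface whose field `T` is a principal direction of curvature `κ`, and whose
induced metric is flat. -/
structure IsFlatPrincipal (U : Set Plane) (f n : Plane → Fin 4 → ℝ) (κ : Plane → ℝ) : Prop
    extends IsLocalSurface U f n where
  cos_ne : ∀ u ∈ U, n u 3 ≠ 0
  principal : ∀ u ∈ U, ∃ Z, Z ≠ 0 ∧ fderiv ℝ f u Z = dt - n u 3 • n u ∧
    -ambientProj (f u) (fderiv ℝ n u Z) = κ u • fderiv ℝ f u Z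
  flat : ∀ u ∈ U, gaussCurvature (gram f) u = 0

namespace IsFlatPrincipal

variable {U : Set Plane} {f n : Plane → Fin 4 → ℝ} {κ : Plane → ℝ}
  (S : IsFlatPrincipal U f n κ) {u : Plane}
include S

theorem lorentz_T (hu : u ∈ U) (X : Plane) :
    lorentz (dt - n u 3 • n u) (fderiv ℝ f u X) = fderiv ℝ f u X 3 := by
  simp [lorentz_dt_left, S.normal_tangent u hu X]

theorem lorentz_T_T (hu : u ∈ U) :
    lorentz (dt - n u 3 • n u) (dt - n u 3 • n u) = 1 - n u 3 ^ 2 := by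
  simp [lorentz_dt_left, lorentz_dt_right, S.unit u hu, show dt 3 = 1 from rfl]; ring

theorem sin_sq_pos (hu : u ∈ U) : 0 < 1 - n u 3 ^ 2 := by
  obtain ⟨Z, hZ, hT, -⟩ := S.principal u hu
  rw [← S.lorentz_T_T hu, ← hT]
  exact S.tangent_pos hu hZ

/-- Derivative of the normal in the direction `T`. -/
theorem deriv_normal_T (hu : u ∈ U) {Z : Plane} (hT : fderiv ℝ f u Z = dt - n u 3 • n u)
    (hA : -ambientProj (f u) (fderiv ℝ n u Z) = κ u • fderiv ℝ f u Z) :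
    fderiv ℝ n u Z = -κ u • (dt - n u 3 • n u)
      - (n u 3 * (1 - n u 3 ^ 2)) • ambientNormal (f u) := by
  have h3 : fderiv ℝ f u Z 3 = 1 - n u 3 ^ 2 := by
    rw [← S.lorentz_T hu, hT, S.lorentz_T_T hu]
  rw [lorentz_ambientProj, S.deriv_normal_ambient hu, h3, hT] at hA
  rw [neg_smul, ← hA]; abel

/-- By symmetry of the shape operator the derivative of cos θ along X is -⟨AT, X⟩, and T is an
eigenvector. Thus cos θ varies only with the height. -/
theorem deriv_cos (hu : u ∈ U) (X : Plane) :
    fderiv ℝ n u X 3 = -κ u * fderiv ℝ f u X 3 := by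
  obtain ⟨Z, hZ, hT, hA⟩ := S.principal u hu
  have h := S.normal_symm hu Z X
  rw [S.deriv_normal_T hu hT hA, hT] at h
  simp only [lorentz_sub_left, lorentz_sub_right, lorentz_smul_left, lorentz_smul_right,
    lorentz_dt_left, lorentz_dt_right, S.deriv_normal_normal hu, S.normal_tangent u hu,
    lorentz_comm (ambientNormal (f u)), S.tangent_ambient hu] at h
  linarith

/-- The tangent vector orthogonal to T is principal as well, and flatness forces the product of the
two principal curvatures to be cos²θ. As cos θ ≠ 0, neither curvature vanishes. -/
theorem exists_frame (hu : u ∈ U) : ∃ Z Y : Plane, Z 0 * Y 1 - Z 1 * Y 0 ≠ 0 ∧ Y ≠ 0 ∧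
    fderiv ℝ f u Z = dt - n u 3 • n u ∧
    fderiv ℝ n u Z = -κ u • (dt - n u 3 • n u)
      - (n u 3 * (1 - n u 3 ^ 2)) • ambientNormal (f u) ∧
    fderiv ℝ f u Y 3 = 0 ∧ κ u ≠ 0 ∧ fderiv ℝ n u Y = -(n u 3 ^ 2 / κ u) • fderiv ℝ f u Y := by
  obtain ⟨Z, hZ, hT, hA⟩ := S.principal u hu
  have hnZ := S.deriv_normal_T hu hT hA
  have hs := S.sin_sq_pos hu
  have hZ3 : fderiv ℝ f u Z 3 = 1 - n u 3 ^ 2 := by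
    rw [← S.lorentz_T hu, hT, S.lorentz_T_T hu]
  -- Y spans the kernel of the height differential, so its image is orthogonal to T; its determinant
  -- with Z is the height derivative along Z, namely sin²θ.
  let Y : Plane := pd 0 f u 3 • EuclideanSpace.single 1 1
    - pd 1 f u 3 • EuclideanSpace.single 0 1
  have hY0 : Y 0 = -pd 1 f u 3 := by simp [Y]
  have hY1 : Y 1 = pd 0 f u 3 := by simp [Y]
  have hY3 : fderiv ℝ f u Y 3 = 0 := by
    rw [fderiv_apply_eq_pd, hY0, hY1]; simp; ring
  have hdet : Z 0 * Y 1 - Z 1 * Y 0 = 1 - n u 3 ^ 2 := by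
    rw [← hZ3, fderiv_apply_eq_pd, hY0, hY1]; simp
  have hY : Y ≠ 0 := by
    intro h
    rw [h] at hdet
    simp at hdet
    linarith
  have hYY := S.tangent_pos hu hY
  have hTY : lorentz (dt - n u 3 • n u) (fderiv ℝ f u Y) = 0 := by rw [S.lorentz_T hu, hY3]
  have hTT := S.lorentz_T_T hu
  have hNT : lorentz (dt - n u 3 • n u) (ambientNormal (f u)) = 0 := by
    rw [← hT]; exact S.tangent_ambient hu Z
  have hnT : lorentz (dt - n u 3 • n u) (n u) = 0 := by
    rw [← hT, lorentz_comm]; exact S.normal_tangent u hu Z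
  have hYZ : lorentz (fderiv ℝ n u Y) (dt - n u 3 • n u) = 0 := by
    rw [← hT, S.normal_symm hu, hnZ, lorentz_sub_left, lorentz_smul_left, lorentz_smul_left,
      hTY, lorentz_comm (ambientNormal _), S.tangent_ambient hu]
    simp
  have hN := lorentz_ambientNormal_self (S.mem u hu)
  have hexp := orthogonal_expansion (dt - n u 3 • n u) (fderiv ℝ f u Y) (n u)
    (ambientNormal (f u)) (fderiv ℝ n u Y) hTY hnT hNT
    (by rw [lorentz_comm]; exact S.normal_tangent u hu Y) (S.tangent_ambient hu Y)
    (S.normal_ambient u hu) (by rw [hTT]; exact hs.ne') hYY.ne'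
    (by rw [S.unit u hu]; norm_num) (by rw [hN]; norm_num)
  rw [hYZ, S.deriv_normal_normal hu, S.deriv_normal_ambient hu, hY3] at hexp
  simp only [zero_div, mul_zero, zero_smul, zero_add, add_zero] at hexp
  set l := lorentz (fderiv ℝ n u Y) (fderiv ℝ f u Y) / lorentz (fderiv ℝ f u Y) (fderiv ℝ f u Y)
    with hl
  have hG := (S.gaussCurvature_eq_zero_iff hu (X := Z) (Y := Y)
    (by rw [hdet]; exact hs.ne')).1 (S.flat u hu)
  rw [hexp, hnZ, hT] at hG
  simp only [lorentz_sub_left (-κ u • _), lorentz_smul_left, hTT, hTY,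
    lorentz_comm (fderiv ℝ f u Y) (dt - _), lorentz_comm (ambientNormal (f u)) (dt - _), hNT,
    lorentz_comm (ambientNormal (f u)) (fderiv _ _ _ _), S.tangent_ambient hu] at hG
  have hG2 : ((1 - n u 3 ^ 2) * lorentz (fderiv ℝ f u Y) (fderiv ℝ f u Y))
      * (-κ u * l - n u 3 ^ 2) = 0 := by
    linear_combination hG
  have hG3 : -κ u * l - n u 3 ^ 2 = 0 :=
    (mul_eq_zero.1 hG2).resolve_left (mul_pos hs hYY).ne'
  have hκ : κ u ≠ 0 := by
    intro h
    rw [h] at hG3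
    have := S.cos_ne u hu
    simp at hG3
    exact this hG3
  refine ⟨Z, Y, by rw [hdet]; exact hs.ne', hY, hT, hnZ, hY3, hκ, ?_⟩
  rw [hexp]
  congr 1
  field_simp
  linarith

theorem kappa_ne (hu : u ∈ U) : κ u ≠ 0 := by
  obtain ⟨Z, Y, -, -, -, -, -, h, -⟩ := S.exists_frame hu
  exact h

/-- Weingarten formula. -/
theorem deriv_normal (hu : u ∈ U) (X : Plane) :
    fderiv ℝ n u X = -(n u 3 ^ 2 / κ u) • fderiv ℝ f u X
      - ((κ u - n u 3 ^ 2 / κ u) / (1 - n u 3 ^ 2) * fderiv ℝ f u X 3) • (dt - n u 3 • n u)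
      - (n u 3 * fderiv ℝ f u X 3) • ambientNormal (f u) := by
  obtain ⟨Z, Y, hdet, -, hT, hnZ, hY3, hκ, hnY⟩ := S.exists_frame hu
  have hs := (S.sin_sq_pos hu).ne'
  have hZ3 : fderiv ℝ f u Z 3 = 1 - n u 3 ^ 2 := by
    rw [← S.lorentz_T hu, hT, S.lorentz_T_T hu]
  obtain ⟨a, b, hX⟩ : ∃ a b : ℝ, X = a • Z + b • Y := by
    refine ⟨(X 0 * Y 1 - X 1 * Y 0) / (Z 0 * Y 1 - Z 1 * Y 0),
      (Z 0 * X 1 - Z 1 * X 0) / (Z 0 * Y 1 - Z 1 * Y 0), ?_⟩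
    ext i
    fin_cases i
    · simp; rw [div_mul_eq_mul_div, div_mul_eq_mul_div, ← add_div, eq_div_iff hdet]; ring
    · simp; rw [div_mul_eq_mul_div, div_mul_eq_mul_div, ← add_div, eq_div_iff hdet]; ring
  have hX3 : fderiv ℝ f u X 3 = a * (1 - n u 3 ^ 2) := by
    rw [hX, map_add, map_smul, map_smul]; simp [hZ3, hY3]
  rw [hX3, hX, map_add, map_smul, map_smul, map_add, map_smul, map_smul, hnZ, hnY, hT]
  have e : (κ u - n u 3 ^ 2 / κ u) / (1 - n u 3 ^ 2) * (a * (1 - n u 3 ^ 2))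
      = a * (κ u - n u 3 ^ 2 / κ u) := by field_simp
  rw [e]
  module

theorem exists_height_ne (hu : u ∈ U) : ∃ i, pd i f u 3 ≠ 0 := by
  by_contra! h
  obtain ⟨Z, -, hT, -⟩ := S.principal u hu
  have hZ3 : fderiv ℝ f u Z 3 = 1 - n u 3 ^ 2 := by
    rw [← S.lorentz_T hu, hT, S.lorentz_T_T hu]
  rw [fderiv_apply_eq_pd] at hZ3
  simp [h] at hZ3
  exact (S.sin_sq_pos hu).ne hZ3

theorem contDiffOn_height (i : Fin 2) : ContDiffOn ℝ ∞ (fun w => pd i f w 3) U :=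
  contDiffOn_pi.1 (S.contDiffOn.pd S.isOpen i) 3

theorem contDiffOn_cos : ContDiffOn ℝ ∞ (fun w => n w 3) U :=
  contDiffOn_pi.1 S.contDiffOn_normal 3

theorem differentiableAt_height (hu : u ∈ U) (i : Fin 2) :
    DifferentiableAt ℝ (fun w => pd i f w 3) u :=
  ((S.contDiffOn_height i).hasFDerivAt' S.isOpen hu).differentiableAt

theorem differentiableAt_cos (hu : u ∈ U) : DifferentiableAt ℝ (fun w => n w 3) u :=
  (S.hasFDerivAt_normal_apply hu 3).differentiableAt

theorem pd_cos (hu : u ∈ U) (i : Fin 2) : pd i (fun w => n w 3) u = -κ u * pd i f u 3 :=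
  (((S.hasFDerivAt_normal_apply hu 3).pd i)).trans (S.deriv_cos hu _)

/-- κ is only given point by point. Near a point where ∂ᵢ of the height is nonzero it equals -∂ᵢ(cos
θ)/∂ᵢ(height), a quotient of smooth functions. -/
theorem differentiableAt_kappa (hu : u ∈ U) : DifferentiableAt ℝ κ u := by
  obtain ⟨i, hi⟩ := S.exists_height_ne hu
  have h1 : DifferentiableAt ℝ (fun w => -pd i (fun w => n w 3) w / pd i f w 3) u :=
    differentiableAt_div_real
      ((S.contDiffOn_cos.pd S.isOpen i).hasFDerivAt' S.isOpen hu).differentiableAt.fun_neg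
      (S.differentiableAt_height hu i) hi
  refine h1.congr_of_eventuallyEq ?_
  have hne : ∀ᶠ w in nhds u, pd i f w 3 ≠ 0 :=
    (S.differentiableAt_height hu i).continuousAt.eventually_ne hi
  filter_upwards [hne, S.isOpen.mem_nhds hu] with w hw hwU
  rw [S.pd_cos hwU]
  field_simp

/-- `dκ ∧ dt = 0`. -/
theorem pd_kappa_symm (hu : u ∈ U) :
    pd 0 κ u * pd 1 f u 3 = pd 1 κ u * pd 0 f u 3 := by
  have h := pd_comm S.isOpen S.contDiffOn_cos hu 0 1
  rw [pd_congr S.isOpen hu (fun w hw => S.pd_cos hw 1) 0,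
    pd_congr S.isOpen hu (fun w hw => S.pd_cos hw 0) 1,
    pd_mul (S.differentiableAt_kappa hu).fun_neg (S.differentiableAt_height hu 1),
    pd_mul (S.differentiableAt_kappa hu).fun_neg (S.differentiableAt_height hu 0)] at h
  have e : ∀ i, pd i (fun w => -κ w) u = -pd i κ u := fun i =>
    (S.differentiableAt_kappa hu).hasFDerivAt.fun_neg.pd i
  rw [e, e, pd_apply_three (S.differentiableAt_pd hu 1),
    pd_apply_three (S.differentiableAt_pd hu 0), pd_comm S.isOpen S.contDiffOn hu 1 0] at h
  linarith

/-- The second principal curvature. -/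
theorem differentiableAt_lambda (hu : u ∈ U) :
    DifferentiableAt ℝ (fun w => n w 3 ^ 2 / κ w) u :=
  differentiableAt_div_real ((S.differentiableAt_cos hu).fun_pow 2) (S.differentiableAt_kappa hu)
    (S.kappa_ne hu)

theorem differentiableAt_mu (hu : u ∈ U) :
    DifferentiableAt ℝ (fun w => (κ w - n w 3 ^ 2 / κ w) / (1 - n w 3 ^ 2)) u :=
  differentiableAt_div_real
    ((S.differentiableAt_kappa hu).fun_sub (S.differentiableAt_lambda hu))
    ((differentiableAt_const _).fun_sub ((S.differentiableAt_cos hu).fun_pow 2))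
    (S.sin_sq_pos hu).ne'

theorem pd_lambda (hu : u ∈ U) (i : Fin 2) : pd i (fun w => n w 3 ^ 2 / κ w) u
    = -2 * n u 3 * pd i f u 3 - n u 3 ^ 2 / κ u ^ 2 * pd i κ u := by
  have hκ := S.kappa_ne hu
  have h := pd_mul (S.differentiableAt_lambda hu) (S.differentiableAt_kappa hu) i
  have h2 : pd i (fun w => n w 3 ^ 2 / κ w * κ w) u = pd i (fun w => n w 3 * n w 3) u :=
    pd_congr S.isOpen hu (fun w hw => by
      have := S.kappa_ne hw
      field_simp) i
  rw [h2, pd_mul (S.differentiableAt_cos hu) (S.differentiableAt_cos hu), S.pd_cos hu] at h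
  field_simp at h ⊢
  linarith

/-- Codazzi equation. -/
theorem codazzi (hu : u ∈ U) (i : Fin 2) : pd i (fun w => n w 3 ^ 2 / κ w) u
    = n u 3 * ((κ u - n u 3 ^ 2 / κ u) / (1 - n u 3 ^ 2) * (n u 3 ^ 2 / κ u) + 1)
      * pd i f u 3 := by
  set lam : Plane → ℝ := fun w => n w 3 ^ 2 / κ w with hlam
  set mu : Plane → ℝ := fun w => (κ w - n w 3 ^ 2 / κ w) / (1 - n w 3 ^ 2) with hmu
  have dl : DifferentiableAt ℝ lam u := S.differentiableAt_lambda hu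
  have dm : DifferentiableAt ℝ mu u := S.differentiableAt_mu hu
  have dC := S.differentiableAt_cos hu
  have dτ := S.differentiableAt_height hu
  have df := S.differentiableAt_pd hu
  have dn := (S.hasFDerivAt_normal hu).differentiableAt
  have dN := (S.hasFDerivAt_ambientNormal hu).differentiableAt
  have dT : DifferentiableAt ℝ (fun w => dt - n w 3 • n w) u :=
    (differentiableAt_const _).fun_sub (dC.fun_smul dn)
  have hn : ∀ w ∈ U, ∀ j, pd j n w = -(lam w • pd j f w
      + ((mu w * pd j f w 3) • (dt - n w 3 • n w) + (n w 3 * pd j f w 3) • ambientNormal (f w))) := by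
    intro w hw j
    rw [pd, S.deriv_normal hw, ← pd.eq_1]
    module
  have pT : ∀ i, pd i (fun w => dt - n w 3 • n w) u
      = (κ u * pd i f u 3) • n u - n u 3 • pd i n u := by
    intro i
    rw [pd_sub (differentiableAt_const _) (dC.fun_smul dn), pd_smul dC dn, S.pd_cos hu]
    have : pd i (fun _ : Plane => dt) u = 0 := by simp [pd]
    rw [this]; module
  have pN : ∀ i, pd i (fun w => ambientNormal (f w)) u = pd i f u - pd i f u 3 • dt := by
    intro i
    rw [(S.hasFDerivAt_ambientNormal hu).pd i]
    simp [ambientNormal_eq, pd]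
  have second : ∀ i j, pd i (pd j n) u = -((pd i lam u • pd j f u + lam u • pd i (pd j f) u)
      + (((pd i mu u * pd j f u 3 + mu u * pd i (pd j f) u 3) • (dt - n u 3 • n u)
          + (mu u * pd j f u 3) • ((κ u * pd i f u 3) • n u - n u 3 • pd i n u))
        + ((-κ u * pd i f u 3 * pd j f u 3 + n u 3 * pd i (pd j f) u 3) • ambientNormal (f u)
          + (n u 3 * pd j f u 3) • (pd i f u - pd i f u 3 • dt)))) := by
    intro i j
    rw [pd_congr S.isOpen hu (fun w hw => hn w hw j) i]
    have a1 := dl.fun_smul (df j)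
    have a2 := (dm.fun_mul (dτ j)).fun_smul dT
    have a3 := (dC.fun_mul (dτ j)).fun_smul dN
    have hneg := ((a1.fun_add (a2.fun_add a3)).hasFDerivAt.fun_neg.pd i)
    refine hneg.trans ?_
    rw [neg_apply, ← pd.eq_1, pd_add a1 (a2.fun_add a3), pd_add a2 a3, pd_smul dl (df j),
      pd_smul (dm.fun_mul (dτ j)) dT, pd_smul (dC.fun_mul (dτ j)) dN, pd_mul dm (dτ j),
      pd_mul dC (dτ j), pT, pN, S.pd_cos hu, pd_apply_three (df j)]
  -- Codazzi is read off from ∂₀∂₁n = ∂₁∂₀n by pairing with the horizontal tangent vector Y below: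
  -- it is orthogonal to T, n, N and ∂_t, so only the multiples of ∂ᵢf survive.
  have hsym := pd_comm S.isOpen S.contDiffOn_normal hu 0 1
  rw [second, second, pd_comm S.isOpen S.contDiffOn hu 1 0] at hsym
  have hn0 := hn u hu 0
  have hn1 := hn u hu 1
  set Y : Fin 4 → ℝ := pd 0 f u 3 • pd 1 f u - pd 1 f u 3 • pd 0 f u with hY
  have hTi : ∀ i, lorentz (dt - n u 3 • n u) (pd i f u) = pd i f u 3 := fun i => S.lorentz_T hu _
  have hTY : lorentz (dt - n u 3 • n u) Y = 0 := by
    rw [hY, lorentz_sub_right, lorentz_smul_right, lorentz_smul_right, hTi, hTi]; ring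
  have hNi : ∀ i, lorentz (ambientNormal (f u)) (pd i f u) = 0 := fun i => by
    rw [lorentz_comm]; exact S.tangent_ambient hu _
  have hNY : lorentz (ambientNormal (f u)) Y = 0 := by
    rw [hY, lorentz_sub_right, lorentz_smul_right, lorentz_smul_right, hNi, hNi]; ring
  have hni : ∀ i, lorentz (n u) (pd i f u) = 0 := fun i => S.normal_tangent u hu _
  have hnY : lorentz (n u) Y = 0 := by
    rw [hY, lorentz_sub_right, lorentz_smul_right, lorentz_smul_right, hni, hni]; ring
  have hdY : lorentz dt Y = 0 := by
    rw [hY, lorentz_dt_left]; simp; ring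
  -- Both cos θ and κ have differentials proportional to that of the height, hence so does λ; the
  -- factor r is what the pairing determines.
  have hl01 : pd 0 lam u * pd 1 f u 3 = pd 1 lam u * pd 0 f u 3 := by
    rw [hlam, S.pd_lambda hu, S.pd_lambda hu]
    linear_combination (-(n u 3 ^ 2 / κ u ^ 2)) * S.pd_kappa_symm hu
  obtain ⟨r, hr⟩ : ∃ r, ∀ i, pd i lam u = r * pd i f u 3 := by
    obtain ⟨k, hk⟩ := S.exists_height_ne hu
    refine ⟨pd k lam u / pd k f u 3, fun i => ?_⟩
    rw [div_mul_eq_mul_div, eq_div_iff hk]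
    fin_cases i <;> fin_cases k <;> simp <;> linarith
  have hYpos : 0 < lorentz Y Y := by
    let X : Plane := pd 0 f u 3 • EuclideanSpace.single 1 1
      - pd 1 f u 3 • EuclideanSpace.single 0 1
    have hX : fderiv ℝ f u X = Y := by simp [X, hY, pd]
    rw [← hX]
    apply S.tangent_pos hu
    intro h
    obtain ⟨k, hk⟩ := S.exists_height_ne hu
    have h0 := congrArg (fun Z : Plane => Z 0) h
    have h1 := congrArg (fun Z : Plane => Z 1) h
    simp [X] at h0 h1
    fin_cases k
    · exact hk h1
    · exact hk h0
  have hpair := congrArg (fun v => lorentz v Y) hsym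
  rw [hn0, hn1] at hpair
  simp only [lorentz_neg_left, lorentz_add_left, lorentz_smul_left, hTY, hNY, hnY, hdY,
    lorentz_sub_left (_ • _) (_ • _), lorentz_sub_left (pd _ f u)] at hpair
  have hYY : lorentz Y Y = pd 0 f u 3 * lorentz (pd 1 f u) Y
      - pd 1 f u 3 * lorentz (pd 0 f u) Y := by
    conv_lhs => rw [hY]
    rw [lorentz_sub_left, lorentz_smul_left, lorentz_smul_left]
  have hfin : (r - n u 3 * (mu u * lam u + 1)) * lorentz Y Y = 0 := by
    rw [hYY]
    rw [hr, hr] at hpair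
    linear_combination (-1 : ℝ) * hpair
  have hrr := (mul_eq_zero.1 hfin).resolve_right hYpos.ne'
  rw [hr i]
  rw [sub_eq_zero.1 hrr]

end IsFlatPrincipal

/-! ### The function `χ` -/

/-- The denominator may vanish, but only where the numerator is zero on a neighbourhood, so it can
be truncated without changing the quotient. Hence χ is differentiable on all of ℝ. -/
theorem chi_integrand_continuous (c : ℝ) :
    Continuous fun τ : ℝ => Real.sqrt (τ ^ 2 + c) / Real.sqrt (τ ^ 2 + c + 1) := by
  have h : (fun τ : ℝ => Real.sqrt (τ ^ 2 + c) / Real.sqrt (τ ^ 2 + c + 1))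
      = fun τ : ℝ => Real.sqrt (τ ^ 2 + c) / Real.sqrt (max (τ ^ 2 + c) 0 + 1) := by
    funext τ
    rcases le_or_gt 0 (τ ^ 2 + c) with h | h
    · rw [max_eq_left h]
    · rw [Real.sqrt_eq_zero_of_nonpos h.le, zero_div, zero_div]
  rw [h]
  refine Continuous.div (by fun_prop) (by fun_prop) fun τ => ?_
  have : 0 ≤ max (τ ^ 2 + c) 0 := le_max_right _ _
  positivity

theorem hasDerivAt_chi (c x : ℝ) :
    HasDerivAt (chi c) (Real.sqrt (x ^ 2 + c) / Real.sqrt (x ^ 2 + c + 1)) x :=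
  (chi_integrand_continuous c).integral_hasStrictDerivAt _ _ |>.hasDerivAt

/-! ### First integrals of a flat surface with principal `T` -/

/-- The axis of the surface, a vector of `ℝ³₁`. -/
def axisVector (k : ℝ) (P v : Fin 4 → ℝ) : Fin 4 → ℝ :=
  (v 3 ^ 2 / k * v 3)⁻¹ • ((v 3 ^ 2 / k) • ambientNormal P + v - v 3 • dt)

theorem axisVector_three (k : ℝ) (P v : Fin 4 → ℝ) : axisVector k P v 3 = 0 := by
  simp only [axisVector, Pi.smul_apply, Pi.sub_apply, Pi.add_apply, smul_eq_mul,
    show ambientNormal P 3 = 0 from rfl, show dt 3 = 1 from rfl]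
  ring

theorem lorentz_axisVector {k : ℝ} {P v : Fin 4 → ℝ} (hP : P ∈ H2R) (hk : k ≠ 0) (hv : v 3 ≠ 0)
    (h0 : lorentz v (ambientNormal P) = 0) :
    lorentz (ambientNormal P) (axisVector k P v) = -(1 / v 3) := by
  simp only [axisVector, lorentz_smul_right, lorentz_add_right, lorentz_sub_right,
    lorentz_ambientNormal_self hP, lorentz_comm (ambientNormal P) v, h0,
    lorentz_ambientNormal_dt]
  field_simp
  ring

theorem lorentz_axisVector_self {k : ℝ} {P v : Fin 4 → ℝ} (hP : P ∈ H2R) (hk : k ≠ 0)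
    (hv : v 3 ≠ 0) (h0 : lorentz v (ambientNormal P) = 0) (h1 : lorentz v v = 1) :
    lorentz (axisVector k P v) (axisVector k P v)
      = -(1 / v 3 ^ 2) + (1 - v 3 ^ 2) * k ^ 2 / v 3 ^ 6 := by
  have h2 : lorentz v (axisVector k P v) = (v 3 ^ 2 / k * v 3)⁻¹ * (1 - v 3 ^ 2) := by
    simp only [axisVector, lorentz_smul_right, lorentz_add_right, lorentz_sub_right, h0, h1,
      lorentz_dt_right]
    ring
  conv_lhs => rw [axisVector.eq_1]
  rw [lorentz_smul_left, lorentz_sub_left, lorentz_add_left, lorentz_smul_left,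
    lorentz_smul_left, ← axisVector.eq_1, lorentz_axisVector hP hk hv h0, h2, lorentz_dt_left,
    axisVector_three]
  field_simp
  ring

namespace IsFlatPrincipal

variable {U : Set Plane} {f n : Plane → Fin 4 → ℝ} {κ : Plane → ℝ}
  (S : IsFlatPrincipal U f n κ) {u : Plane}
include S

/-- With λ and μ as in the Codazzi equation, the numerator λN + n - cos θ ∂_t and the denominator λ
cos θ have the same logarithmic derivative, μ cos θ times the height differential; this uses κλ =
cos²θ. -/
theorem hasFDerivAt_axisVector (hu : u ∈ U) :
    HasFDerivAt (fun w => axisVector (κ w) (f w) (n w)) (0 : Plane →L[ℝ] (Fin 4 → ℝ)) u := by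
  have hκ := S.kappa_ne hu
  have hC := S.cos_ne u hu
  have hs := (S.sin_sq_pos hu).ne'
  have dl := S.differentiableAt_lambda hu
  have dC := S.differentiableAt_cos hu
  have dn := (S.hasFDerivAt_normal hu).differentiableAt
  have dN := (S.hasFDerivAt_ambientNormal hu).differentiableAt
  have dD : DifferentiableAt ℝ (fun w => n w 3 ^ 2 / κ w * n w 3) u := dl.fun_mul dC
  have hD : n u 3 ^ 2 / κ u * n u 3 ≠ 0 := by positivity
  have dV : DifferentiableAt ℝ (fun w => (n w 3 ^ 2 / κ w) • ambientNormal (f w) + n w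
      - n w 3 • dt) u :=
    ((dl.fun_smul dN).fun_add dn).fun_sub (dC.fun_smul (differentiableAt_const _))
  have dW : DifferentiableAt ℝ (fun w => axisVector (κ w) (f w) (n w)) u :=
    (dD.fun_inv hD).fun_smul dV
  have h0 : ∀ i, pd i (fun w => axisVector (κ w) (f w) (n w)) u = 0 := by
    intro i
    -- Differentiating (λ cos θ)·W = numerator avoids differentiating the inverse: one shows that (λ
    -- cos θ)·∂ᵢW = 0.
    have h1 := pd_smul dD dW i
    have h2 : pd i (fun w => (n w 3 ^ 2 / κ w * n w 3) • axisVector (κ w) (f w) (n w)) u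
        = pd i (fun w => (n w 3 ^ 2 / κ w) • ambientNormal (f w) + n w - n w 3 • dt) u := by
      refine pd_congr S.isOpen hu (fun w hw => ?_) i
      have hκ := S.kappa_ne hw
      have hC := S.cos_ne w hw
      have hD : n w 3 ^ 2 / κ w * n w 3 ≠ 0 := by positivity
      simp only [axisVector]
      rw [smul_inv_smul₀ hD]
    have pN : pd i (fun w => ambientNormal (f w)) u = pd i f u - pd i f u 3 • dt := by
      rw [(S.hasFDerivAt_ambientNormal hu).pd i]
      simp [ambientNormal_eq, pd]
    have pc : pd i (fun _ : Plane => dt) u = 0 := by simp [pd]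
    have pn : pd i n u = -(n u 3 ^ 2 / κ u) • pd i f u
      - ((κ u - n u 3 ^ 2 / κ u) / (1 - n u 3 ^ 2) * pd i f u 3) • (dt - n u 3 • n u)
      - (n u 3 * pd i f u 3) • ambientNormal (f u) := S.deriv_normal hu _
    rw [h2, pd_sub ((dl.fun_smul dN).fun_add dn) (dC.fun_smul (differentiableAt_const _)),
      pd_add (dl.fun_smul dN) dn, pd_smul dl dN, pd_smul dC (differentiableAt_const _),
      pd_mul dl dC, S.codazzi hu, S.pd_cos hu, pN, pc, pn] at h1
    refine (smul_eq_zero.1 (?_ : (n u 3 ^ 2 / κ u * n u 3) • _ = (0 : Fin 4 → ℝ))).resolve_left hD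
    have h3 := eq_sub_of_add_eq' h1.symm
    refine h3.trans ?_
    simp only [axisVector, smul_smul]
    generalize ambientNormal (f u) = N
    generalize pd i f u = F
    generalize n u = v at *
    set C := v 3
    match_scalars
    all_goals (field_simp; ring)
  refine dW.hasFDerivAt.congr_fderiv ?_
  ext1 X
  rw [fderiv_apply_eq_pd, h0, h0]
  simp

/-- The height is `±χ(x)` up to a constant, with `x = √(1 / cos² θ - c - 1)`. -/
theorem hasFDerivAt_height_sub_chi {c η : ℝ} (hη : η ^ 2 = 1) (hu : u ∈ U)
    (hpos : 0 < η * (κ u * n u 3))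
    (hc : 1 / n u 3 ^ 2 - c - 1 = (1 - n u 3 ^ 2) * κ u ^ 2 / n u 3 ^ 6) :
    HasFDerivAt (fun w => f w 3 - η * chi c (Real.sqrt (1 / n w 3 ^ 2 - c - 1)))
      (0 : Plane →L[ℝ] ℝ) u := by
  have hκ := S.kappa_ne hu
  have hC := S.cos_ne u hu
  have hs := S.sin_sq_pos hu
  have hx : 0 < 1 / n u 3 ^ 2 - c - 1 := by rw [hc]; positivity
  have hcos : HasFDerivAt (fun w => n w 3) (-κ u • (ContinuousLinearMap.proj
      (R := ℝ) (φ := fun _ : Fin 4 => ℝ) 3).comp (fderiv ℝ f u)) u := by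
    refine (S.hasFDerivAt_normal_apply hu 3).congr_fderiv ?_
    ext1 X
    exact S.deriv_cos hu X
  have hg : HasDerivAt (fun C : ℝ => 1 / C ^ 2 - c - 1) (-2 / n u 3 ^ 3) (n u 3) := by
    have h := ((((hasDerivAt_pow 2 (n u 3)).fun_inv (by positivity)).sub_const c).sub_const 1)
    simp only [one_div]
    refine h.congr_deriv ?_
    simp only [Nat.cast_ofNat, Nat.add_one_sub_one, pow_one]
    field_simp
  have hchi := (hasDerivAt_chi c (Real.sqrt (1 / n u 3 ^ 2 - c - 1))).comp (n u 3)
    (hg.sqrt hx.ne')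
  have h := (S.hasFDerivAt_height hu 3).fun_sub ((hchi.comp_hasFDerivAt u hcos).const_mul η)
  refine h.congr_fderiv ?_
  ext1 X
  simp only [sub_apply, smul_apply, ContinuousLinearMap.comp_apply, ContinuousLinearMap.proj_apply,
    smul_eq_mul, zero_apply]
  rw [Real.sq_sqrt hx.le]
  -- For this x the quantity x² + c is tan²θ and x² + c + 1 is 1/cos²θ, so the integrand defining χ
  -- equals sin θ at x.
  have e1 : 1 / n u 3 ^ 2 - c - 1 + c = (1 - n u 3 ^ 2) / n u 3 ^ 2 := by field_simp; ring
  have e2 : (1 - n u 3 ^ 2) / n u 3 ^ 2 + 1 = 1 / n u 3 ^ 2 := by field_simp; ring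
  have habs : η * (κ u * n u 3) = |κ u| * |n u 3| := by
    have : |η| = 1 := by
      rw [← sq_eq_sq₀ (abs_nonneg _) zero_le_one, sq_abs, hη, one_pow]
    rw [← abs_of_pos hpos, abs_mul, abs_mul, this, one_mul]
  have e3 : Real.sqrt (1 / n u 3 ^ 2 - c - 1)
      = Real.sqrt (1 - n u 3 ^ 2) * |κ u| / |n u 3| ^ 3 := by
    rw [hc, show (1 - n u 3 ^ 2) * κ u ^ 2 / n u 3 ^ 6
      = (1 - n u 3 ^ 2) * (κ u / n u 3 ^ 3) ^ 2 by field_simp,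
      Real.sqrt_mul hs.le, Real.sqrt_sq_eq_abs, abs_div, abs_pow, mul_div_assoc]
  rw [e1, e2, e3, Real.sqrt_div hs.le, Real.sqrt_div zero_le_one, Real.sqrt_sq_eq_abs,
    Real.sqrt_one]
  have hC2 : n u 3 ^ 2 = |n u 3| ^ 2 := (sq_abs _).symm
  have e4 : η * κ u = |κ u| * |n u 3| / n u 3 := by
    rw [eq_div_iff hC, ← habs]; ring
  -- The chain rule makes the derivative of χ(x) equal to sign(κ cos θ) times that of the height; η
  -- is this sign.
  have key : η * (Real.sqrt (1 - n u 3 ^ 2) / |n u 3| / (1 / |n u 3|)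
      * (-2 / n u 3 ^ 3 / (2 * (Real.sqrt (1 - n u 3 ^ 2) * |κ u| / |n u 3| ^ 3))) * (-κ u)) = 1 := by
    have : η * (Real.sqrt (1 - n u 3 ^ 2) / |n u 3| / (1 / |n u 3|)
      * (-2 / n u 3 ^ 3 / (2 * (Real.sqrt (1 - n u 3 ^ 2) * |κ u| / |n u 3| ^ 3))) * (-κ u))
      = (η * κ u) * (|n u 3| ^ 3 / (n u 3 ^ 3 * |κ u|)) := by
      field_simp
    rw [this, e4]
    have h4 : n u 3 ^ 4 = |n u 3| ^ 4 := by
      rw [show n u 3 ^ 4 = (n u 3 ^ 2) ^ 2 by ring, hC2]; ring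
    field_simp
    rw [h4]
  linear_combination (-(fderiv ℝ f u X 3)) * key

end IsFlatPrincipal

/-! ### The explicit immersions: moving frame -/

/-- First order data of an explicit immersion at the point with coordinates `v`: the coordinate
fields `E`, `R`, the unit normal `ν`, and its derivative. -/
structure ModelFrame (c : ℝ) (G E R ν : ℝ → ℝ → Fin 4 → ℝ) (v : Plane) : Prop where
  hasFDerivAt : HasFDerivAt (fun w : Plane => G (w 0) (w 1))
    ((EuclideanSpace.proj (𝕜 := ℝ) (0 : Fin 2)).smulRight (E (v 0) (v 1))
      + (EuclideanSpace.proj (𝕜 := ℝ) (1 : Fin 2)).smulRight (R (v 0) (v 1))) v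
  hasFDerivAt_normal : HasFDerivAt (fun w : Plane => ν (w 0) (w 1))
    ((EuclideanSpace.proj (𝕜 := ℝ) (0 : Fin 2)).smulRight
        (-(v 0 / (Real.sqrt (v 0 ^ 2 + c) * (v 0 ^ 2 + c + 1))) • E (v 0) (v 1)
          - (Real.sqrt (v 0 ^ 2 + c) / (v 0 ^ 2 + c + 1)) • ambientNormal (G (v 0) (v 1)))
      + (EuclideanSpace.proj (𝕜 := ℝ) (1 : Fin 2)).smulRight
        (-(Real.sqrt (v 0 ^ 2 + c) / v 0) • R (v 0) (v 1))) v
  mem : G (v 0) (v 1) ∈ H2R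
  lorentz_E_E : lorentz (E (v 0) (v 1)) (E (v 0) (v 1)) = 1
  lorentz_E_R : lorentz (E (v 0) (v 1)) (R (v 0) (v 1)) = 0
  lorentz_R_R : 0 < lorentz (R (v 0) (v 1)) (R (v 0) (v 1))
  lorentz_E_normal : lorentz (E (v 0) (v 1)) (ambientNormal (G (v 0) (v 1))) = 0
  lorentz_R_normal : lorentz (R (v 0) (v 1)) (ambientNormal (G (v 0) (v 1))) = 0
  lorentz_ν_ν : lorentz (ν (v 0) (v 1)) (ν (v 0) (v 1)) = 1
  lorentz_ν_E : lorentz (ν (v 0) (v 1)) (E (v 0) (v 1)) = 0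
  lorentz_ν_R : lorentz (ν (v 0) (v 1)) (R (v 0) (v 1)) = 0
  lorentz_ν_normal : lorentz (ν (v 0) (v 1)) (ambientNormal (G (v 0) (v 1))) = 0
  ν_three : ν (v 0) (v 1) 3 = 1 / Real.sqrt (v 0 ^ 2 + c + 1)
  tangent : dt - (1 / Real.sqrt (v 0 ^ 2 + c + 1)) • ν (v 0) (v 1)
    = (Real.sqrt (v 0 ^ 2 + c) / Real.sqrt (v 0 ^ 2 + c + 1)) • E (v 0) (v 1)

/-- The horizontal part of each explicit immersion has the form `x A(y) + γ(x) B`. -/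
structure ProfileData (c : ℝ) (G : ℝ → ℝ → Fin 4 → ℝ) (A A' : ℝ → Fin 4 → ℝ) (B : Fin 4 → ℝ)
    (γ γ₁ γ₂ : ℝ → ℝ) : Prop where
  eq : ∀ x y, G x y = x • A y + γ x • B + chi c x • dt
  hasDerivAt_A : ∀ y, HasDerivAt A (A' y) y
  A_three : ∀ y, A y 3 = 0
  B_three : B 3 = 0
  hasDerivAt_γ : ∀ x, 0 < x → 0 < x ^ 2 + c → HasDerivAt γ (γ₁ x) x
  hasDerivAt_γ₁ : ∀ x, 0 < x → 0 < x ^ 2 + c → HasDerivAt γ₁ (γ₂ x) x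
  profile_eq : ∀ x, 0 < x → 0 < x ^ 2 + c → γ₂ x * (x ^ 2 + c + 1) = γ x - x * γ₁ x
  mem : ∀ x y, 0 < x → 0 < x ^ 2 + c → G x y ∈ H2R
  lorentz_P_Q : ∀ x y, 0 < x → 0 < x ^ 2 + c →
    lorentz (x • A y + γ x • B) (A y + γ₁ x • B) = 0
  lorentz_Q_Q : ∀ x y, 0 < x → 0 < x ^ 2 + c →
    lorentz (A y + γ₁ x • B) (A y + γ₁ x • B) = 1 / (x ^ 2 + c + 1)
  lorentz_A'_A : ∀ y, lorentz (A' y) (A y) = 0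
  lorentz_A'_B : ∀ y, lorentz (A' y) B = 0
  lorentz_A'_A' : ∀ y, 0 < lorentz (A' y) (A' y)

/-- Let P = xA + γB be the horizontal position and Q = A + γ₁B its x-derivative. Then ⟨P,Q⟩ = 0 and
|Q|² = 1/(x² + c + 1), which makes E a unit vector and fixes the unit normal in the plane of Q and
∂_t. Differentiating the normal needs only Q. -/
theorem ProfileData.modelFrame {c : ℝ} {G : ℝ → ℝ → Fin 4 → ℝ} {A A' : ℝ → Fin 4 → ℝ}
    {B : Fin 4 → ℝ} {γ γ₁ γ₂ : ℝ → ℝ} (D : ProfileData c G A A' B γ γ₁ γ₂) {v : Plane}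
    (h0 : 0 < v 0) (h1 : 0 < v 0 ^ 2 + c) :
    ModelFrame c G
      (fun x y => A y + γ₁ x • B + (Real.sqrt (x ^ 2 + c) / Real.sqrt (x ^ 2 + c + 1)) • dt)
      (fun x y => x • A' y)
      (fun x y => -Real.sqrt (x ^ 2 + c) • (A y + γ₁ x • B)
        + (1 / Real.sqrt (x ^ 2 + c + 1)) • dt) v := by
  have h2 : 0 < v 0 ^ 2 + c + 1 := by linarith
  have p0 : HasFDerivAt (fun w : Plane => w 0) (EuclideanSpace.proj (𝕜 := ℝ) (0 : Fin 2)) v :=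
    (EuclideanSpace.proj (𝕜 := ℝ) (0 : Fin 2)).hasFDerivAt
  have p1 : HasFDerivAt (fun w : Plane => w 1) (EuclideanSpace.proj (𝕜 := ℝ) (1 : Fin 2)) v :=
    (EuclideanSpace.proj (𝕜 := ℝ) (1 : Fin 2)).hasFDerivAt
  have hA := (D.hasDerivAt_A (v 1)).hasFDerivAt.comp v p1
  have hγ := (D.hasDerivAt_γ (v 0) h0 h1).comp_hasFDerivAt v p0
  have hγ₁ := (D.hasDerivAt_γ₁ (v 0) h0 h1).comp_hasFDerivAt v p0
  have hχ := (hasDerivAt_chi c (v 0)).comp_hasFDerivAt v p0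
  have hN : ambientNormal (G (v 0) (v 1)) = v 0 • A (v 1) + γ (v 0) • B := by
    rw [ambientNormal_eq, D.eq]
    simp [D.A_three, D.B_three, show dt 3 = 1 from rfl]
  have hs1 : 0 < Real.sqrt (v 0 ^ 2 + c) := Real.sqrt_pos.2 h1
  have hs2 : 0 < Real.sqrt (v 0 ^ 2 + c + 1) := Real.sqrt_pos.2 h2
  have q1 : Real.sqrt (v 0 ^ 2 + c) ^ 2 = v 0 ^ 2 + c := Real.sq_sqrt h1.le
  have q2 : Real.sqrt (v 0 ^ 2 + c + 1) ^ 2 = v 0 ^ 2 + c + 1 := Real.sq_sqrt h2.le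
  have hQ3 : (A (v 1) + γ₁ (v 0) • B) 3 = 0 := by simp [D.A_three, D.B_three]
  have hQd : lorentz (A (v 1) + γ₁ (v 0) • B) dt = 0 := by rw [lorentz_dt_right, hQ3]
  have hdQ : lorentz dt (A (v 1) + γ₁ (v 0) • B) = 0 := by rw [lorentz_dt_left, hQ3]
  have hA'3 : A' (v 1) 3 = 0 := by
    have h := (hasDerivAt_pi.1 (D.hasDerivAt_A (v 1))) 3
    exact h.unique ((hasDerivAt_const (v 1) (0 : ℝ)).congr_of_eventuallyEq
      (Filter.Eventually.of_forall D.A_three))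
  have hA'Q : lorentz (A' (v 1)) (A (v 1) + γ₁ (v 0) • B) = 0 := by
    simp [D.lorentz_A'_A, D.lorentz_A'_B]
  have hA'P : lorentz (A' (v 1)) (v 0 • A (v 1) + γ (v 0) • B) = 0 := by
    simp [D.lorentz_A'_A, D.lorentz_A'_B]
  have hPQ := D.lorentz_P_Q (v 0) (v 1) h0 h1
  have hQQ := D.lorentz_Q_Q (v 0) (v 1) h0 h1
  have hPd : lorentz dt (v 0 • A (v 1) + γ (v 0) • B) = 0 := by
    rw [← hN]; exact lorentz_dt_ambientNormal _
  have hp := D.profile_eq (v 0) h0 h1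
  refine
  { hasFDerivAt := ?_
    hasFDerivAt_normal := ?_
    mem := D.mem _ _ h0 h1
    lorentz_E_E := ?_
    lorentz_E_R := ?_
    lorentz_R_R := ?_
    lorentz_E_normal := ?_
    lorentz_R_normal := ?_
    lorentz_ν_ν := ?_
    lorentz_ν_E := ?_
    lorentz_ν_R := ?_
    lorentz_ν_normal := ?_
    ν_three := ?_
    tangent := ?_ }
  · have h := ((p0.fun_smul hA).fun_add (hγ.smul_const B)).fun_add (hχ.smul_const dt)
    simp only [D.eq]
    refine h.congr_fderiv ?_
    ext1 X
    simp
    module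
  · have hr1 : HasDerivAt (fun x : ℝ => x ^ 2 + c) (2 * v 0) (v 0) := by
      simpa using (hasDerivAt_pow 2 (v 0)).add_const c
    have hw := (hr1.sqrt h1.ne').comp_hasFDerivAt v p0
    have hr := (((hr1.add_const 1).sqrt h2.ne').fun_inv hs2.ne').comp_hasFDerivAt v p0
    have h := (hw.fun_neg.fun_smul (hA.fun_add (hγ₁.smul_const B))).fun_add (hr.smul_const dt)
    simp only [one_div]
    refine h.congr_fderiv ?_
    -- The profile equation says that ∂ₓQ = (P - xQ)/(x² + c + 1), so no new vector appears in the
    -- derivative of the normal.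
    have hγ₂ : γ₂ (v 0) = (γ (v 0) - v 0 * γ₁ (v 0)) / (v 0 ^ 2 + c + 1) := by
      rw [eq_div_iff h2.ne', hp]
    ext1 X
    rw [hN]
    simp only [Function.comp_apply, smul_apply, add_apply, neg_apply,
      ContinuousLinearMap.smulRight_apply, PiLp.proj_apply, smul_eq_mul, hγ₂,
      ContinuousLinearMap.comp_apply, ContinuousLinearMap.toSpanSingleton_apply]
    generalize hw' : Real.sqrt (v 0 ^ 2 + c) = s at *
    generalize hr' : Real.sqrt (v 0 ^ 2 + c + 1) = r at *
    have e : v 0 ^ 2 + c + 1 = s ^ 2 + 1 := by rw [q1]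
    have q3 : r ^ 2 = s ^ 2 + 1 := by rw [q2, e]
    simp only [e]
    have hx := h0.ne'
    match_scalars
    · field_simp
    · field_simp; ring
    · field_simp; ring
    · field_simp
      linear_combination (X 0) * q3
  · simp only [lorentz_add_left _ (_ • dt), lorentz_add_right _ _ (_ • dt), lorentz_smul_left _ dt,
      lorentz_smul_right _ _ dt, hQd, hdQ, hQQ, lorentz_dt_dt]
    field_simp
    linear_combination q2 + (v 0 ^ 2 + c + 1) * q1 - (v 0 ^ 2 + c + 1) * q2
  · simp only [lorentz_add_left _ (_ • dt), lorentz_smul_right, lorentz_smul_left _ dt,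
      lorentz_comm _ (A' (v 1)), hA'Q]
    simp [lorentz_dt_right, hA'3]
  · simp only [lorentz_smul_left, lorentz_smul_right]
    have := D.lorentz_A'_A' (v 1)
    positivity
  · rw [hN, lorentz_add_left, lorentz_comm _ (v 0 • A (v 1) + γ (v 0) • B), hPQ,
      lorentz_smul_left, hPd]; simp
  · rw [hN, lorentz_smul_left, hA'P, mul_zero]
  · simp only [lorentz_add_left (_ • (_ + _)), lorentz_add_right _ (_ • (_ + _)),
      lorentz_smul_left _ dt, lorentz_smul_left _ (_ + _), lorentz_smul_right _ _ (_ + _),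
      lorentz_smul_right _ _ dt, hQd, hdQ, hQQ, lorentz_dt_dt]
    field_simp
    linear_combination Real.sqrt (v 0 ^ 2 + c) ^ 2 * q2 + (v 0 ^ 2 + c + 1) * q1
      - (v 0 ^ 2 + c + 1) * q2
  · simp only [lorentz_add_left (_ • (_ + _)), lorentz_add_right _ _ (_ • dt),
      lorentz_smul_left _ dt, lorentz_smul_left _ (_ + _),
      lorentz_smul_right _ _ dt, hQd, hdQ, hQQ, lorentz_dt_dt]
    field_simp
    linear_combination (-Real.sqrt (v 0 ^ 2 + c)) * q2
  · rw [lorentz_smul_right, lorentz_add_left, lorentz_smul_left, lorentz_smul_left,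
      lorentz_comm _ (A' (v 1)), hA'Q, lorentz_dt_left, hA'3]; simp
  · rw [hN, lorentz_add_left, lorentz_smul_left, lorentz_comm _ (v 0 • A (v 1) + γ (v 0) • B),
      hPQ, lorentz_smul_left, hPd]; simp
  · rw [Pi.add_apply, Pi.smul_apply, hQ3]; simp [show dt 3 = 1 from rfl]
  · have hx := h0.ne'
    match_scalars
    · field_simp
      linear_combination q2 - q1
    · field_simp
    · field_simp
  

/-! ### Profiles with timelike, spacelike and lightlike axis -/

theorem hasDerivAt_vec {a b d e : ℝ → ℝ} {a' b' d' e' y : ℝ} (ha : HasDerivAt a a' y)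
    (hb : HasDerivAt b b' y) (hd : HasDerivAt d d' y) (he : HasDerivAt e e' y) :
    HasDerivAt (fun t => (![a t, b t, d t, e t] : Fin 4 → ℝ)) ![a', b', d', e'] y := by
  rw [hasDerivAt_pi]
  intro i
  fin_cases i <;> assumption

theorem hasDerivAt_sqrt_sq_add {c x : ℝ} (h : 0 < x ^ 2 + c) :
    HasDerivAt (fun x : ℝ => Real.sqrt (x ^ 2 + c + 1)) (x / Real.sqrt (x ^ 2 + c + 1)) x := by
  have h1 : HasDerivAt (fun x : ℝ => x ^ 2 + c + 1) (2 * x) x := by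
    simpa using ((hasDerivAt_pow 2 x).add_const c).add_const 1
  refine (h1.sqrt (by linarith)).congr_deriv ?_
  rw [mul_div_mul_left _ _ two_ne_zero]

theorem hasDerivAt_div_sqrt_sq_add {c x : ℝ} (h : 0 < x ^ 2 + c) :
    HasDerivAt (fun x : ℝ => x / Real.sqrt (x ^ 2 + c + 1))
      ((c + 1) / Real.sqrt (x ^ 2 + c + 1) ^ 3) x := by
  have hs : 0 < Real.sqrt (x ^ 2 + c + 1) := Real.sqrt_pos.2 (by linarith)
  have q : Real.sqrt (x ^ 2 + c + 1) ^ 2 = x ^ 2 + c + 1 := Real.sq_sqrt (by linarith)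
  refine ((hasDerivAt_id x).fun_div (hasDerivAt_sqrt_sq_add h) hs.ne').congr_deriv ?_
  simp only [id]
  field_simp
  linear_combination q

theorem sqrt_profile_eq {c x : ℝ} (h : 0 < x ^ 2 + c) :
    (c + 1) / Real.sqrt (x ^ 2 + c + 1) ^ 3 * (x ^ 2 + c + 1)
      = Real.sqrt (x ^ 2 + c + 1) - x * (x / Real.sqrt (x ^ 2 + c + 1)) := by
  have hs : 0 < Real.sqrt (x ^ 2 + c + 1) := Real.sqrt_pos.2 (by linarith)
  have q : Real.sqrt (x ^ 2 + c + 1) ^ 2 = x ^ 2 + c + 1 := Real.sq_sqrt (by linarith)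
  field_simp
  linear_combination (-(Real.sqrt (x ^ 2 + c + 1) ^ 2 + c + 1)) * q

theorem profileData_immersionA {c : ℝ} (hc : -1 < c) :
    ProfileData c (immersionA c)
      (fun y => ![Real.cos y / Real.sqrt (c + 1), Real.sin y / Real.sqrt (c + 1), 0, 0])
      (fun y => ![-Real.sin y / Real.sqrt (c + 1), Real.cos y / Real.sqrt (c + 1), 0, 0])
      ![0, 0, 1 / Real.sqrt (c + 1), 0] (fun x => Real.sqrt (x ^ 2 + c + 1))
      (fun x => x / Real.sqrt (x ^ 2 + c + 1)) (fun x => (c + 1) / Real.sqrt (x ^ 2 + c + 1) ^ 3) := by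
  have hk : 0 < Real.sqrt (c + 1) := Real.sqrt_pos.2 (by linarith)
  have qk : Real.sqrt (c + 1) ^ 2 = c + 1 := Real.sq_sqrt (by linarith)
  have hs : ∀ x, 0 < x ^ 2 + c → 0 < Real.sqrt (x ^ 2 + c + 1) := fun x h =>
    Real.sqrt_pos.2 (by linarith)
  have q : ∀ x, 0 < x ^ 2 + c → Real.sqrt (x ^ 2 + c + 1) ^ 2 = x ^ 2 + Real.sqrt (c + 1) ^ 2 :=
    fun x h => by rw [qk, Real.sq_sqrt (by linarith)]; ring
  refine
  { eq := fun x y => ?_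
    hasDerivAt_A := fun y => hasDerivAt_vec ((Real.hasDerivAt_cos y).div_const _)
      ((Real.hasDerivAt_sin y).div_const _) (hasDerivAt_const _ _) (hasDerivAt_const _ _)
    A_three := fun y => rfl
    B_three := rfl
    hasDerivAt_γ := fun x _ h => hasDerivAt_sqrt_sq_add h
    hasDerivAt_γ₁ := fun x _ h => hasDerivAt_div_sqrt_sq_add h
    profile_eq := fun x _ h => sqrt_profile_eq h
    mem := fun x y _ h => ⟨?_, ?_⟩
    lorentz_P_Q := fun x y _ h => ?_
    lorentz_Q_Q := fun x y _ h => ?_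
    lorentz_A'_A := fun y => ?_
    lorentz_A'_B := fun y => ?_
    lorentz_A'_A' := fun y => ?_ }
  · ext i
    fin_cases i <;> simp [immersionA, dt] <;> ring
  · have := q x h
    have := Real.sin_sq_add_cos_sq y
    simp only [immersionA, Matrix.cons_val]
    field_simp
    linear_combination x ^ 2 * Real.sin_sq_add_cos_sq y - q x h
  · have := hs x h
    simp only [immersionA, Matrix.cons_val]
    positivity
  · have := hs x h
    simp [lorentz]
    field_simp
    linear_combination x * Real.sin_sq_add_cos_sq y
  · have := hs x h
    rw [show x ^ 2 + c + 1 = Real.sqrt (x ^ 2 + c + 1) ^ 2 from (Real.sq_sqrt (by linarith)).symm]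
    simp [lorentz]
    field_simp
    linear_combination Real.sqrt (x ^ 2 + c + 1) ^ 2 * Real.sin_sq_add_cos_sq y + q x h
  · simp [lorentz]; ring
  · simp [lorentz]
  · simp [lorentz]
    have : -Real.sin y / Real.sqrt (c + 1) * (-Real.sin y / Real.sqrt (c + 1))
        + Real.cos y / Real.sqrt (c + 1) * (Real.cos y / Real.sqrt (c + 1))
        = 1 / Real.sqrt (c + 1) ^ 2 := by
      field_simp
      linear_combination Real.sin_sq_add_cos_sq y
    rw [this]
    positivity

theorem profileData_immersionB {c : ℝ} (hc : c < -1) :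
    ProfileData c (immersionB c)
      (fun y => ![0, Real.sinh y / Real.sqrt (-c - 1), Real.cosh y / Real.sqrt (-c - 1), 0])
      (fun y => ![0, Real.cosh y / Real.sqrt (-c - 1), Real.sinh y / Real.sqrt (-c - 1), 0])
      ![1 / Real.sqrt (-c - 1), 0, 0, 0] (fun x => Real.sqrt (x ^ 2 + c + 1))
      (fun x => x / Real.sqrt (x ^ 2 + c + 1)) (fun x => (c + 1) / Real.sqrt (x ^ 2 + c + 1) ^ 3) := by
  have hk : 0 < Real.sqrt (-c - 1) := Real.sqrt_pos.2 (by linarith)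
  have qk : Real.sqrt (-c - 1) ^ 2 = -c - 1 := Real.sq_sqrt (by linarith)
  have hs : ∀ x, 0 < x ^ 2 + c → 0 < Real.sqrt (x ^ 2 + c + 1) := fun x h =>
    Real.sqrt_pos.2 (by linarith)
  have q : ∀ x, 0 < x ^ 2 + c → Real.sqrt (x ^ 2 + c + 1) ^ 2 = x ^ 2 - Real.sqrt (-c - 1) ^ 2 :=
    fun x h => by rw [qk, Real.sq_sqrt (by linarith)]; ring
  refine
  { eq := fun x y => ?_
    hasDerivAt_A := fun y => hasDerivAt_vec (hasDerivAt_const _ _)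
      ((Real.hasDerivAt_sinh y).div_const _)
      ((Real.hasDerivAt_cosh y).div_const _) (hasDerivAt_const _ _)
    A_three := fun y => rfl
    B_three := rfl
    hasDerivAt_γ := fun x _ h => hasDerivAt_sqrt_sq_add h
    hasDerivAt_γ₁ := fun x _ h => hasDerivAt_div_sqrt_sq_add h
    profile_eq := fun x _ h => sqrt_profile_eq h
    mem := fun x y _ h => ⟨?_, ?_⟩
    lorentz_P_Q := fun x y _ h => ?_
    lorentz_Q_Q := fun x y _ h => ?_
    lorentz_A'_A := fun y => ?_
    lorentz_A'_B := fun y => ?_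
    lorentz_A'_A' := fun y => ?_ }
  · ext i
    fin_cases i <;> simp [immersionB, dt] <;> ring
  · simp only [immersionB, Matrix.cons_val]
    field_simp
    linear_combination (-x ^ 2) * Real.cosh_sq y + q x h
  · have := Real.cosh_pos y
    simp only [immersionB, Matrix.cons_val]
    positivity
  · have := hs x h
    simp [lorentz]
    field_simp
    linear_combination (-x) * Real.cosh_sq y
  · have := hs x h
    rw [show x ^ 2 + c + 1 = Real.sqrt (x ^ 2 + c + 1) ^ 2 from (Real.sq_sqrt (by linarith)).symm]
    simp [lorentz]
    field_simp
    linear_combination (-Real.sqrt (x ^ 2 + c + 1) ^ 2) * Real.cosh_sq y - q x h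
  · simp [lorentz]; ring
  · simp [lorentz]
  · simp [lorentz]
    have : Real.cosh y / Real.sqrt (-c - 1) * (Real.cosh y / Real.sqrt (-c - 1))
        - Real.sinh y / Real.sqrt (-c - 1) * (Real.sinh y / Real.sqrt (-c - 1))
        = 1 / Real.sqrt (-c - 1) ^ 2 := by
      field_simp
      linear_combination Real.cosh_sq y
    rw [← sub_pos, this]
    positivity

theorem profileData_immersionC :
    ProfileData (-1) (immersionC (-1))
      (fun y => ![y, (1 - y ^ 2) / 2, (1 + y ^ 2) / 2, 0]) (fun y => ![1, -y, y, 0])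
      ![0, -1, 1, 0] (fun x => 1 / (2 * x)) (fun x => -1 / (2 * x ^ 2)) (fun x => 1 / x ^ 3) := by
  have hsq : ∀ y : ℝ, HasDerivAt (fun y : ℝ => y ^ 2) (2 * y) y := fun y => by
    simpa using hasDerivAt_pow 2 y
  refine
  { eq := fun x y => ?_
    hasDerivAt_A := fun y => ?_
    A_three := fun y => rfl
    B_three := rfl
    hasDerivAt_γ := fun x hx _ => ?_
    hasDerivAt_γ₁ := fun x hx _ => ?_
    profile_eq := fun x hx _ => ?_
    mem := fun x y hx _ => ⟨?_, ?_⟩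
    lorentz_P_Q := fun x y hx _ => ?_
    lorentz_Q_Q := fun x y hx _ => ?_
    lorentz_A'_A := fun y => ?_
    lorentz_A'_B := fun y => ?_
    lorentz_A'_A' := fun y => ?_ }
  · ext i
    fin_cases i <;> simp [immersionC, dt] <;> ring
  · refine hasDerivAt_vec (hasDerivAt_id y)
      ((((hsq y).const_sub 1).div_const 2).congr_deriv (by ring))
      ((((hsq y).const_add 1).div_const 2).congr_deriv (by ring)) (hasDerivAt_const _ _)
  · have h := ((hasDerivAt_id x).const_mul 2).fun_inv (by simpa using hx.ne')
    simp only [one_div]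
    refine h.congr_deriv ?_
    simp only [id]
    field_simp
  · have h := (((hsq x).const_mul 2).fun_inv (by positivity)).const_mul (-1)
    simp only [div_eq_mul_inv]
    refine h.congr_deriv ?_
    field_simp
  · field_simp; ring
  · simp only [immersionC, Matrix.cons_val]
    field_simp
    ring
  · simp only [immersionC, Matrix.cons_val]
    positivity
  · simp [lorentz]
    field_simp
    ring
  · simp [lorentz]
    field_simp
    ring
  · simp [lorentz]; ring
  · simp [lorentz]
  · simp [lorentz]

theorem IsModel.exists_modelFrame {c : ℝ} {G : ℝ → ℝ → Fin 4 → ℝ} (hG : IsModel c G) :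
    ∃ E R ν, ∀ v : Plane, 0 < v 0 → 0 < v 0 ^ 2 + c → ModelFrame c G E R ν v := by
  rcases hG with ⟨hc, rfl⟩ | ⟨hc, rfl⟩ | ⟨rfl, rfl⟩
  · exact ⟨_, _, _, fun v h0 h1 => (profileData_immersionA hc).modelFrame h0 h1⟩
  · exact ⟨_, _, _, fun v h0 h1 => (profileData_immersionB hc).modelFrame h0 h1⟩
  · exact ⟨_, _, _, fun v h0 h1 => profileData_immersionC.modelFrame h0 h1⟩


/-! ### Distances in `ℍ² × ℝ` -/

theorem hypDist_eq (P Q : Fin 4 → ℝ) :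
    hypDist P Q = Real.arcosh (-lorentz (ambientNormal P) (ambientNormal Q)) := by
  simp [hypDist, lorentz, ambientNormal]

theorem lorentz_hyperboloid {P Q : Fin 4 → ℝ} (hP : P ∈ H2R) (hQ : Q ∈ H2R) :
    1 ≤ -lorentz (ambientNormal P) (ambientNormal Q) := by
  obtain ⟨h1, h2⟩ := hP
  obtain ⟨h3, h4⟩ := hQ
  have e : -lorentz (ambientNormal P) (ambientNormal Q) = P 2 * Q 2 - (P 0 * Q 0 + P 1 * Q 1) := by
    simp [lorentz, ambientNormal]
  rw [e, le_sub_iff_add_le]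
  have h5 : 0 < P 2 * Q 2 := mul_pos h2 h4
  apply le_of_sq_le_sq _ h5.le
  have : (P 2 * Q 2) ^ 2 = (1 + P 0 ^ 2 + P 1 ^ 2) * (1 + Q 0 ^ 2 + Q 1 ^ 2) := by
    rw [mul_pow]; congr 1 <;> linarith
  rw [this]
  nlinarith [sq_nonneg (P 0 - Q 0), sq_nonneg (P 1 - Q 1), sq_nonneg (P 0 * Q 1 - P 1 * Q 0)]

theorem eq_of_lorentz_hyperboloid {P Q : Fin 4 → ℝ} (hP : P ∈ H2R) (hQ : Q ∈ H2R)
    (h : lorentz (ambientNormal P) (ambientNormal Q) = -1) :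
    ambientNormal P = ambientNormal Q := by
  obtain ⟨h1, h2⟩ := hP
  obtain ⟨h3, h4⟩ := hQ
  have e : P 2 * Q 2 = 1 + P 0 * Q 0 + P 1 * Q 1 := by
    simp [lorentz, ambientNormal] at h
    linarith
  have h5 : (P 2 * Q 2) ^ 2 = (1 + P 0 ^ 2 + P 1 ^ 2) * (1 + Q 0 ^ 2 + Q 1 ^ 2) := by
    rw [mul_pow]; congr 1 <;> linarith
  rw [e] at h5
  have h6 : (P 0 - Q 0) ^ 2 + (P 1 - Q 1) ^ 2 + (P 0 * Q 1 - P 1 * Q 0) ^ 2 = 0 := by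
    linear_combination (-1 : ℝ) * h5
  have a0 : P 0 = Q 0 := by
    nlinarith [sq_nonneg (P 0 - Q 0), sq_nonneg (P 1 - Q 1), sq_nonneg (P 0 * Q 1 - P 1 * Q 0)]
  have a1 : P 1 = Q 1 := by
    nlinarith [sq_nonneg (P 0 - Q 0), sq_nonneg (P 1 - Q 1), sq_nonneg (P 0 * Q 1 - P 1 * Q 0)]
  have a2 : P 2 = Q 2 := by
    rw [← sq_eq_sq₀ h2.le h4.le]
    rw [a0, a1] at h1
    linarith
  simp [ambientNormal, a0, a1, a2]

/-- On the lower sheet -Q would lie in `H2R`, and two points of the upper sheet have product at most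
-1, so Q and P would have a positive product. -/
theorem mem_H2R_of_lorentz {P Q : Fin 4 → ℝ} (hP : P ∈ H2R)
    (hQ : lorentz (ambientNormal Q) (ambientNormal Q) = -1)
    (h : lorentz (ambientNormal Q) (ambientNormal P) < 0) : Q ∈ H2R := by
  rw [mem_H2R_iff]
  refine ⟨hQ, ?_⟩
  by_contra! hn
  rcases hn.lt_or_eq with hneg | h0
  · have hmem : -Q ∈ H2R := by
      rw [mem_H2R_iff]
      refine ⟨?_, by simpa using hneg⟩
      rw [← hQ]; simp [lorentz, ambientNormal]
    have h1 := lorentz_hyperboloid hmem hP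
    have : lorentz (ambientNormal (-Q)) (ambientNormal P)
        = -lorentz (ambientNormal Q) (ambientNormal P) := by
      simp [lorentz, ambientNormal]; ring
    linarith
  · simp [lorentz, ambientNormal, h0] at hQ
    nlinarith [sq_nonneg (Q 0), sq_nonneg (Q 1)]

theorem hypDist_nonneg {P Q : Fin 4 → ℝ} (hP : P ∈ H2R) (hQ : Q ∈ H2R) : 0 ≤ hypDist P Q := by
  rw [hypDist_eq]; exact Real.arcosh_nonneg (lorentz_hyperboloid hP hQ)

theorem cosh_hypDist {P Q : Fin 4 → ℝ} (hP : P ∈ H2R) (hQ : Q ∈ H2R) :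
    Real.cosh (hypDist P Q) = -lorentz (ambientNormal P) (ambientNormal Q) := by
  rw [hypDist_eq]; exact Real.cosh_arcosh (lorentz_hyperboloid hP hQ)

theorem ambientDist_sq (P Q : Fin 4 → ℝ) :
    ambientDist P Q ^ 2 = hypDist P Q ^ 2 + (P 3 - Q 3) ^ 2 :=
  Real.sq_sqrt (by positivity)

theorem add_smul_dt_mem {P : Fin 4 → ℝ} (hP : P ∈ H2R) (s : ℝ) : P + s • dt ∈ H2R := by
  simpa [H2R, show dt 0 = 0 from rfl, show dt 1 = 0 from rfl, show dt 2 = 0 from rfl] using hP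

theorem ambientNormal_add_smul_dt (P : Fin 4 → ℝ) (s : ℝ) :
    ambientNormal (P + s • dt) = ambientNormal P := by
  simp [ambientNormal, dt]

theorem hypDist_add_smul_dt_right (P Q : Fin 4 → ℝ) (s : ℝ) :
    hypDist P (Q + s • dt) = hypDist P Q := by
  rw [hypDist_eq, hypDist_eq, ambientNormal_add_smul_dt]

theorem hypDist_self {P : Fin 4 → ℝ} (hP : P ∈ H2R) : hypDist P P = 0 := by
  rw [hypDist_eq, lorentz_ambientNormal_self hP]; simp

theorem hypDist_comm (P Q : Fin 4 → ℝ) : hypDist P Q = hypDist Q P := by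
  rw [hypDist_eq, hypDist_eq, lorentz_comm]

theorem hypDist_congr_left {P P' : Fin 4 → ℝ} (h : ambientNormal P = ambientNormal P')
    (Q : Fin 4 → ℝ) : hypDist P Q = hypDist P' Q := by
  rw [hypDist_eq, hypDist_eq, h]

/-- In a right isosceles triangle with legs a the hyperbolic hypotenuse has cosh equal to cosh²a,
the Euclidean one is √2·a. The inequality compares the power series of cosh(√2·a) and (cosh 2a +
1)/2 termwise. -/
theorem cosh_sqrt_two_mul_lt {a : ℝ} (ha : 0 < a) :
    Real.cosh (Real.sqrt 2 * a) < Real.cosh a ^ 2 := by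
  have h1 := Real.hasSum_cosh (Real.sqrt 2 * a)
  have h2 : HasSum (fun n : ℕ => ((2 * a) ^ (2 * n) / ((2 * n).factorial : ℝ)
      + if n = 0 then 1 else 0) / 2) ((Real.cosh (2 * a) + 1) / 2) :=
    ((Real.hasSum_cosh (2 * a)).add (hasSum_ite_eq 0 1)).div_const 2
  have h3 : Real.cosh a ^ 2 = (Real.cosh (2 * a) + 1) / 2 := by
    rw [Real.cosh_two_mul, Real.sinh_sq]; ring
  rw [h3]
  have e1 : ∀ n : ℕ, (Real.sqrt 2 * a) ^ (2 * n) = 2 ^ n * a ^ (2 * n) := fun n => by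
    rw [mul_pow, pow_mul, Real.sq_sqrt zero_le_two]
  have e2 : ∀ n : ℕ, (2 * a) ^ (2 * n) = 2 ^ n * 2 ^ n * a ^ (2 * n) := fun n => by
    rw [mul_pow, pow_mul, ← mul_pow]; norm_num
  -- The terms of index 0 and 1 agree; the fourth-order term is the first to differ.
  refine hasSum_lt (i := 2) (fun n => ?_) ?_ h1 h2
  · rcases Nat.eq_zero_or_pos n with rfl | hn
    · simp
    · simp only [hn.ne', if_false, add_zero]
      rw [e1, e2, div_right_comm]
      gcongr
      have : (2 : ℝ) ≤ 2 ^ n := by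
        calc (2 : ℝ) = 2 ^ 1 := by norm_num
          _ ≤ 2 ^ n := pow_le_pow_right₀ (by norm_num) hn
      rw [le_div_iff₀ two_pos, mul_comm _ (a ^ (2 * n)), mul_comm _ (a ^ (2 * n)), mul_assoc]
      gcongr
  · simp only [e1, e2]
    norm_num [Nat.factorial]
    have : 0 < a ^ 4 := by positivity
    linarith

/-- Lorentzian cross product in `ℝ³₁`. -/
def cross (u v : Fin 4 → ℝ) : Fin 4 → ℝ :=
  ![u 1 * v 2 - u 2 * v 1, u 2 * v 0 - u 0 * v 2, -(u 0 * v 1 - u 1 * v 0), 0]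

theorem lorentz_cross_left (u v : Fin 4 → ℝ) : lorentz (cross u v) u = 0 := by
  simp [lorentz, cross]; ring

theorem lorentz_cross_right (u v : Fin 4 → ℝ) : lorentz (cross u v) v = 0 := by
  simp [lorentz, cross]; ring

theorem lorentz_cross_self {u v : Fin 4 → ℝ} (hu : u 3 = 0) :
    lorentz (cross u v) (cross u v) = lorentz u v ^ 2 - lorentz u u * lorentz v v
      + (u 0 ^ 2 + u 1 ^ 2 - u 2 ^ 2) * v 3 ^ 2 := by
  simp [lorentz, cross, hu]; ring

/-- Two points of `ℍ² × ℝ` lie on a common vertical line iff the semi-parallelogram law is an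
equality for them. -/
theorem vertical_of_parallelogram {P Q M : Fin 4 → ℝ} (hP : P ∈ H2R) (hQ : Q ∈ H2R) (hM : M ∈ H2R)
    (h : ∀ R ∈ H2R, ambientDist P R ^ 2 + ambientDist Q R ^ 2 - 2 * ambientDist M R ^ 2
      = ambientDist P Q ^ 2 / 2) : ambientNormal P = ambientNormal Q := by
  simp only [ambientDist_sq] at h
  -- Comparing the identity at R = P and at P shifted vertically isolates the terms linear in the
  -- height of R.
  have hM3 : M 3 = (P 3 + Q 3) / 2 := by
    have h0 := h P hP
    have h1 := h _ (add_smul_dt_mem hP 1)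
    simp only [hypDist_add_smul_dt_right] at h1
    simp [show dt 3 = 1 from rfl] at h1
    nlinarith
  have hyp : ∀ R ∈ H2R, hypDist P R ^ 2 + hypDist Q R ^ 2 - 2 * hypDist M R ^ 2
      = hypDist P Q ^ 2 / 2 := by
    intro R hR
    have := h R hR
    rw [hM3] at this
    linarith
  set a := hypDist P Q / 2 with ha
  have ha0 : 0 ≤ a := by have := hypDist_nonneg hP hQ; positivity
  have hD : hypDist P Q = 2 * a := by rw [ha]; ring
  have hMP : hypDist M P = a := by
    have := hyp P hP
    rw [hypDist_self hP, hypDist_comm Q P, hD] at this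
    rw [← sq_eq_sq₀ (hypDist_nonneg hM hP) ha0]; linarith
  rcases ha0.eq_or_lt with hz | hpos
  · apply eq_of_lorentz_hyperboloid hP hQ
    have := cosh_hypDist hP hQ
    rw [hD, ← hz] at this
    simp at this
    linarith
  exfalso
  have hMQ : hypDist M Q = a := by
    have := hyp Q hQ
    rw [hypDist_self hQ, hD] at this
    rw [← sq_eq_sq₀ (hypDist_nonneg hM hQ) ha0]; linarith
  have cMP := cosh_hypDist hM hP
  have cMQ := cosh_hypDist hM hQ
  rw [hMP] at cMP
  rw [hMQ] at cMQ
  set m := ambientNormal M with hm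
  set p := ambientNormal P with hp
  set q := ambientNormal Q with hq
  have hmm : lorentz m m = -1 := lorentz_ambientNormal_self hM
  have hpp : lorentz p p = -1 := lorentz_ambientNormal_self hP
  set n := (Real.sinh a)⁻¹ • cross m p with hn
  have hnm : lorentz n m = 0 := by rw [hn, lorentz_smul_left, lorentz_cross_left, mul_zero]
  have hnp : lorentz n p = 0 := by rw [hn, lorentz_smul_left, lorentz_cross_right, mul_zero]
  have hnn : lorentz n n = 1 := by
    rw [hn, lorentz_smul_left, lorentz_smul_right, lorentz_cross_self rfl, hmm, hpp,
      show p 3 = 0 from rfl, show lorentz m p = -Real.cosh a by linarith]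
    have := Real.cosh_sq a
    field_simp
    linarith
  have hn3 : n 3 = 0 := by simp [hn, cross]
  -- R is the point at distance a from M on the geodesic perpendicular to MP, on the side given by
  -- σ. Since Q is not yet known to lie on the line through P and M, both sides are used to
  -- eliminate ⟨q, n⟩.
  have point : ∀ σ : ℝ, σ ^ 2 = 1 → ∃ R ∈ H2R, hypDist M R = a ∧
      Real.cosh (hypDist P R) = Real.cosh a ^ 2 ∧
      Real.cosh (hypDist Q R) = Real.cosh a ^ 2 - σ * Real.sinh a * lorentz q n := by
    intro σ hσ
    set R := Real.cosh a • m + (σ * Real.sinh a) • n with hR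
    have hR3 : R 3 = 0 := by simp [hR, hn3, show m 3 = 0 from rfl]
    have hRN : ambientNormal R = R := by rw [ambientNormal_eq, hR3]; simp
    have hRm : lorentz m R = -Real.cosh a := by
      rw [hR, lorentz_add_right, lorentz_smul_right, lorentz_smul_right, hmm,
        lorentz_comm m n, hnm]; ring
    have hRR : lorentz R R = -1 := by
      conv_lhs => rw [hR]
      simp only [lorentz_add_right, lorentz_add_left, lorentz_smul_right, lorentz_smul_left, hmm,
        hnn, hnm, lorentz_comm m n]
      have := Real.cosh_sq a
      linear_combination (Real.sinh a ^ 2) * hσ - this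
    have hRmem : R ∈ H2R := by
      apply mem_H2R_of_lorentz hM
      · rw [hRN, hRR]
      · rw [hRN, lorentz_comm, hRm]; linarith [Real.cosh_pos a]
    refine ⟨R, hRmem, ?_, ?_, ?_⟩
    · rw [hypDist_eq, hRN, hRm, neg_neg, Real.arcosh_cosh ha0]
    · rw [cosh_hypDist hP hRmem, hRN, hR, lorentz_add_right, lorentz_smul_right,
        lorentz_smul_right, lorentz_comm _ m, lorentz_comm _ n, hnp]
      linear_combination (-Real.cosh a) * cMP
    · rw [cosh_hypDist hQ hRmem, hRN, hR, lorentz_add_right, lorentz_smul_right,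
        lorentz_smul_right, lorentz_comm _ m]
      linear_combination (-Real.cosh a) * cMQ
  obtain ⟨R, hR, hMR, hPR, hQR⟩ := point 1 (by norm_num)
  obtain ⟨R', hR', hMR', hPR', hQR'⟩ := point (-1) (by norm_num)
  have ePR : hypDist P R = hypDist P R' :=
    Real.cosh_injOn (hypDist_nonneg hP hR) (hypDist_nonneg hP hR') (by rw [hPR, hPR'])
  have eQR : hypDist Q R = hypDist Q R' := by
    have h1 := hyp R hR
    have h2 := hyp R' hR'
    rw [hMR] at h1
    rw [hMR', ← ePR] at h2
    rw [← sq_eq_sq₀ (hypDist_nonneg hQ hR) (hypDist_nonneg hQ hR')]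
    linarith
  have hQR2 : Real.cosh (hypDist Q R) = Real.cosh a ^ 2 := by
    rw [← eQR] at hQR'
    linarith
  have eqPQ : hypDist Q R = hypDist P R :=
    Real.cosh_injOn (hypDist_nonneg hQ hR) (hypDist_nonneg hP hR) (by rw [hPR, hQR2])
  -- The assumed law gives the Euclidean hypotenuse √2·a for the right triangle PMR, whereas
  -- hyperbolic geometry gives cosh d(P,R) = cosh²a.
  have hρ : hypDist P R = Real.sqrt 2 * a := by
    have h1 := hyp R hR
    rw [hMR, eqPQ, hD] at h1
    rw [← sq_eq_sq₀ (hypDist_nonneg hP hR) (by positivity), mul_pow, Real.sq_sqrt zero_le_two]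
    linarith
  have := cosh_sqrt_two_mul_lt hpos
  rw [← hρ, hPR] at this
  exact lt_irrefl _ this

theorem parallelogram_of_vertical {P Q : Fin 4 → ℝ} (hP : P ∈ H2R)
    (h : ambientNormal P = ambientNormal Q) : ∃ M ∈ H2R, ∀ R ∈ H2R,
      ambientDist P R ^ 2 + ambientDist Q R ^ 2 - 2 * ambientDist M R ^ 2
        = ambientDist P Q ^ 2 / 2 := by
  refine ⟨P + ((Q 3 - P 3) / 2) • dt, add_smul_dt_mem hP _, fun R _ => ?_⟩
  simp only [ambientDist_sq]
  rw [hypDist_congr_left (ambientNormal_add_smul_dt P _), ← hypDist_congr_left h R,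
    hypDist_comm P Q, ← hypDist_congr_left h P, hypDist_self hP]
  simp [show dt 3 = 1 from rfl]
  ring

/-! ### Isometries of ℍ² × ℝ are affine products -/

theorem exists_sign_of_isometry_real {g : ℝ → ℝ} (h : ∀ s t, (g s - g t) ^ 2 = (s - t) ^ 2) :
    ∃ ε : ℝ, ε ^ 2 = 1 ∧ ∀ t, g t = ε * t + g 0 := by
  refine ⟨g 1 - g 0, by rw [h]; norm_num, fun t => ?_⟩
  have h1 := h 1 0
  have h2 := h t 0
  have h3 := h t 1
  -- Polarization: the increments of g have the same products as the increments of the variable.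
  have h4 : (g t - g 0) * (g 1 - g 0) = t := by linarith
  have h5 : (g 1 - g 0) * ((g t - g 0) * (g 1 - g 0)) = (g 1 - g 0) * t := by rw [h4]
  have h6 : (g t - g 0) * (g 1 - g 0) ^ 2 = (g 1 - g 0) * t := by rw [← h5]; ring
  rw [h1] at h6
  linarith

/-- A map of `ℝ³₁ × ℝ` preserving the scalar product and the direction of `∂_t`. -/
structure IsLorentzMap (L : (Fin 4 → ℝ) →L[ℝ] (Fin 4 → ℝ)) (ε : ℝ) : Prop where
  sign : ε ^ 2 = 1
  map_lorentz : ∀ u v, lorentz (L u) (L v) = lorentz u v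
  map_dt : L dt = ε • dt

namespace IsLorentzMap

variable {L : (Fin 4 → ℝ) →L[ℝ] (Fin 4 → ℝ)} {ε : ℝ} (hL : IsLorentzMap L ε)
include hL

theorem injective : Function.Injective L := by
  rw [injective_iff_map_eq_zero]
  intro u hu
  apply lorentz_nondegenerate
  intro v
  rw [← hL.map_lorentz, hu, lorentz_zero_left]

theorem surjective : Function.Surjective L :=
  (LinearMap.injective_iff_surjective (f := L.toLinearMap)).1 hL.injective

theorem apply_three (u : Fin 4 → ℝ) : L u 3 = ε * u 3 := by
  have h := hL.map_lorentz dt u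
  rw [hL.map_dt, lorentz_smul_left, lorentz_dt_left, lorentz_dt_left] at h
  rw [← h, ← mul_assoc, ← sq, hL.sign, one_mul]

theorem ambientNormal (P : Fin 4 → ℝ) (b : ℝ) :
    ambientNormal (L P + b • dt) = L (_root_.ambientNormal P) := by
  rw [ambientNormal_add_smul_dt, ambientNormal_eq, ambientNormal_eq, map_sub, map_smul, hL.map_dt,
    hL.apply_three, smul_smul, mul_comm]

end IsLorentzMap

/-- The semi-parallelogram equality involves distances only, so Φ preserves it; surjectivity is
needed because the test point ranges over all of `H2R`. -/
theorem IsAmbientIsometry.vertical {Φ : (Fin 4 → ℝ) → (Fin 4 → ℝ)} (hΦ : IsAmbientIsometry Φ)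
    {P Q : Fin 4 → ℝ} (hP : P ∈ H2R) (hQ : Q ∈ H2R) (h : ambientNormal P = ambientNormal Q) :
    ambientNormal (Φ P) = ambientNormal (Φ Q) := by
  obtain ⟨M, hM, hR⟩ := parallelogram_of_vertical hP h
  refine vertical_of_parallelogram (hΦ.1.mapsTo hP) (hΦ.1.mapsTo hQ) (hΦ.1.mapsTo hM) ?_
  intro R' hR'
  obtain ⟨R, hRm, rfl⟩ := hΦ.1.surjOn hR'
  rw [hΦ.2 _ hP _ hRm, hΦ.2 _ hQ _ hRm, hΦ.2 _ hM _ hRm, hΦ.2 _ hP _ hQ]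
  exact hR R hRm

theorem ambientNormal_mem {P : Fin 4 → ℝ} (hP : P ∈ H2R) : ambientNormal P ∈ H2R := by
  simpa [H2R, ambientNormal] using hP

@[simp] theorem ambientNormal_idem (P : Fin 4 → ℝ) :
    ambientNormal (ambientNormal P) = ambientNormal P := by
  simp [ambientNormal]

/-- An isometry of `ℍ² × ℝ` is the product of isometries of the factors. -/
theorem IsAmbientIsometry.product {Φ : (Fin 4 → ℝ) → (Fin 4 → ℝ)} (hΦ : IsAmbientIsometry Φ) :
    ∃ ε b : ℝ, ε ^ 2 = 1 ∧ (∀ P ∈ H2R, Φ P 3 = ε * P 3 + b) ∧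
      ∀ P ∈ H2R, ∀ Q ∈ H2R, lorentz (ambientNormal (Φ P)) (ambientNormal (Φ Q))
        = lorentz (ambientNormal P) (ambientNormal Q) := by
  have hmem : ∀ P ∈ H2R, ∀ t : ℝ, ambientNormal P + t • dt ∈ H2R := fun P hP t =>
    add_smul_dt_mem (ambientNormal_mem hP) t
  have hdec : ∀ P : Fin 4 → ℝ, ambientNormal P + P 3 • dt = P := fun P => by
    rw [ambientNormal_eq]; simp
  have h3 : ∀ (P : Fin 4 → ℝ) (t : ℝ), (ambientNormal P + t • dt) 3 = t := fun P t => by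
    simp [ambientNormal, dt]
  have hsgn : ∀ P ∈ H2R, ∃ ε : ℝ, ε ^ 2 = 1 ∧ ∀ t : ℝ,
      Φ (ambientNormal P + t • dt) 3 = ε * t + Φ (ambientNormal P + (0 : ℝ) • dt) 3 := by
    intro P hP
    refine exists_sign_of_isometry_real (g := fun t => Φ (ambientNormal P + t • dt) 3) ?_
    intro s t
    have hv := hΦ.vertical (hmem P hP s) (hmem P hP t)
      (by rw [ambientNormal_add_smul_dt, ambientNormal_add_smul_dt])
    have hd := congrArg (· ^ 2) (hΦ.2 _ (hmem P hP s) _ (hmem P hP t))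
    simp only [ambientDist_sq] at hd
    rw [hypDist_congr_left hv, hypDist_self (hΦ.1.mapsTo (hmem P hP t)),
      hypDist_congr_left (P' := ambientNormal P + t • dt)
        (by rw [ambientNormal_add_smul_dt, ambientNormal_add_smul_dt]),
      hypDist_self (hmem P hP t), h3, h3] at hd
    simpa using hd
  choose! ε hε hτ using hsgn
  have hNΦ : ∀ P ∈ H2R, ∀ t : ℝ, ambientNormal (Φ (ambientNormal P + t • dt))
      = ambientNormal (Φ P) := fun P hP t =>
    hΦ.vertical (hmem P hP t) hP (by rw [ambientNormal_add_smul_dt, ambientNormal_idem])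
  -- Distance between arbitrary points of the vertical lines over P and Q. Its values at three pairs
  -- of heights force the same sign and the same shift over all points.
  have main : ∀ P ∈ H2R, ∀ Q ∈ H2R, ∀ s t : ℝ,
      hypDist (Φ P) (Φ Q) ^ 2 + (ε P * s + Φ (ambientNormal P + (0 : ℝ) • dt) 3
        - (ε Q * t + Φ (ambientNormal Q + (0 : ℝ) • dt) 3)) ^ 2
      = hypDist P Q ^ 2 + (s - t) ^ 2 := by
    intro P hP Q hQ s t
    have hd := congrArg (· ^ 2) (hΦ.2 _ (hmem P hP s) _ (hmem Q hQ t))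
    simp only [ambientDist_sq] at hd
    rw [hτ P hP, hτ Q hQ, h3, h3, hypDist_eq, hypDist_eq (ambientNormal P + s • dt), hNΦ P hP,
      hNΦ Q hQ, ambientNormal_add_smul_dt, ambientNormal_add_smul_dt, ambientNormal_idem,
      ambientNormal_idem, ← hypDist_eq, ← hypDist_eq] at hd
    exact hd
  let O : Fin 4 → ℝ := ![0, 0, 1, 0]
  have hO : O ∈ H2R := by simp [H2R, O]
  have cons : ∀ P ∈ H2R, ∀ Q ∈ H2R, ε P = ε Q ∧
      Φ (ambientNormal P + (0 : ℝ) • dt) 3 = Φ (ambientNormal Q + (0 : ℝ) • dt) 3 ∧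
      hypDist (Φ P) (Φ Q) ^ 2 = hypDist P Q ^ 2 := by
    intro P hP Q hQ
    have m0 := main P hP Q hQ 0 0
    have m1 := main P hP Q hQ 1 0
    have m2 := main P hP Q hQ 1 1
    set β := Φ (ambientNormal P + (0 : ℝ) • dt) 3
    set β' := Φ (ambientNormal Q + (0 : ℝ) • dt) 3
    have e1 := hε P hP
    have hprod : ε P * (β - β') = 0 := by linarith
    have hβ : β - β' = 0 := by
      rcases mul_eq_zero.1 hprod with h | h
      · rw [h] at e1; norm_num at e1
      · exact h
    have hβ' : β = β' := by linarith
    rw [hβ'] at m0 m2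
    refine ⟨?_, hβ', by linarith⟩
    have : (ε P - ε Q) ^ 2 = 0 := by linarith
    have := pow_eq_zero_iff two_ne_zero |>.1 this
    linarith
  refine ⟨ε O, Φ (ambientNormal O + (0 : ℝ) • dt) 3, hε O hO, fun P hP => ?_, fun P hP Q hQ => ?_⟩
  · have h := hτ P hP (P 3)
    rw [hdec] at h
    rw [h, (cons P hP O hO).1, (cons P hP O hO).2.1]
  · have hd := (cons P hP Q hQ).2.2
    rw [sq_eq_sq₀ (hypDist_nonneg (hΦ.1.mapsTo hP) (hΦ.1.mapsTo hQ)) (hypDist_nonneg hP hQ)] at hd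
    have hc := congrArg Real.cosh hd
    rw [cosh_hypDist (hΦ.1.mapsTo hP) (hΦ.1.mapsTo hQ), cosh_hypDist hP hQ] at hc
    linarith

/-- Isometries of `ℍ² × ℝ` are restrictions of affine maps of `ℝ³₁ × ℝ`. -/
theorem IsAmbientIsometry.exists_lorentzMap {Φ : (Fin 4 → ℝ) → (Fin 4 → ℝ)}
    (hΦ : IsAmbientIsometry Φ) : ∃ (L : (Fin 4 → ℝ) →L[ℝ] (Fin 4 → ℝ)) (ε b : ℝ),
      IsLorentzMap L ε ∧ ∀ P ∈ H2R, Φ P = L P + b • dt := by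
  obtain ⟨ε, b, hε, h3, hN⟩ := hΦ.product
  -- Three points of ℍ² that form a basis of ℝ³₁. A linear map is prescribed by their images; the
  -- coefficients in `Ll` are the coordinates in this basis.
  let p₀ : Fin 4 → ℝ := ![0, 0, 1, 0]
  let p₁ : Fin 4 → ℝ := ![1, 0, Real.sqrt 2, 0]
  let p₂ : Fin 4 → ℝ := ![0, 1, Real.sqrt 2, 0]
  have h₀ : p₀ ∈ H2R := by simp [H2R, p₀]
  have h₁ : p₁ ∈ H2R := by simp [H2R, p₁]; norm_num
  have h₂ : p₂ ∈ H2R := by simp [H2R, p₂]; norm_num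
  let φ : (Fin 4 → ℝ) → (Fin 4 → ℝ) := fun P => ambientNormal (Φ P)
  let Ll : (Fin 4 → ℝ) →ₗ[ℝ] (Fin 4 → ℝ) :=
    { toFun := fun v => v 0 • φ p₁ + v 1 • φ p₂
        + (v 2 - Real.sqrt 2 * v 0 - Real.sqrt 2 * v 1) • φ p₀ + (v 3 * ε) • dt
      map_add' := fun u v => by simp only [Pi.add_apply]; module
      map_smul' := fun a v => by simp only [Pi.smul_apply, smul_eq_mul, RingHom.id_apply]; module }
  let L := LinearMap.toContinuousLinearMap Ll
  have hLapp : ∀ v, L v = v 0 • φ p₁ + v 1 • φ p₂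
      + (v 2 - Real.sqrt 2 * v 0 - Real.sqrt 2 * v 1) • φ p₀ + (v 3 * ε) • dt := fun v => rfl
  have hLdt : L dt = ε • dt := by rw [hLapp]; simp [dt]
  have hφd : ∀ P, lorentz (φ P) dt = 0 := fun P => lorentz_ambientNormal_dt _
  have hdφ : ∀ P, lorentz dt (φ P) = 0 := fun P => lorentz_dt_ambientNormal _
  have hφφ : ∀ P ∈ H2R, ∀ Q ∈ H2R, lorentz (φ P) (φ Q)
      = P 0 * Q 0 + P 1 * Q 1 - P 2 * Q 2 := fun P hP Q hQ => by
    rw [hN P hP Q hQ]; simp [lorentz, ambientNormal]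
  have hLL : ∀ u v, lorentz (L u) (L v) = lorentz u v := by
    intro u v
    rw [hLapp, hLapp]
    simp only [lorentz_add_left, lorentz_add_right, lorentz_smul_left, lorentz_smul_right, hφd, hdφ,
      lorentz_dt_dt, hφφ _ h₀ _ h₀, hφφ _ h₀ _ h₁, hφφ _ h₀ _ h₂, hφφ _ h₁ _ h₀, hφφ _ h₁ _ h₁,
      hφφ _ h₁ _ h₂, hφφ _ h₂ _ h₀, hφφ _ h₂ _ h₁, hφφ _ h₂ _ h₂]
    simp only [p₀, p₁, p₂, Matrix.cons_val, lorentz]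
    linear_combination (u 3 * v 3) * hε
  have hL : IsLorentzMap L ε := ⟨hε, hLL, hLdt⟩
  refine ⟨L, ε, b, hL, fun P hP => ?_⟩
  have hkey : L (ambientNormal P) = φ P := by
    -- L(N) and φ(P) have the same products with φ(p₀), φ(p₁), φ(p₂) and with ∂_t, that is, with the
    -- whole image of L, which is everything.
    rw [← sub_eq_zero]
    apply lorentz_nondegenerate
    intro v
    obtain ⟨w, rfl⟩ := hL.surjective v
    rw [lorentz_sub_left, hLL, hLapp w]
    simp only [lorentz_add_right, lorentz_smul_right, hφd, hφφ _ hP _ h₀, hφφ _ hP _ h₁,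
      hφφ _ hP _ h₂]
    simp only [p₀, p₁, p₂, Matrix.cons_val, lorentz, ambientNormal]
    ring
  have e1 : Φ P = φ P + Φ P 3 • dt := by
    simp only [φ]; rw [ambientNormal_eq]; simp
  have e2 : P = ambientNormal P + P 3 • dt := by rw [ambientNormal_eq]; simp
  rw [e1, h3 P hP, ← hkey]
  conv_rhs => rw [e2, map_add, map_smul, hLdt]
  module


/-! ### From the surface to coordinates -/

theorem normal_three_sq_le_one {P v : Fin 4 → ℝ} (hP : P ∈ H2R) (h0 : lorentz v (ambientNormal P) = 0)
    (h1 : lorentz v v = 1) : v 3 ^ 2 ≤ 1 := by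
  have := horizontal_nonneg hP h0
  have e : lorentz v v = (v 0 ^ 2 + v 1 ^ 2 - v 2 ^ 2) + v 3 ^ 2 := by simp only [lorentz]; ring
  linarith

theorem normal_three_ne_zero {M : Type*} {ξ : M → Fin 4 → ℝ} {p : M} (h : angle ξ p ≠ Real.pi / 2) :
    ξ p 3 ≠ 0 := by
  intro h0
  apply h
  rw [angle, lorentz_dt_left, h0, Real.arccos_zero]

section Surface

variable {M : Type*} [TopologicalSpace M] [ChartedSpace (EuclideanSpace ℝ (Fin 2)) M]

theorem IsUnitNormal.cos_angle {F ξ : M → Fin 4 → ℝ} (hF : IsImmersedSurface F)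
    (hξ : IsUnitNormal F ξ) (p : M) : Real.cos (angle ξ p) = ξ p 3 := by
  have h := normal_three_sq_le_one (hF.2.1 p) (hξ.2 p).2.1 (hξ.2 p).1
  rw [angle, lorentz_dt_left, Real.cos_arccos]
  · nlinarith
  · nlinarith

theorem IsUnitNormal.tangentPart_eq {F ξ : M → Fin 4 → ℝ} (hF : IsImmersedSurface F)
    (hξ : IsUnitNormal F ξ) (p : M) : tangentPart ξ p = dt - ξ p 3 • ξ p := by
  rw [tangentPart, hξ.cos_angle hF]

theorem exists_principalCurvature {F ξ : M → Fin 4 → ℝ} (hP : IsPrincipalT F ξ) :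
    ∃ κ : M → ℝ, ∀ p, ∃ X : TangentSpace (𝓡 2) p, X ≠ 0 ∧ diffAt F p X = tangentPart ξ p ∧
      shapeOperator F ξ p X = κ p • diffAt F p X := by
  choose X κ h using hP
  exact ⟨κ, fun p => ⟨X p, h p⟩⟩

variable {e : OpenPartialHomeomorph M (EuclideanSpace ℝ (Fin 2))}

theorem contDiffOn_chart {V : Type*} [NormedAddCommGroup V] [NormedSpace ℝ V]
    (he : e ∈ IsManifold.maximalAtlas (𝓡 2) ∞ M) {F : M → V} {s : Set M}
    (hF : ContMDiffOn (𝓡 2) 𝓘(ℝ, V) ∞ F s) :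
    ContDiffOn ℝ ∞ (F ∘ e.symm) (e.target ∩ e.symm ⁻¹' s) := by
  rw [← contMDiffOn_iff_contDiffOn]
  exact hF.comp ((contMDiffOn_symm_of_mem_maximalAtlas he).mono Set.inter_subset_left)
    fun x hx => hx.2

theorem mdifferentiable_chart_of_mem (he : e ∈ IsManifold.maximalAtlas (𝓡 2) ∞ M) :
    e.MDifferentiable (𝓡 2) (𝓡 2) :=
  ⟨(contMDiffOn_of_mem_maximalAtlas he).mdifferentiableOn (by simp),
    (contMDiffOn_symm_of_mem_maximalAtlas he).mdifferentiableOn (by simp)⟩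

variable [IsManifold (𝓡 2) ∞ M]

/-- The coordinate description of the differentials of maps at a point of a chart. -/
theorem exists_chart_differential (he : e ∈ IsManifold.maximalAtlas (𝓡 2) ∞ M) {u : Plane}
    (hu : u ∈ e.target) : ∃ D : Plane →ₗ[ℝ] TangentSpace (𝓡 2) (e.symm u),
      Function.Bijective D ∧ ∀ F : M → Fin 4 → ℝ,
        MDifferentiableAt (𝓡 2) 𝓘(ℝ, Fin 4 → ℝ) F (e.symm u) → ∀ v,
          diffAt F (e.symm u) (D v) = fderiv ℝ (F ∘ e.symm) u v := by
  have hd := mdifferentiable_chart_of_mem he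
  have : IsManifold (𝓡 2) 1 M := IsManifold.of_le (n := ∞) ENat.LEInfty.out
  refine ⟨(mfderiv (𝓡 2) (𝓡 2) e.symm u : _ →L[ℝ] _).toLinearMap,
    hd.symm.mfderiv_bijective hu, fun F hF v => ?_⟩
  have h := mfderiv_comp u hF (hd.mdifferentiableAt_symm hu)
  rw [← mfderiv_eq_fderiv, h]
  rfl

theorem isLocalSurface_chart {F ξ : M → Fin 4 → ℝ} (hF : IsImmersedSurface F)
    (hξ : IsUnitNormal F ξ) (he : e ∈ IsManifold.maximalAtlas (𝓡 2) ∞ M) :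
    IsLocalSurface e.target (F ∘ e.symm) (ξ ∘ e.symm) where
  isOpen := e.open_target
  contDiffOn := by simpa using contDiffOn_chart he hF.1.contMDiffOn (s := Set.univ)
  contDiffOn_normal := by simpa using contDiffOn_chart he hξ.1.contMDiffOn (s := Set.univ)
  mem := fun u _ => hF.2.1 _
  injective := fun u hu => by
    obtain ⟨D, hD, hDF⟩ := exists_chart_differential he hu
    intro v w hvw
    rw [← hDF F (hF.1.mdifferentiable (by simp) _), ← hDF F (hF.1.mdifferentiable (by simp) _)]
      at hvw
    exact hD.1 (hF.2.2 _ hvw)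
  unit := fun u _ => (hξ.2 _).1
  normal_ambient := fun u _ => (hξ.2 _).2.1
  normal_tangent := fun u hu X => by
    obtain ⟨D, hD, hDF⟩ := exists_chart_differential he hu
    rw [← hDF F (hF.1.mdifferentiable (by simp) _)]
    exact (hξ.2 _).2.2 _

theorem isFlatPrincipal_chart {F ξ : M → Fin 4 → ℝ} (hF : IsImmersedSurface F)
    (hξ : IsUnitNormal F ξ) (hC : ∀ p, ξ p 3 ≠ 0) (hflat : IsFlatSurface F) {κ : M → ℝ}
    (hκ : ∀ p, ∃ X : TangentSpace (𝓡 2) p, X ≠ 0 ∧ diffAt F p X = tangentPart ξ p ∧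
      shapeOperator F ξ p X = κ p • diffAt F p X)
    (he : e ∈ IsManifold.maximalAtlas (𝓡 2) ∞ M) :
    IsFlatPrincipal e.target (F ∘ e.symm) (ξ ∘ e.symm) (κ ∘ e.symm) where
  toIsLocalSurface := isLocalSurface_chart hF hξ he
  cos_ne := fun u _ => hC _
  principal := fun u hu => by
    obtain ⟨D, hD, hDF⟩ := exists_chart_differential he hu
    obtain ⟨X, hX, hT, hA⟩ := hκ (e.symm u)
    obtain ⟨Z, rfl⟩ := hD.2 X
    rw [hξ.tangentPart_eq hF, hDF F (hF.1.mdifferentiable (by simp) _)] at hT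
    rw [shapeOperator, hDF F (hF.1.mdifferentiable (by simp) _),
      hDF ξ (hξ.1.mdifferentiable (by simp) _)] at hA
    refine ⟨Z, ?_, hT, hA⟩
    rintro rfl
    exact hX (map_zero D)
  flat := fun u hu => hflat e he u hu

/-- A function with vanishing derivative in every chart is constant. -/
theorem eq_of_hasFDerivAt_zero [ConnectedSpace M] {V : Type*} [NormedAddCommGroup V]
    [NormedSpace ℝ V] {h : M → V}
    (hd : ∀ e ∈ IsManifold.maximalAtlas (𝓡 2) ∞ M, ∀ u ∈ e.target,
      HasFDerivAt (h ∘ e.symm) (0 : Plane →L[ℝ] V) u) (p q : M) : h p = h q := by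
  have hloc : IsLocallyConstant h := by
    rw [IsLocallyConstant.iff_eventually_eq]
    intro x
    set e := chartAt (EuclideanSpace ℝ (Fin 2)) x with he
    have hmem : e ∈ IsManifold.maximalAtlas (𝓡 2) ∞ M := IsManifold.chart_mem_maximalAtlas x
    have hx : x ∈ e.source := mem_chart_source _ x
    obtain ⟨r, hr, hball⟩ := Metric.isOpen_iff.1 e.open_target (e x) (e.map_source hx)
    have hc : ∀ᶠ y in nhds x, e y ∈ Metric.ball (e x) r :=
      (e.continuousAt hx).eventually (Metric.ball_mem_nhds _ hr)
    filter_upwards [hc, e.open_source.mem_nhds hx] with y hy hys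
    have hz : ∀ v ∈ Metric.ball (e x) r, fderivWithin ℝ (h ∘ e.symm) (Metric.ball (e x) r) v = 0 :=
      fun v hv => by
        rw [fderivWithin_of_isOpen Metric.isOpen_ball hv]
        exact (hd e hmem v (hball hv)).fderiv
    have := (convex_ball (e x) r).is_const_of_fderivWithin_eq_zero
      (fun v hv => (hd e hmem v (hball hv)).differentiableAt.differentiableWithinAt) hz hy
      (Metric.mem_ball_self hr)
    simpa [e.left_inv hx, e.left_inv hys] using this
  exact hloc.apply_eq_of_preconnectedSpace p q

end Surface

/-! ### Surfaces given by the explicit immersions -/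

section Surface

variable {M : Type*} [TopologicalSpace M] [ChartedSpace (EuclideanSpace ℝ (Fin 2)) M]
  [IsManifold (𝓡 2) ∞ M] {e : OpenPartialHomeomorph M (EuclideanSpace ℝ (Fin 2))}

theorem exists_chart_differential' (he : e ∈ IsManifold.maximalAtlas (𝓡 2) ∞ M) {p : M}
    (hp : p ∈ e.source) : ∃ D : Plane →ₗ[ℝ] TangentSpace (𝓡 2) p,
      Function.Bijective D ∧ ∀ F : M → Fin 4 → ℝ,
        MDifferentiableAt (𝓡 2) 𝓘(ℝ, Fin 4 → ℝ) F p → ∀ v,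
          diffAt F p (D v) = fderiv ℝ (F ∘ e.symm) (e p) v := by
  have h := exists_chart_differential he (e.map_source hp)
  rwa [e.left_inv hp] at h

/-- First order data of a surface given by an explicit immersion. -/
theorem IsRepresentation.local_data {F ξ : M → Fin 4 → ℝ} (hF : IsImmersedSurface F)
    (hξ : IsUnitNormal F ξ) {c : ℝ} {Φ : (Fin 4 → ℝ) → (Fin 4 → ℝ)} {G : ℝ → ℝ → Fin 4 → ℝ}
    (hrep : IsRepresentation F c Φ G e) {L : (Fin 4 → ℝ) →L[ℝ] (Fin 4 → ℝ)} {ε b : ℝ}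
    (hL : IsLorentzMap L ε) (hΦ : ∀ P ∈ H2R, Φ P = L P + b • dt) {E R ν : ℝ → ℝ → Fin 4 → ℝ}
    (hm : ∀ v : Plane, 0 < v 0 → 0 < v 0 ^ 2 + c → ModelFrame c G E R ν v) {v : Plane}
    (hv : v ∈ e.target) :
    0 < v 0 ∧ 0 < v 0 ^ 2 + c ∧
    ambientNormal ((F ∘ e.symm) v) = L (ambientNormal (G (v 0) (v 1))) ∧
    (∀ X, fderiv ℝ (F ∘ e.symm) v X = X 0 • L (E (v 0) (v 1)) + X 1 • L (R (v 0) (v 1))) ∧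
    ∃ a : ℝ, a ^ 2 = 1 ∧ (ξ ∘ e.symm) v = a • L (ν (v 0) (v 1)) ∧
      ∀ X, fderiv ℝ (ξ ∘ e.symm) v X = a •
        (X 0 • (-(v 0 / (Real.sqrt (v 0 ^ 2 + c) * (v 0 ^ 2 + c + 1))) • L (E (v 0) (v 1))
          - (Real.sqrt (v 0 ^ 2 + c) / (v 0 ^ 2 + c + 1)) • L (ambientNormal (G (v 0) (v 1))))
        + X 1 • (-(Real.sqrt (v 0 ^ 2 + c) / v 0) • L (R (v 0) (v 1)))) := by
  obtain ⟨he, hrep⟩ := hrep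
  have S := isLocalSurface_chart hF hξ he
  have hpos : ∀ w ∈ e.target, 0 < w 0 ∧ 0 < w 0 ^ 2 + c ∧
      (F ∘ e.symm) w = L (G (w 0) (w 1)) + b • dt := by
    intro w hw
    obtain ⟨h0, h1, h2⟩ := hrep (e.symm w) (e.map_target hw)
    rw [e.right_inv hw] at h0 h1 h2
    exact ⟨h0, h1, by rw [Function.comp_apply, h2, hΦ _ (hm w h0 h1).mem]⟩
  have hN : ∀ w ∈ e.target,
      ambientNormal ((F ∘ e.symm) w) = L (ambientNormal (G (w 0) (w 1))) := by
    intro w hw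
    rw [(hpos w hw).2.2, hL.ambientNormal]
  have hfd : ∀ w ∈ e.target, ∀ X, fderiv ℝ (F ∘ e.symm) w X
      = X 0 • L (E (w 0) (w 1)) + X 1 • L (R (w 0) (w 1)) := by
    intro w hw X
    have h1 : HasFDerivAt (fun w : Plane => L (G (w 0) (w 1)) + b • dt)
        (L.comp _) w :=
      (L.hasFDerivAt.comp w (hm w (hpos w hw).1 (hpos w hw).2.1).hasFDerivAt).add_const _
    have h2 := (h1.congr_of_eventuallyEq (Filter.eventuallyEq_of_mem (S.isOpen.mem_nhds hw)
      fun z hz => (hpos z hz).2.2)).fderiv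
    rw [h2]
    simp
  have hn : ∀ w ∈ e.target, (lorentz ((ξ ∘ e.symm) w) (L (ν (w 0) (w 1)))) ^ 2 = 1 ∧
      (ξ ∘ e.symm) w = lorentz ((ξ ∘ e.symm) w) (L (ν (w 0) (w 1))) • L (ν (w 0) (w 1)) := by
    intro w hw
    obtain ⟨h0, h1, -⟩ := hpos w hw
    have m := hm w h0 h1
    have hE : lorentz ((ξ ∘ e.symm) w) (L (E (w 0) (w 1))) = 0 := by
      have := S.normal_tangent w hw (EuclideanSpace.single 0 1)
      rw [hfd w hw] at this
      simpa using this
    have hR : lorentz ((ξ ∘ e.symm) w) (L (R (w 0) (w 1))) = 0 := by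
      have := S.normal_tangent w hw (EuclideanSpace.single 1 1)
      rw [hfd w hw] at this
      simpa using this
    have hNN : lorentz ((ξ ∘ e.symm) w) (L (ambientNormal (G (w 0) (w 1)))) = 0 := by
      have := S.normal_ambient w hw
      rwa [hN w hw] at this
    -- The images under L of the model normal, its two tangents and the position vector form an
    -- orthogonal basis, and ξ is orthogonal to the last three: it is a multiple of the first.
    have key := orthogonal_expansion (L (ν (w 0) (w 1))) (L (E (w 0) (w 1)))
      (L (R (w 0) (w 1))) (L (ambientNormal (G (w 0) (w 1)))) ((ξ ∘ e.symm) w)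
      (by rw [hL.map_lorentz, m.lorentz_ν_E]) (by rw [hL.map_lorentz, m.lorentz_ν_R])
      (by rw [hL.map_lorentz, m.lorentz_ν_normal]) (by rw [hL.map_lorentz, m.lorentz_E_R])
      (by rw [hL.map_lorentz, m.lorentz_E_normal]) (by rw [hL.map_lorentz, m.lorentz_R_normal])
      (by rw [hL.map_lorentz, m.lorentz_ν_ν]; norm_num)
      (by rw [hL.map_lorentz, m.lorentz_E_E]; norm_num)
      (by rw [hL.map_lorentz]; exact m.lorentz_R_R.ne')
      (by rw [hL.map_lorentz, lorentz_ambientNormal_self m.mem]; norm_num)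
    rw [hE, hR, hNN, hL.map_lorentz, m.lorentz_ν_ν] at key
    simp only [zero_div, zero_smul, add_zero, div_one] at key
    refine ⟨?_, key⟩
    have hu := S.unit w hw
    rw [key, lorentz_smul_left, lorentz_smul_right, hL.map_lorentz, m.lorentz_ν_ν] at hu
    linarith
  obtain ⟨h0, h1, -⟩ := hpos v hv
  have m := hm v h0 h1
  refine ⟨h0, h1, hN v hv, hfd v hv, _, (hn v hv).1, (hn v hv).2, fun X => ?_⟩
  set a : Plane → ℝ := fun w => lorentz ((ξ ∘ e.symm) w) (L (ν (w 0) (w 1))) with ha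
  have hdν := L.hasFDerivAt.comp v m.hasFDerivAt_normal
  have hda := (S.hasFDerivAt_normal hv).lorentz hdν
  -- The factor a takes the values ±1, and differentiating a² = 1 shows that its derivative
  -- vanishes.
  have hda0 : HasFDerivAt a (0 : Plane →L[ℝ] ℝ) v := by
    have h2 := hda.fun_mul hda
    have h3 : HasFDerivAt (fun w => a w * a w) (0 : Plane →L[ℝ] ℝ) v :=
      (hasFDerivAt_const (1 : ℝ) v).congr_of_eventuallyEq
        (Filter.eventuallyEq_of_mem (S.isOpen.mem_nhds hv) fun z hz => by
          simpa only [sq] using (hn z hz).1)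
    have h4 := h2.unique h3
    refine hda.congr_fderiv ?_
    have ha0 : a v ≠ 0 := by
      intro h
      have := (hn v hv).1
      rw [show lorentz ((ξ ∘ e.symm) v) (L (ν (v 0) (v 1))) = a v from rfl, h] at this
      norm_num at this
    rw [← two_smul ℝ] at h4
    exact (smul_eq_zero.1 ((smul_eq_zero.1 h4).resolve_left two_ne_zero)).resolve_left ha0
  have hds := hda0.fun_smul hdν
  have hder := (hds.congr_of_eventuallyEq (Filter.eventuallyEq_of_mem (S.isOpen.mem_nhds hv)
    fun z hz => (hn z hz).2)).fderiv
  rw [hder]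
  simp [ha]

theorem arccos_sign_mul {w s : ℝ} (hs : s ^ 2 = 1) (hw : 0 < w) :
    Real.arccos (s * (1 / Real.sqrt (w + 1))) = Real.arctan (Real.sqrt w) ∨
      Real.arccos (s * (1 / Real.sqrt (w + 1))) = Real.pi - Real.arctan (Real.sqrt w) := by
  have h : Real.arccos (1 / Real.sqrt (w + 1)) = Real.arctan (Real.sqrt w) := by
    have h1 := Real.cos_arctan (Real.sqrt w)
    rw [Real.sq_sqrt hw.le, add_comm] at h1
    rw [← h1]
    apply Real.arccos_cos
    · exact Real.arctan_nonneg.2 (Real.sqrt_nonneg _)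
    · have := Real.arctan_lt_pi_div_two (Real.sqrt w)
      linarith [Real.pi_pos]
  rcases mul_self_eq_one_iff.1 ((sq s).symm.trans hs) with rfl | rfl
  · left; rw [one_mul, h]
  · right; rw [neg_one_mul, Real.arccos_neg, h]

theorem IsRepresentation.angle_eq {F ξ : M → Fin 4 → ℝ} (hF : IsImmersedSurface F)
    (hξ : IsUnitNormal F ξ) {c : ℝ} {Φ : (Fin 4 → ℝ) → (Fin 4 → ℝ)} {G : ℝ → ℝ → Fin 4 → ℝ}
    (hΦ : IsAmbientIsometry Φ) (hG : IsModel c G) (hrep : IsRepresentation F c Φ G e) {q : M}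
    (hq : q ∈ e.source) : angle ξ q = Real.arctan (Real.sqrt (e q 0 ^ 2 + c)) ∨
      angle ξ q = Real.pi - Real.arctan (Real.sqrt (e q 0 ^ 2 + c)) := by
  obtain ⟨L, ε, b, hL, hΦL⟩ := hΦ.exists_lorentzMap
  obtain ⟨E, R, ν, hm⟩ := hG.exists_modelFrame
  obtain ⟨h0, h1, -, -, a, ha, hξν, -⟩ :=
    hrep.local_data hF hξ hL hΦL hm (e.map_source hq)
  rw [Function.comp_apply, e.left_inv hq] at hξν
  have h3 : lorentz dt (ξ q) = (a * ε) * (1 / Real.sqrt (e q 0 ^ 2 + c + 1)) := by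
    rw [lorentz_dt_left, hξν, Pi.smul_apply, hL.apply_three, (hm (e q) h0 h1).ν_three, smul_eq_mul]
    ring
  rw [angle, h3]
  exact arccos_sign_mul (by rw [mul_pow, ha, hL.sign, one_mul]) h1

/-- Principal curvatures of a surface given by an explicit immersion. -/
theorem IsRepresentation.principal {F ξ : M → Fin 4 → ℝ} (hF : IsImmersedSurface F)
    (hξ : IsUnitNormal F ξ) {c : ℝ} {Φ : (Fin 4 → ℝ) → (Fin 4 → ℝ)} {G : ℝ → ℝ → Fin 4 → ℝ}
    (hΦ : IsAmbientIsometry Φ) (hG : IsModel c G) (hrep : IsRepresentation F c Φ G e) {q : M}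
    (hq : q ∈ e.source) : ∃ (X : TangentSpace (𝓡 2) q) (κ : ℝ), X ≠ 0 ∧
      diffAt F q X = tangentPart ξ q ∧ shapeOperator F ξ q X = κ • diffAt F q X := by
  obtain ⟨L, ε, b, hL, hΦL⟩ := hΦ.exists_lorentzMap
  obtain ⟨E, R, ν, hm⟩ := hG.exists_modelFrame
  obtain ⟨h0, h1, hN, hfd, a, ha, hξν, hnd⟩ :=
    hrep.local_data hF hξ hL hΦL hm (e.map_source hq)
  have m := hm (e q) h0 h1
  obtain ⟨D, hD, hDF⟩ := exists_chart_differential' hrep.1 hq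
  rw [Function.comp_apply, e.left_inv hq] at hξν hN
  have hε0 : ε ≠ 0 := by
    rintro rfl
    have := hL.sign
    norm_num at this
  set s := Real.sqrt (e q 0 ^ 2 + c) / Real.sqrt (e q 0 ^ 2 + c + 1) with hs
  have hs0 : s ≠ 0 := by positivity
  -- T = ∂_t - cos θ ξ is ε times the image of the tangential part of ∂_t on the model, since L maps
  -- ∂_t to ε∂_t and a² = 1; the model part is s·E.
  set Z : Plane := (ε * s) • EuclideanSpace.single 0 1 with hZ
  have hZ0 : Z 0 = ε * s := by simp [Z]
  have hZ1 : Z 1 = 0 := by simp [Z]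
  have hT : diffAt F q (D Z) = tangentPart ξ q := by
    rw [hDF F (hF.1.mdifferentiable (by simp) q), hfd, hZ0, hZ1, hξ.tangentPart_eq hF, hξν,
      Pi.smul_apply, hL.apply_three, m.ν_three, zero_smul, add_zero, mul_smul, ← map_smul, ← m.tangent,
      map_sub, hL.map_dt, map_smul, smul_sub, smul_smul, ← sq, hL.sign, one_smul, smul_smul,
      smul_smul, smul_eq_mul]
    congr 2
    linear_combination (-(ε * (1 / Real.sqrt (e q 0 ^ 2 + c + 1)))) * ha
  refine ⟨D Z, a * (e q 0 / (Real.sqrt (e q 0 ^ 2 + c) * (e q 0 ^ 2 + c + 1))), ?_, hT, ?_⟩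
  · intro h
    have hz : Z = 0 := hD.1 (by rw [h, map_zero])
    have := congrArg (fun W : Plane => W 0) hz
    simp only [hZ0] at this
    exact (mul_ne_zero hε0 hs0) this
  · rw [shapeOperator, hDF ξ (hξ.1.mdifferentiable (by simp) q),
      hDF F (hF.1.mdifferentiable (by simp) q), hnd, hfd, hZ0, hZ1, lorentz_ambientProj, hN]
    simp only [zero_smul, add_zero, lorentz_smul_left, lorentz_sub_left, hL.map_lorentz,
      m.lorentz_E_normal, lorentz_ambientNormal_self m.mem]
    module

theorem IsRepresentation.gaussCurvature_eq_zero {F ξ : M → Fin 4 → ℝ} (hF : IsImmersedSurface F)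
    (hξ : IsUnitNormal F ξ) {c : ℝ} {Φ : (Fin 4 → ℝ) → (Fin 4 → ℝ)} {G : ℝ → ℝ → Fin 4 → ℝ}
    (hΦ : IsAmbientIsometry Φ) (hG : IsModel c G) (hrep : IsRepresentation F c Φ G e)
    {e' : OpenPartialHomeomorph M (EuclideanSpace ℝ (Fin 2))}
    (he' : e' ∈ IsManifold.maximalAtlas (𝓡 2) ∞ M) {u : Plane} (hu : u ∈ e'.target)
    (hq : e'.symm u ∈ e.source) : gaussCurvature (metricCoeff F e') u = 0 := by
  obtain ⟨L, ε, b, hL, hΦL⟩ := hΦ.exists_lorentzMap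
  obtain ⟨E, R, ν, hm⟩ := hG.exists_modelFrame
  obtain ⟨h0, h1, hN, hfd, a, ha, hξν, hnd⟩ :=
    hrep.local_data hF hξ hL hΦL hm (e.map_source hq)
  set v := e (e'.symm u) with hv
  have m := hm v h0 h1
  obtain ⟨D, hD, hDF⟩ := exists_chart_differential' hrep.1 hq
  obtain ⟨D', hD', hDF'⟩ := exists_chart_differential he' hu
  have S := isLocalSurface_chart hF hξ he'
  -- The coordinate vectors of the adapted chart, expressed in the given chart e', so that the
  -- flatness criterion applies there.
  obtain ⟨X, hX⟩ := hD'.2 (D (EuclideanSpace.single 0 1))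
  obtain ⟨Y, hY⟩ := hD'.2 (D (EuclideanSpace.single 1 1))
  have dF := hF.1.mdifferentiable (by simp) (e'.symm u)
  have dξ := hξ.1.mdifferentiable (by simp) (e'.symm u)
  have fX : fderiv ℝ (F ∘ e'.symm) u X = L (E (v 0) (v 1)) := by
    rw [← hDF' F dF, hX, hDF F dF, hfd]; simp
  have fY : fderiv ℝ (F ∘ e'.symm) u Y = L (R (v 0) (v 1)) := by
    rw [← hDF' F dF, hY, hDF F dF, hfd]; simp
  have nX : fderiv ℝ (ξ ∘ e'.symm) u X = a •
      (-(v 0 / (Real.sqrt (v 0 ^ 2 + c) * (v 0 ^ 2 + c + 1))) • L (E (v 0) (v 1))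
        - (Real.sqrt (v 0 ^ 2 + c) / (v 0 ^ 2 + c + 1)) • L (ambientNormal (G (v 0) (v 1)))) := by
    rw [← hDF' ξ dξ, hX, hDF ξ dξ, hnd]; simp
  have nY : fderiv ℝ (ξ ∘ e'.symm) u Y
      = a • (-(Real.sqrt (v 0 ^ 2 + c) / v 0) • L (R (v 0) (v 1))) := by
    rw [← hDF' ξ dξ, hY, hDF ξ dξ, hnd]; simp
  have hdet : X 0 * Y 1 - X 1 * Y 0 ≠ 0 := by
    intro h
    have e1 : lorentz (fderiv ℝ (F ∘ e'.symm) u X) (fderiv ℝ (F ∘ e'.symm) u X)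
        * lorentz (fderiv ℝ (F ∘ e'.symm) u Y) (fderiv ℝ (F ∘ e'.symm) u Y)
        - lorentz (fderiv ℝ (F ∘ e'.symm) u X) (fderiv ℝ (F ∘ e'.symm) u Y) ^ 2
        = (X 0 * Y 1 - X 1 * Y 0) ^ 2 * (gram (F ∘ e'.symm) u).det := by
      rw [Matrix.det_fin_two]
      simp only [fderiv_apply_eq_pd, lorentz_add_left, lorentz_add_right, lorentz_smul_left,
        lorentz_smul_right, gram_apply,
        lorentz_comm (pd 1 (F ∘ e'.symm) u) (pd 0 (F ∘ e'.symm) u)]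
      ring
    rw [h, fX, fY, hL.map_lorentz, hL.map_lorentz, hL.map_lorentz, m.lorentz_E_E,
      m.lorentz_E_R] at e1
    have := m.lorentz_R_R
    linarith
  have hn3 : (ξ ∘ e'.symm) u 3 ^ 2 = 1 / (v 0 ^ 2 + c + 1) := by
    have h : (ξ ∘ e'.symm) u = a • L (ν (v 0) (v 1)) := by
      rw [← hξν, Function.comp_apply, Function.comp_apply, hv, e.left_inv hq]
    rw [h, Pi.smul_apply, hL.apply_three, m.ν_three, smul_eq_mul, mul_pow, mul_pow, ha, hL.sign,
      div_pow, Real.sq_sqrt (by linarith)]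
    norm_num
  change gaussCurvature (gram (F ∘ e'.symm)) u = 0
  rw [S.gaussCurvature_eq_zero_iff hu hdet, hn3, nX, nY, fX, fY]
  have hRN := m.lorentz_R_normal
  have hEN := m.lorentz_E_normal
  have hER := m.lorentz_E_R
  simp only [lorentz_smul_left, lorentz_sub_left, hL.map_lorentz, m.lorentz_E_E, hER,
    lorentz_comm (R (v 0) (v 1)) (E (v 0) (v 1)), lorentz_comm (ambientNormal (G (v 0) (v 1))),
    hRN, hEN]
  field_simp
  -- The principal curvatures are, up to the common sign a, x/(√(x² + c)(x² + c + 1)) and √(x² +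
  -- c)/x; their product 1/(x² + c + 1) is cos²θ.
  linear_combination (v 0 * lorentz (R (v 0) (v 1)) (R (v 0) (v 1))) * ha

end Surface

/-! ### Orthonormal frames of `ℝ³₁` -/

/-- An orthonormal frame of `ℝ³₁` whose timelike vector points upwards. -/
structure LorentzFrame (E₀ E₁ E₂ : Fin 4 → ℝ) : Prop where
  three₀ : E₀ 3 = 0
  three₁ : E₁ 3 = 0
  mem : E₂ ∈ H2R
  three₂ : E₂ 3 = 0
  norm₀ : lorentz E₀ E₀ = 1
  norm₁ : lorentz E₁ E₁ = 1
  orth₀₁ : lorentz E₀ E₁ = 0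
  orth₀₂ : lorentz E₀ E₂ = 0
  orth₁₂ : lorentz E₁ E₂ = 0

/-- The map of `ℝ³₁ × ℝ` taking the standard frame to `E₀, E₁, E₂` and acting by
`t ↦ η t + b` on the last factor. -/
def frameMap (E₀ E₁ E₂ : Fin 4 → ℝ) (η b : ℝ) (v : Fin 4 → ℝ) : Fin 4 → ℝ :=
  v 0 • E₀ + v 1 • E₁ + v 2 • E₂ + (η * v 3 + b) • dt

/-- The inverse of `frameMap`. -/
def frameCoord (E₀ E₁ E₂ : Fin 4 → ℝ) (η b : ℝ) (P : Fin 4 → ℝ) : Fin 4 → ℝ :=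
  ![lorentz (ambientNormal P) E₀, lorentz (ambientNormal P) E₁, -lorentz (ambientNormal P) E₂,
    η * (P 3 - b)]

theorem ambientNormal_eq_self {P : Fin 4 → ℝ} (h : P 3 = 0) : ambientNormal P = P := by
  rw [ambientNormal_eq, h, zero_smul, sub_zero]

namespace LorentzFrame

variable {E₀ E₁ E₂ : Fin 4 → ℝ} (hE : LorentzFrame E₀ E₁ E₂)
include hE

theorem norm₂ : lorentz E₂ E₂ = -1 := by
  have := lorentz_ambientNormal_self hE.mem
  rwa [ambientNormal_eq_self hE.three₂] at this

theorem expansion {P : Fin 4 → ℝ} (hP : P 3 = 0) :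
    P = lorentz P E₀ • E₀ + lorentz P E₁ • E₁ - lorentz P E₂ • E₂ := by
  have h := orthogonal_expansion E₀ E₁ E₂ dt P hE.orth₀₁ hE.orth₀₂
    (by rw [lorentz_dt_right, hE.three₀]) hE.orth₁₂ (by rw [lorentz_dt_right, hE.three₁])
    (by rw [lorentz_dt_right, hE.three₂]) (by rw [hE.norm₀]; norm_num)
    (by rw [hE.norm₁]; norm_num) (by rw [hE.norm₂]; norm_num) (by simp)
  rw [hE.norm₀, hE.norm₁, hE.norm₂, lorentz_dt_right, hP] at h
  refine h.trans ?_
  module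

theorem frameMap_three (η b : ℝ) (v : Fin 4 → ℝ) : frameMap E₀ E₁ E₂ η b v 3 = η * v 3 + b := by
  simp [frameMap, hE.three₀, hE.three₁, hE.three₂, show dt 3 = 1 from rfl]

theorem ambientNormal_frameMap (η b : ℝ) (v : Fin 4 → ℝ) :
    ambientNormal (frameMap E₀ E₁ E₂ η b v) = v 0 • E₀ + v 1 • E₁ + v 2 • E₂ := by
  rw [ambientNormal_eq, hE.frameMap_three, frameMap]
  module

theorem lorentz_combination (u v : Fin 4 → ℝ) :
    lorentz (u 0 • E₀ + u 1 • E₁ + u 2 • E₂) (v 0 • E₀ + v 1 • E₁ + v 2 • E₂)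
      = lorentz (ambientNormal u) (ambientNormal v) := by
  simp only [lorentz_add_left, lorentz_add_right, lorentz_smul_left, lorentz_smul_right, hE.norm₀,
    hE.norm₁, hE.norm₂, hE.orth₀₁, hE.orth₀₂, hE.orth₁₂, lorentz_comm E₁ E₀, lorentz_comm E₂ E₀,
    lorentz_comm E₂ E₁]
  simp [lorentz, ambientNormal]
  ring

theorem frameMap_frameCoord {η : ℝ} (hη : η ^ 2 = 1) (b : ℝ) (P : Fin 4 → ℝ) :
    frameMap E₀ E₁ E₂ η b (frameCoord E₀ E₁ E₂ η b P) = P := by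
  have h := hE.expansion (P := ambientNormal P) rfl
  have h2 := ambientNormal_eq P
  simp only [frameMap, frameCoord, Matrix.cons_val]
  rw [neg_smul, ← sub_eq_add_neg, ← h, ← mul_assoc, ← sq, hη, h2]
  module

theorem frameCoord_mem {η : ℝ} (hη : η ^ 2 = 1) (b : ℝ) {P : Fin 4 → ℝ} (hP : P ∈ H2R) :
    frameCoord E₀ E₁ E₂ η b P ∈ H2R := by
  rw [mem_H2R_iff]
  constructor
  · rw [← hE.lorentz_combination, ← hE.ambientNormal_frameMap η b,
      hE.frameMap_frameCoord hη, lorentz_ambientNormal_self hP]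
  · have := lorentz_hyperboloid hP hE.mem
    rw [ambientNormal_eq_self hE.three₂] at this
    simp only [frameCoord, Matrix.cons_val]
    linarith

theorem frameMap_mem (η b : ℝ) {v : Fin 4 → ℝ} (hv : v ∈ H2R) :
    frameMap E₀ E₁ E₂ η b v ∈ H2R := by
  apply mem_H2R_of_lorentz hE.mem
  · rw [hE.ambientNormal_frameMap, hE.lorentz_combination, lorentz_ambientNormal_self hv]
  · rw [hE.ambientNormal_frameMap, ambientNormal_eq_self hE.three₂]
    simp only [lorentz_add_left, lorentz_smul_left, hE.norm₂, hE.orth₀₂, hE.orth₁₂]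
    linarith [hv.2]

theorem isAmbientIsometry_frameMap {η : ℝ} (hη : η ^ 2 = 1) (b : ℝ) :
    IsAmbientIsometry (frameMap E₀ E₁ E₂ η b) := by
  have hη0 : η ≠ 0 := by
    rintro rfl
    norm_num at hη
  refine ⟨⟨fun v hv => hE.frameMap_mem η b hv, ?_, fun P hP =>
    ⟨_, hE.frameCoord_mem hη b hP, hE.frameMap_frameCoord hη b P⟩⟩, ?_⟩
  · intro u _ v _ huv
    have h3 := congrFun huv 3
    rw [hE.frameMap_three, hE.frameMap_three] at h3
    have h := congrArg ambientNormal huv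
    rw [hE.ambientNormal_frameMap, hE.ambientNormal_frameMap] at h
    have h0 := congrArg (fun z => lorentz z E₀) h
    have h1 := congrArg (fun z => lorentz z E₁) h
    have h2 := congrArg (fun z => lorentz z E₂) h
    simp only [lorentz_add_left, lorentz_smul_left, hE.norm₀, hE.norm₁, hE.norm₂, hE.orth₀₁,
      hE.orth₀₂, hE.orth₁₂, lorentz_comm E₁ E₀, lorentz_comm E₂ E₀, lorentz_comm E₂ E₁] at h0 h1 h2
    ext i
    fin_cases i
    · simpa using h0
    · simpa using h1
    · simpa using h2
    · simpa [hη0] using h3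
  · intro u _ v _
    rw [ambientDist, ambientDist, hypDist_eq, hypDist_eq, hE.frameMap_three, hE.frameMap_three,
      hE.ambientNormal_frameMap, hE.ambientNormal_frameMap, hE.lorentz_combination]
    congr 2
    linear_combination (u 3 - v 3) ^ 2 * hη

end LorentzFrame

/-- Taking the model axis for w, this converts the product of N with the axis of the surface into a
condition on the frame coordinates. -/
theorem lorentz_frameCoord (E₀ E₁ E₂ : Fin 4 → ℝ) (η b : ℝ) (P w : Fin 4 → ℝ) :
    lorentz (ambientNormal (frameCoord E₀ E₁ E₂ η b P)) w
      = lorentz (ambientNormal P) (w 0 • E₀ + w 1 • E₁ + w 2 • E₂) := by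
  simp only [lorentz_add_right, lorentz_smul_right]
  simp [lorentz, ambientNormal, frameCoord]
  ring

/-- The axis of the explicit immersions: the scalar product with it depends only on `x`. -/
def modelAxis (c : ℝ) : Fin 4 → ℝ :=
  if -1 < c then ![0, 0, Real.sqrt (c + 1), 0]
  else if c < -1 then ![-Real.sqrt (-c - 1), 0, 0, 0] else ![0, -1, 1, 0]

/-- Any vector of `ℝ³₁` of the length of the axis, suitably oriented, is the axis in some frame. -/
theorem exists_lorentzFrame {c x r : ℝ} {P W : Fin 4 → ℝ} (hP : P ∈ H2R) (hx : 0 < x) (hr : 0 < r)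
    (hxr : r ^ 2 = x ^ 2 + c + 1) (hW3 : W 3 = 0) (hWW : lorentz W W = -c - 1)
    (hPW : lorentz (ambientNormal P) W = -r) :
    ∃ E₀ E₁ E₂, LorentzFrame E₀ E₁ E₂ ∧
      modelAxis c 0 • E₀ + modelAxis c 1 • E₁ + modelAxis c 2 • E₂ = W := by
  have hN3 : ambientNormal P 3 = 0 := rfl
  have hNN := lorentz_ambientNormal_self hP
  have hWN : lorentz W (ambientNormal P) = -r := by rw [lorentz_comm, hPW]
  set N := ambientNormal P with hN
  -- The cross product has squared length ⟨W,N⟩² - ⟨W,W⟩⟨N,N⟩ = r² - (c + 1) = x².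
  set n := x⁻¹ • cross W N with hn
  have hn3 : n 3 = 0 := by simp [n, cross]
  have hnn : lorentz n n = 1 := by
    rw [hn, lorentz_smul_left, lorentz_smul_right, lorentz_cross_self hW3, hN3, hWN, hWW, hNN]
    field_simp
    linarith
  have hnW : lorentz n W = 0 := by rw [hn, lorentz_smul_left, lorentz_cross_left, mul_zero]
  have hnN : lorentz n N = 0 := by rw [hn, lorentz_smul_left, lorentz_cross_right, mul_zero]
  have hWn : lorentz W n = 0 := by rw [lorentz_comm, hnW]
  have hNn : lorentz N n = 0 := by rw [lorentz_comm, hnN]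
  have hmem : ∀ E : Fin 4 → ℝ, E 3 = 0 → lorentz E E = -1 → lorentz E N < 0 → E ∈ H2R := by
    intro E h3 h1 h2
    apply mem_H2R_of_lorentz hP <;> rwa [ambientNormal_eq_self h3]
  rcases lt_trichotomy c (-1) with hc | hc | hc
  · have hk : 0 < Real.sqrt (-c - 1) := Real.sqrt_pos.2 (by linarith)
    have hk2 := Real.sq_sqrt (show 0 ≤ -c - 1 by linarith)
    set k := Real.sqrt (-c - 1)
    have hc' : c = -1 - k ^ 2 := by linarith
    have hxr' : r ^ 2 = x ^ 2 - k ^ 2 := by rw [hxr, hc']; ring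
    -- W is spacelike: the timelike vector is the normalized part of N orthogonal to W. The minus
    -- sign matches the sign of the model axis.
    refine ⟨-(k⁻¹ • W), n, (k / x) • N + (r / (k * x)) • W, ⟨?_, hn3, hmem _ ?_ ?_ ?_, ?_, ?_,
      hnn, ?_, ?_, ?_⟩, ?_⟩
    · simp [hW3]
    · simp [hW3, hN3]
    · simp only [lorentz_add_left, lorentz_add_right, lorentz_smul_left, lorentz_smul_right, hNN,
        hPW, hWN, hWW, hk2.symm]
      field_simp
      linarith
    · simp only [lorentz_add_left, lorentz_smul_left, hNN, hWN]
      have h1 : 0 < k / x := by positivity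
      have h2 : 0 < r / (k * x) * r := by positivity
      linarith
    · simp [hW3, hN3]
    · simp only [lorentz_neg_left, lorentz_neg_right, lorentz_smul_left, lorentz_smul_right, hWW,
        hk2.symm]
      field_simp
    · simp [hWn]
    · simp only [lorentz_add_right, lorentz_neg_left, lorentz_smul_left, lorentz_smul_right, hWN,
        hWW, hk2.symm]
      field_simp
      ring
    · simp [hnN, hnW]
    · have h1 : ¬ -1 < c := by linarith
      simp only [modelAxis, h1, hc, if_true, if_false, Matrix.cons_val]
      rw [zero_smul, zero_smul, add_zero, add_zero, smul_neg, neg_smul, neg_neg,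
        smul_inv_smul₀ hk.ne']
  · subst hc
    have hrx : r = x := by
      rw [← sq_eq_sq₀ hr.le hx.le, hxr]; ring
    subst hrx
    -- W is null and has to become E₂ - E₁. The multiple of W in E₂ is fixed by ⟨E₂,E₂⟩ = -1, and
    -- then E₁ = E₂ - W.
    refine ⟨n, r⁻¹ • N - ((1 / r ^ 2 - 1) / 2) • W - W, r⁻¹ • N - ((1 / r ^ 2 - 1) / 2) • W,
      ⟨hn3, ?_, hmem _ ?_ ?_ ?_, ?_, hnn, ?_, ?_, ?_, ?_⟩, ?_⟩
    · simp [hW3, hN3]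
    · simp [hW3, hN3]
    · simp only [lorentz_sub_left, lorentz_sub_right, lorentz_smul_left, lorentz_smul_right, hNN,
        hPW, hWN, hWW]
      field_simp
      ring
    · simp only [lorentz_sub_left, lorentz_smul_left, hNN, hWN]
      have h1 : r⁻¹ * -1 - (1 / r ^ 2 - 1) / 2 * -r = -(r⁻¹ + r) / 2 := by field_simp; ring
      rw [h1]
      have : 0 < r⁻¹ := by positivity
      linarith
    · simp [hW3, hN3]
    · simp only [lorentz_sub_left, lorentz_sub_right, lorentz_smul_left, lorentz_smul_right, hNN,
        hPW, hWN, hWW]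
      field_simp
      ring
    · simp [hnN, hnW]
    · simp [hnN, hnW]
    · simp only [lorentz_sub_left, lorentz_sub_right, lorentz_smul_left, lorentz_smul_right, hNN,
        hPW, hWN, hWW]
      field_simp
      ring
    · simp only [modelAxis, lt_irrefl, if_false, Matrix.cons_val]
      module
  · have hk : 0 < Real.sqrt (c + 1) := Real.sqrt_pos.2 (by linarith)
    have hk2 := Real.sq_sqrt (show 0 ≤ c + 1 by linarith)
    set k := Real.sqrt (c + 1)
    have hc' : c = k ^ 2 - 1 := by linarith
    have hWW' : lorentz W W = -k ^ 2 := by rw [hWW, hc']; ring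
    -- W is timelike and ⟨W,N⟩ < 0, so W/k points upwards; the first vector is the normalized part
    -- of N orthogonal to W.
    refine ⟨(k / x) • N - (r / (k * x)) • W, n, k⁻¹ • W, ⟨?_, hn3, hmem _ ?_ ?_ ?_, ?_, ?_,
      hnn, ?_, ?_, ?_⟩, ?_⟩
    · simp [hW3, hN3]
    · simp [hW3]
    · simp only [lorentz_smul_left, lorentz_smul_right, hWW']
      field_simp
    · rw [lorentz_smul_left, hWN]
      have : 0 < k⁻¹ * r := by positivity
      linarith
    · simp [hW3]
    · simp only [lorentz_sub_left, lorentz_sub_right, lorentz_smul_left, lorentz_smul_right, hNN,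
        hPW, hWN, hWW']
      field_simp
      linarith
    · simp [hNn, hWn]
    · simp only [lorentz_sub_left, lorentz_smul_left, lorentz_smul_right, hPW, hWW']
      field_simp
      ring
    · simp [hnW]
    · simp only [modelAxis, hc, if_true, Matrix.cons_val]
      rw [zero_smul, zero_smul, zero_add, zero_add, smul_inv_smul₀ hk.ne']

/-- The second coordinate of the explicit immersions as a local smooth function. -/
theorem exists_modelCoordinate (c : ℝ) : ∃ G, IsModel c G ∧ (∀ x y, G x y 3 = chi c x) ∧
    ∀ a ∈ H2R, ∀ x, 0 < x → 0 < x ^ 2 + c →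
      lorentz (ambientNormal a) (modelAxis c) = -Real.sqrt (x ^ 2 + c + 1) →
    ∃ (O : Set (Fin 4 → ℝ)) (Y : (Fin 4 → ℝ) → ℝ), IsOpen O ∧ a ∈ O ∧ ContDiffOn ℝ ∞ Y O ∧
      ∀ v ∈ O, v ∈ H2R → ∀ x, 0 < x → 0 < x ^ 2 + c →
        lorentz (ambientNormal v) (modelAxis c) = -Real.sqrt (x ^ 2 + c + 1) →
        ambientNormal v = ambientNormal (G x (Y v)) := by
  rcases lt_trichotomy c (-1) with hc | hc | hc
  · have hk : 0 < Real.sqrt (-c - 1) := Real.sqrt_pos.2 (by linarith)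
    have hk2 := Real.sq_sqrt (show 0 ≤ -c - 1 by linarith)
    refine ⟨immersionB c, Or.inr (Or.inl ⟨hc, rfl⟩), fun _ _ => rfl, ?_⟩
    have h1 : ¬ -1 < c := by linarith
    simp only [modelAxis, h1, hc, if_true, if_false]
    set k := Real.sqrt (-c - 1)
    have hv0 : ∀ (v : Fin 4 → ℝ) (r : ℝ), lorentz (ambientNormal v) ![-k, 0, 0, 0] = -r →
        v 0 = r / k := by
      intro v r h
      simp [lorentz, ambientNormal] at h
      rw [eq_div_iff hk.ne', h]
    have hdiff : ∀ v ∈ H2R, ∀ x : ℝ, 0 < x ^ 2 + c →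
        lorentz (ambientNormal v) ![-k, 0, 0, 0] = -Real.sqrt (x ^ 2 + c + 1) →
        v 2 ^ 2 - v 1 ^ 2 = (x / k) ^ 2 := by
      intro v hv x h2 h
      have h3 := hv.1
      rw [hv0 v _ h, div_pow, Real.sq_sqrt (by linarith)] at h3
      rw [div_pow]
      field_simp at h3 ⊢
      linarith
    intro a ha x hx hxc haw
    refine ⟨{v | 0 < v 2 ^ 2 - v 1 ^ 2},
      fun v => Real.arsinh (v 1 / Real.sqrt (v 2 ^ 2 - v 1 ^ 2)),
      isOpen_lt continuous_const (by fun_prop), ?_, ?_, ?_⟩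
    · change 0 < a 2 ^ 2 - a 1 ^ 2
      rw [hdiff a ha x hxc haw]
      positivity
    · refine Real.contDiff_arsinh.comp_contDiffOn ?_
      refine ContDiffOn.div (by fun_prop) (ContDiffOn.sqrt (by fun_prop) fun v hv => hv.ne')
        fun v hv => (Real.sqrt_pos.2 hv).ne'
    · intro v hv hvm x hx hxc hvw
      have h4 := hdiff v hvm x hxc hvw
      have h5 : v 1 = x / k * (v 1 / Real.sqrt (v 2 ^ 2 - v 1 ^ 2)) := by
        rw [h4, Real.sqrt_sq (by positivity), mul_div_cancel₀ _ (by positivity)]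
      have h6 : v 2 = x / k * Real.cosh (Real.arsinh (v 1 / Real.sqrt (v 2 ^ 2 - v 1 ^ 2))) := by
        rw [Real.cosh_arsinh, h4, Real.sqrt_sq (by positivity)]
        rw [← sq_eq_sq₀ hvm.2.le (by positivity), mul_pow, Real.sq_sqrt (by positivity)]
        field_simp at h4 ⊢
        linarith
      ext i
      fin_cases i
      · exact hv0 v _ hvw
      · change v 1 = x / k * Real.sinh _
        rw [Real.sinh_arsinh]
        exact h5
      · exact h6
      · rfl
  · subst hc
    refine ⟨immersionC (-1), Or.inr (Or.inr ⟨rfl, rfl⟩), fun _ _ => rfl, ?_⟩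
    simp only [modelAxis, lt_irrefl, if_false]
    have hv0 : ∀ (v : Fin 4 → ℝ) (x : ℝ), 0 < x →
        lorentz (ambientNormal v) ![0, -1, 1, 0] = -Real.sqrt (x ^ 2 + -1 + 1) →
        v 1 + v 2 = x := by
      intro v x hx h
      rw [neg_add_cancel_right, Real.sqrt_sq hx.le] at h
      simp [lorentz, ambientNormal] at h
      linarith
    intro a ha x hx _ haw
    refine ⟨{v | 0 < v 1 + v 2}, fun v => v 0 / (v 1 + v 2),
      isOpen_lt continuous_const (by fun_prop), ?_, ?_, ?_⟩
    · change 0 < a 1 + a 2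
      rwa [hv0 a x hx haw]
    · exact ContDiffOn.div (by fun_prop) (by fun_prop) fun v hv => hv.ne'
    · intro v hv hvm x hx _ hvw
      have h4 := hv0 v x hx hvw
      have h5 : v 1 = x - v 2 := by linarith
      have h6 := hvm.1
      have h7 : v 2 = x / 2 + 1 / (2 * x) + v 0 ^ 2 / (2 * x) := by
        rw [h5] at h6
        field_simp
        linarith
      ext i
      fin_cases i
      · change v 0 = x * (v 0 / (v 1 + v 2))
        rw [h4, mul_div_cancel₀ _ hx.ne']
      · change v 1 = x / 2 * (1 - (v 0 / (v 1 + v 2)) ^ 2) - 1 / (2 * x)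
        rw [h4, h5, h7]
        field_simp
        ring
      · change v 2 = x / 2 * (1 + (v 0 / (v 1 + v 2)) ^ 2) + 1 / (2 * x)
        rw [h4, h7]
        field_simp
        ring
      · rfl
  · have hk : 0 < Real.sqrt (c + 1) := Real.sqrt_pos.2 (by linarith)
    have hk2 := Real.sq_sqrt (show 0 ≤ c + 1 by linarith)
    refine ⟨immersionA c, Or.inl ⟨hc, rfl⟩, fun _ _ => rfl, ?_⟩
    simp only [modelAxis, hc, if_true]
    set k := Real.sqrt (c + 1)
    have hv2 : ∀ (v : Fin 4 → ℝ) (r : ℝ), lorentz (ambientNormal v) ![0, 0, k, 0] = -r →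
        v 2 = r / k := by
      intro v r h
      simp [lorentz, ambientNormal] at h
      rw [eq_div_iff hk.ne', h]
    have hsum : ∀ v ∈ H2R, ∀ x : ℝ, 0 < x ^ 2 + c →
        lorentz (ambientNormal v) ![0, 0, k, 0] = -Real.sqrt (x ^ 2 + c + 1) →
        v 0 ^ 2 + v 1 ^ 2 = (x / k) ^ 2 := by
      intro v hv x h2 h
      have h3 := hv.1
      rw [hv2 v _ h, div_pow, Real.sq_sqrt (by linarith)] at h3
      rw [div_pow]
      field_simp at h3 ⊢
      linarith
    intro a ha x hx hxc haw
    -- Here y is a polar angle. Measuring it from the angle y₀ of the base point by an arctangent on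
    -- a half-plane keeps it smooth across the branch cut of the argument.
    set z : ℂ := ⟨a 0, a 1⟩ with hz
    have hzn : ‖z‖ = x / k := by
      rw [← sq_eq_sq₀ (norm_nonneg _) (by positivity), ← Complex.normSq_eq_norm_sq,
        ← hsum a ha x hxc haw, Complex.normSq_apply]
      simp only [hz]; ring
    have ha0 : a 0 = x / k * Real.cos z.arg := by
      rw [← hzn, Complex.norm_mul_cos_arg]
    have ha1 : a 1 = x / k * Real.sin z.arg := by
      rw [← hzn, Complex.norm_mul_sin_arg]
    set y₀ := z.arg
    have hcs := Real.sin_sq_add_cos_sq y₀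
    refine ⟨{v | 0 < v 0 * Real.cos y₀ + v 1 * Real.sin y₀}, fun v => y₀ + Real.arctan
      ((v 1 * Real.cos y₀ - v 0 * Real.sin y₀) / (v 0 * Real.cos y₀ + v 1 * Real.sin y₀)),
      isOpen_lt continuous_const (by fun_prop), ?_, ?_, ?_⟩
    · change 0 < a 0 * Real.cos y₀ + a 1 * Real.sin y₀
      have : a 0 * Real.cos y₀ + a 1 * Real.sin y₀ = x / k := by
        rw [ha0, ha1]
        linear_combination (x / k) * hcs
      rw [this]
      positivity
    · refine contDiffOn_const.add (Real.contDiff_arctan.comp_contDiffOn ?_)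
      exact ContDiffOn.div (by fun_prop) (by fun_prop) fun v hv => hv.ne'
    · intro v hv hvm x hx hxc hvw
      have h4 := hsum v hvm x hxc hvw
      change 0 < v 0 * Real.cos y₀ + v 1 * Real.sin y₀ at hv
      set D := v 0 * Real.cos y₀ + v 1 * Real.sin y₀ with hD
      set B := v 1 * Real.cos y₀ - v 0 * Real.sin y₀ with hB
      have h5 : D ^ 2 + B ^ 2 = (x / k) ^ 2 := by
        rw [← h4, hD, hB]
        linear_combination (v 0 ^ 2 + v 1 ^ 2) * hcs
      have h6 : Real.sqrt (1 + (B / D) ^ 2) = (x / k) / D := by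
        rw [show 1 + (B / D) ^ 2 = ((x / k) / D) ^ 2 by
          rw [div_pow (x / k), ← h5]; field_simp, Real.sqrt_sq (by positivity)]
      have h7 : x / k * Real.cos (Real.arctan (B / D)) = D := by
        rw [Real.cos_arctan, h6]
        field_simp
      have h8 : x / k * Real.sin (Real.arctan (B / D)) = B := by
        rw [Real.sin_arctan, h6]
        field_simp
      ext i
      fin_cases i
      · change v 0 = x / k * Real.cos (y₀ + Real.arctan (B / D))
        rw [Real.cos_add]
        linear_combination (-(Real.cos y₀)) * h7 + Real.sin y₀ * h8 - v 0 * hcs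
      · change v 1 = x / k * Real.sin (y₀ + Real.arctan (B / D))
        rw [Real.sin_add]
        linear_combination (-(Real.sin y₀)) * h7 - Real.cos y₀ * h8 - v 1 * hcs
      · exact hv2 v _ hvw
      · rfl


/-! ### Adapted coordinates -/

theorem exists_local_diffeomorphism {U : Set Plane} (hU : IsOpen U) {g : Plane → Plane}
    (hg : ContDiffOn ℝ ∞ g U) (hinj : ∀ u ∈ U, Function.Injective (fderiv ℝ g u)) {u₀ : Plane}
    (hu₀ : u₀ ∈ U) : ∃ h : OpenPartialHomeomorph Plane Plane, u₀ ∈ h.source ∧ h.source ⊆ U ∧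
      (∀ u, h u = g u) ∧ ContDiffOn ℝ ∞ h.symm h.target := by
  have hd : ∀ u ∈ U, ∃ L : Plane ≃L[ℝ] Plane, HasFDerivAt g (L : Plane →L[ℝ] Plane) u := by
    intro u hu
    refine ⟨(LinearEquiv.ofInjectiveEndo (fderiv ℝ g u : Plane →ₗ[ℝ] Plane)
      (hinj u hu)).toContinuousLinearEquiv, ?_⟩
    refine (hg.hasFDerivAt' hU hu).congr_fderiv ?_
    ext1 X
    rfl
  have hcd : ∀ u ∈ U, ContDiffAt ℝ ∞ g u := fun u hu => hg.contDiffAt (hU.mem_nhds hu)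
  obtain ⟨L, hL⟩ := hd u₀ hu₀
  set h₀ := (hcd u₀ hu₀).toOpenPartialHomeomorph g hL (by simp) with hh₀
  have hu₀' : u₀ ∈ h₀.source :=
    (hcd u₀ hu₀).mem_toOpenPartialHomeomorph_source hL (by simp)
  -- After restriction to U the derivative is invertible at every point of the source, so the
  -- inverse is smooth on the whole target and not only near the image of u₀.
  refine ⟨h₀.restrOpen U hU, ⟨hu₀', hu₀⟩, fun u hu => hu.2, fun _ => rfl, ?_⟩
  intro v hv
  have hs := (h₀.restrOpen U hU).map_target hv
  obtain ⟨L', hL'⟩ := hd _ hs.2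
  exact ((h₀.restrOpen U hU).contDiffAt_symm hv hL' (hcd _ hs.2)).contDiffWithinAt

/-- A continuous function without zeros on a connected space has a constant sign. -/
theorem sign_of_continuous {X : Type*} [TopologicalSpace X] [PreconnectedSpace X] {f : X → ℝ} (hf : Continuous f)
    (h0 : ∀ p, f p ≠ 0) : ∃ s : ℝ, s ^ 2 = 1 ∧ ∀ p, 0 < s * f p := by
  by_cases h : ∃ p, 0 < f p
  · obtain ⟨p, hp⟩ := h
    refine ⟨1, by norm_num, fun q => ?_⟩
    rw [one_mul]
    by_contra! hq
    obtain ⟨z, hz⟩ := mem_range_of_exists_le_of_exists_ge hf ⟨q, hq⟩ ⟨p, hp.le⟩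
    exact h0 z hz
  · push Not at h
    refine ⟨-1, by norm_num, fun q => ?_⟩
    have := lt_of_le_of_ne (h q) (h0 q)
    linarith

section Surface

variable {M : Type*} [TopologicalSpace M] [ChartedSpace (EuclideanSpace ℝ (Fin 2)) M]
  [IsManifold (𝓡 2) ∞ M]

theorem exists_chart_eq {ψ : M → Plane} {s : Set M} (hs : IsOpen s)
    (hψ : ContMDiffOn (𝓡 2) 𝓘(ℝ, Plane) ∞ ψ s) {p : M} (hp : p ∈ s)
    (hinj : ∀ e ∈ IsManifold.maximalAtlas (𝓡 2) ∞ M, ∀ u ∈ e.target, e.symm u ∈ s →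
      Function.Injective (fderiv ℝ (ψ ∘ e.symm) u)) :
    ∃ e ∈ IsManifold.maximalAtlas (𝓡 2) ∞ M, p ∈ e.source ∧ e.source ⊆ s ∧
      ∀ q ∈ e.source, e q = ψ q := by
  set e₀ := chartAt (EuclideanSpace ℝ (Fin 2)) p
  have he₀ : e₀ ∈ IsManifold.maximalAtlas (𝓡 2) ∞ M := IsManifold.chart_mem_maximalAtlas p
  have hp₀ : p ∈ e₀.source := mem_chart_source _ p
  obtain ⟨h, hh, hhU, hhg, hhs⟩ := exists_local_diffeomorphism
    (e₀.isOpen_inter_preimage_symm hs) (contDiffOn_chart he₀ hψ)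
    (fun u hu => hinj e₀ he₀ u hu.1 hu.2) (u₀ := e₀ p)
    ⟨e₀.map_source hp₀, by rwa [Set.mem_preimage, e₀.left_inv hp₀]⟩
  have hsub : ∀ q ∈ (e₀.trans h).source, q ∈ s := by
    intro q hq
    rw [OpenPartialHomeomorph.trans_source] at hq
    have := (hhU hq.2).2
    rwa [Set.mem_preimage, e₀.left_inv hq.1] at this
  have heq : ∀ q ∈ (e₀.trans h).source, (e₀.trans h) q = ψ q := by
    intro q hq
    rw [OpenPartialHomeomorph.trans_source] at hq
    rw [OpenPartialHomeomorph.coe_trans, Function.comp_apply, hhg, Function.comp_apply,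
      e₀.left_inv hq.1]
  refine ⟨e₀.trans h, ?_, ?_, hsub, heq⟩
  · apply OpenPartialHomeomorph.mem_maximalAtlas_of_contMDiffOn
    · exact (hψ.mono hsub).congr heq
    · rw [OpenPartialHomeomorph.coe_trans_symm]
      refine (contMDiffOn_symm_of_mem_maximalAtlas he₀).comp
        ((contMDiffOn_iff_contDiffOn.2 hhs).mono ?_) ?_
      · intro v hv
        rw [OpenPartialHomeomorph.trans_target] at hv
        exact hv.1
      · intro v hv
        rw [OpenPartialHomeomorph.trans_target] at hv
        exact hv.2
  · rw [OpenPartialHomeomorph.trans_source]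
    exact ⟨hp₀, hh⟩

/-- F is an immersion and factors through ψ, so the differential of ψ cannot have a kernel. -/
theorem injective_of_representation {F ξ : M → Fin 4 → ℝ} (hF : IsImmersedSurface F)
    (hξ : IsUnitNormal F ξ) {c : ℝ} {Φ : (Fin 4 → ℝ) → (Fin 4 → ℝ)} {G : ℝ → ℝ → Fin 4 → ℝ}
    (hΦ : Differentiable ℝ Φ) (hG : IsModel c G) {ψ : M → Plane} {s : Set M} (hs : IsOpen s)
    (hψ : ContMDiffOn (𝓡 2) 𝓘(ℝ, Plane) ∞ ψ s)
    (hrep : ∀ q ∈ s, 0 < ψ q 0 ∧ 0 < ψ q 0 ^ 2 + c ∧ F q = Φ (G (ψ q 0) (ψ q 1)))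
    {e : OpenPartialHomeomorph M (EuclideanSpace ℝ (Fin 2))}
    (he : e ∈ IsManifold.maximalAtlas (𝓡 2) ∞ M) {u : Plane} (hu : u ∈ e.target)
    (hus : e.symm u ∈ s) : Function.Injective (fderiv ℝ (ψ ∘ e.symm) u) := by
  obtain ⟨E, R, ν, hm⟩ := hG.exists_modelFrame
  have S := isLocalSurface_chart hF hξ he
  have hopen := e.isOpen_inter_preimage_symm hs
  have hd := (contDiffOn_chart he hψ).hasFDerivAt' hopen ⟨hu, hus⟩
  obtain ⟨h0, h1, -⟩ := hrep _ hus
  have hcomp := (hΦ _).hasFDerivAt.comp u ((hm ((ψ ∘ e.symm) u) h0 h1).hasFDerivAt.comp u hd)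
  have hF' := hcomp.congr_of_eventuallyEq (f₁ := F ∘ e.symm)
    (Filter.eventuallyEq_of_mem (hopen.mem_nhds ⟨hu, hus⟩) fun w hw => (hrep _ hw.2).2.2)
  intro X Y hXY
  apply S.injective u hu
  rw [hF'.fderiv]
  simp only [ContinuousLinearMap.comp_apply, hXY]

/-- The first integrals of a flat surface on which `T` is a principal direction. -/
theorem exists_first_integrals [ConnectedSpace M] {F ξ : M → Fin 4 → ℝ}
    (hF : IsImmersedSurface F) (hξ : IsUnitNormal F ξ) (hC : ∀ p, ξ p 3 ≠ 0)
    (hflat : IsFlatSurface F) (hP : IsPrincipalT F ξ) :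
    ∃ (c η b : ℝ) (W : Fin 4 → ℝ), η ^ 2 = 1 ∧ W 3 = 0 ∧ lorentz W W = -c - 1 ∧
      ∀ p, 0 < 1 / ξ p 3 ^ 2 - c - 1 ∧ 0 < 1 / ξ p 3 ^ 2 - 1 ∧
        lorentz (ambientNormal (F p)) W = -Real.sqrt (1 / ξ p 3 ^ 2) ∧
        F p 3 = η * chi c (Real.sqrt (1 / ξ p 3 ^ 2 - c - 1)) + b := by
  obtain ⟨κ, hκ⟩ := exists_principalCurvature hP
  have S : ∀ {e : OpenPartialHomeomorph M (EuclideanSpace ℝ (Fin 2))},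
      e ∈ IsManifold.maximalAtlas (𝓡 2) ∞ M → _ :=
    fun he => isFlatPrincipal_chart hF hξ hC hflat hκ he
  have hκ0 : ∀ p, κ p ≠ 0 := fun p => by
    have h := (S (IsManifold.chart_mem_maximalAtlas p)).kappa_ne (mem_chart_target _ p)
    rwa [Function.comp_apply, (chartAt _ p).left_inv (mem_chart_source _ p)] at h
  have hs : ∀ p, 0 < 1 - ξ p 3 ^ 2 := fun p => by
    have h := (S (IsManifold.chart_mem_maximalAtlas p)).sin_sq_pos (mem_chart_target _ p)
    rwa [Function.comp_apply, (chartAt _ p).left_inv (mem_chart_source _ p)] at h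
  have hκc : Continuous κ := by
    rw [continuous_iff_continuousAt]
    intro p
    have h := ((S (IsManifold.chart_mem_maximalAtlas p)).differentiableAt_kappa
      (mem_chart_target _ p)).continuousAt
    rw [(chartAt (EuclideanSpace ℝ (Fin 2)) p).symm.continuousAt_iff_continuousAt_comp_right
      (f := κ) (x := p) (by simp)]
    simpa using h
  have hCc : Continuous fun p => ξ p 3 := (continuous_apply 3).comp hξ.1.continuous
  -- η, the sign of κ cos θ, relates the height to χ; σ, the sign of cos θ, orients W so that ⟨N,W⟩
  -- is negative. Both are constant because M is connected.
  obtain ⟨η, hη, hηpos⟩ := sign_of_continuous (hκc.mul hCc) fun p => mul_ne_zero (hκ0 p) (hC p)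
  obtain ⟨σ, hσ, hσpos⟩ := sign_of_continuous hCc hC
  obtain ⟨p₀⟩ : Nonempty M := inferInstance
  set W₀ := axisVector (κ p₀) (F p₀) (ξ p₀) with hW₀
  have hW : ∀ p, axisVector (κ p) (F p) (ξ p) = W₀ := fun p =>
    eq_of_hasFDerivAt_zero (h := fun p => axisVector (κ p) (F p) (ξ p))
      (fun e he u hu => (S he).hasFDerivAt_axisVector hu) p p₀
  set c := -lorentz W₀ W₀ - 1 with hc
  have hcp : ∀ p, 1 / ξ p 3 ^ 2 - c - 1 = (1 - ξ p 3 ^ 2) * κ p ^ 2 / ξ p 3 ^ 6 := fun p => by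
    have h := lorentz_axisVector_self (hF.2.1 p) (hκ0 p) (hC p) (hξ.2 p).2.1 (hξ.2 p).1
    rw [hW] at h
    linarith
  refine ⟨c, η, F p₀ 3 - η * chi c (Real.sqrt (1 / ξ p₀ 3 ^ 2 - c - 1)), σ • W₀, hη, ?_, ?_,
    fun p => ⟨?_, ?_, ?_, ?_⟩⟩
  · rw [Pi.smul_apply, hW₀, axisVector_three, smul_zero]
  · rw [lorentz_smul_left, lorentz_smul_right, ← mul_assoc, ← sq, hσ, hc]
    ring
  · rw [hcp]
    have := hs p
    have := hC p
    have := hκ0 p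
    positivity
  · have h1 := hs p
    have h2 : 0 < ξ p 3 ^ 2 := by
      have := hC p
      positivity
    rw [sub_pos, lt_div_iff₀ h2]
    linarith
  · rw [lorentz_smul_right, ← hW p, lorentz_axisVector (hF.2.1 p) (hκ0 p) (hC p) (hξ.2 p).2.1]
    have h1 := hσpos p
    have h2 : 1 / ξ p 3 ^ 2 = (1 / (σ * ξ p 3)) ^ 2 := by
      rw [div_pow, mul_pow, hσ, one_mul, one_pow]
    rw [h2, Real.sqrt_sq (by positivity)]
    have hC := hC p
    have hσ0 : σ ≠ 0 := by
      rintro rfl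
      norm_num at hσ
    field_simp
    linarith
  · have h := eq_of_hasFDerivAt_zero
      (h := fun p => F p 3 - η * chi c (Real.sqrt (1 / ξ p 3 ^ 2 - c - 1)))
      (fun e he u hu => (S he).hasFDerivAt_height_sub_chi hη hu (hηpos _) (hcp _)) p p₀
    linarith

theorem exists_representation [ConnectedSpace M] {F ξ : M → Fin 4 → ℝ}
    (hF : IsImmersedSurface F) (hξ : IsUnitNormal F ξ) (hC : ∀ p, ξ p 3 ≠ 0)
    (hflat : IsFlatSurface F) (hP : IsPrincipalT F ξ) :
    ∃ (c : ℝ) (Φ : (Fin 4 → ℝ) → (Fin 4 → ℝ)) (G : ℝ → ℝ → Fin 4 → ℝ),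
      IsAmbientIsometry Φ ∧ IsModel c G ∧
        ∀ p : M, ∃ e, p ∈ e.source ∧ IsRepresentation F c Φ G e := by
  obtain ⟨c, η, b, W, hη, hW3, hWW, hp⟩ := exists_first_integrals hF hξ hC hflat hP
  obtain ⟨p₀⟩ : Nonempty M := inferInstance
  set x : M → ℝ := fun p => Real.sqrt (1 / ξ p 3 ^ 2 - c - 1) with hx
  have hx0 : ∀ p, 0 < x p := fun p => Real.sqrt_pos.2 (hp p).1
  have hx2 : ∀ p, x p ^ 2 = 1 / ξ p 3 ^ 2 - c - 1 := fun p => Real.sq_sqrt (hp p).1.le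
  have hxc : ∀ p, 0 < x p ^ 2 + c := fun p => by
    rw [hx2]
    linarith [(hp p).2.1]
  have hr : ∀ p, 1 / ξ p 3 ^ 2 = x p ^ 2 + c + 1 := fun p => by
    rw [hx2]
    ring
  have hNW : ∀ p, lorentz (ambientNormal (F p)) W = -Real.sqrt (x p ^ 2 + c + 1) := fun p => by
    rw [← hr, (hp p).2.2.1]
  -- One base point suffices: W is the same everywhere, so a frame adapted to W serves the whole
  -- surface and Φ is global. Only the coordinate y is local.
  obtain ⟨E₀, E₁, E₂, hE, hEW⟩ := exists_lorentzFrame (hF.2.1 p₀) (hx0 p₀)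
    (Real.sqrt_pos.2 (by linarith [hxc p₀] : 0 < x p₀ ^ 2 + c + 1))
    (Real.sq_sqrt (by linarith [hxc p₀])) hW3 hWW (hNW p₀)
  obtain ⟨G, hG, hG3, hGY⟩ := exists_modelCoordinate c
  refine ⟨c, frameMap E₀ E₁ E₂ η b, G, hE.isAmbientIsometry_frameMap hη b, hG, fun p => ?_⟩
  set a : M → Fin 4 → ℝ := fun q => frameCoord E₀ E₁ E₂ η b (F q) with ha
  have ham : ∀ q, a q ∈ H2R := fun q => hE.frameCoord_mem hη b (hF.2.1 q)
  have haW : ∀ q, lorentz (ambientNormal (a q)) (modelAxis c) = -Real.sqrt (x q ^ 2 + c + 1) :=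
    fun q => by rw [lorentz_frameCoord, hEW, hNW]
  have hda : ContMDiff (𝓡 2) 𝓘(ℝ, Fin 4 → ℝ) ∞ a := by
    have h : ContDiff ℝ ∞ (frameCoord E₀ E₁ E₂ η b) := by
      rw [contDiff_pi]
      intro i
      fin_cases i <;> simp [frameCoord, lorentz, ambientNormal] <;> fun_prop
    exact h.contMDiff.comp hF.1
  obtain ⟨O, Y, hO, hpO, hY, hGY⟩ := hGY (a p) (ham p) (x p) (hx0 p) (hxc p) (haW p)
  have hs : IsOpen (a ⁻¹' O) := hO.preimage hda.continuous
  set ψ : M → Plane := fun q => !₂[x q, Y (a q)] with hψ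
  have hψd : ContMDiffOn (𝓡 2) 𝓘(ℝ, Plane) ∞ ψ (a ⁻¹' O) := by
    have h1 : ContMDiffOn (𝓡 2) 𝓘(ℝ, ℝ) ∞ x (a ⁻¹' O) := by
      intro q _
      have h : ContDiffAt ℝ ∞ (fun v : Fin 4 → ℝ => Real.sqrt (1 / v 3 ^ 2 - c - 1)) (ξ q) := by
        refine ContDiffAt.sqrt (((contDiffAt_const.div
          (g := fun v : Fin 4 → ℝ => v 3 ^ 2) (by fun_prop) (pow_ne_zero 2 (hC q))).sub contDiffAt_const).sub contDiffAt_const) (hp q).1.ne'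
      exact (h.contMDiffAt.comp q (hξ.1 q)).contMDiffWithinAt
    have h2 : ContMDiffOn (𝓡 2) 𝓘(ℝ, ℝ) ∞ (fun q => Y (a q)) (a ⁻¹' O) :=
      hY.contMDiffOn.comp hda.contMDiffOn fun q hq => hq
    have h3 : ContDiff ℝ ∞ (fun v : ℝ × ℝ => (!₂[v.1, v.2] : Plane)) := by
      rw [contDiff_euclidean]
      intro i
      fin_cases i <;> simp <;> fun_prop
    exact h3.contMDiff.comp_contMDiffOn (h1.prodMk_space h2)
  have hrep : ∀ q ∈ a ⁻¹' O, 0 < ψ q 0 ∧ 0 < ψ q 0 ^ 2 + c ∧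
      F q = frameMap E₀ E₁ E₂ η b (G (ψ q 0) (ψ q 1)) := by
    intro q hq
    refine ⟨hx0 q, hxc q, ?_⟩
    have h1 := hGY (a q) hq (ham q) (x q) (hx0 q) (hxc q) (haW q)
    have h2 : a q = G (x q) (Y (a q)) := by
      have h3 : a q 3 = G (x q) (Y (a q)) 3 := by
        rw [hG3, ha]
        simp only [frameCoord, Matrix.cons_val]
        rw [(hp q).2.2.2, add_sub_cancel_right, ← mul_assoc, ← sq, hη, one_mul]
      ext i
      fin_cases i
      · exact congrFun h1 0
      · exact congrFun h1 1
      · exact congrFun h1 2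
      · exact h3
    change F q = frameMap E₀ E₁ E₂ η b (G (x q) (Y (a q)))
    rw [← h2, hE.frameMap_frameCoord hη]
  -- The pair (x, y) becomes a chart: its differential is injective because F is the composite of an
  -- affine map, the model immersion and ψ.
  obtain ⟨e, he, hpe, hes, heq⟩ := exists_chart_eq hs hψd (p := p) hpO
    fun e he u hu hus => injective_of_representation hF hξ
      (by unfold frameMap; fun_prop) hG hs hψd hrep he hu hus
  refine ⟨e, hpe, he, fun q hq => ?_⟩
  rw [heq q hq]
  exact hrep q (hes hq)

end Surface
end

theorem theorem7 {M : Type*} [TopologicalSpace M] [ChartedSpace (EuclideanSpace ℝ (Fin 2)) M]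
    [IsManifold (𝓡 2) ∞ M] [ConnectedSpace M] (F ξ : M → Fin 4 → ℝ)
    (hF : IsImmersedSurface F) (hξ : IsUnitNormal F ξ)
    (hθ : ∀ p, angle ξ p ≠ 0 ∧ angle ξ p ≠ Real.pi / 2) :
    ((IsFlatSurface F ∧ IsPrincipalT F ξ) ↔
      ∃ (c : ℝ) (Φ : (Fin 4 → ℝ) → (Fin 4 → ℝ)) (G : ℝ → ℝ → Fin 4 → ℝ),
        IsAmbientIsometry Φ ∧ IsModel c G ∧
          ∀ p, ∃ e, p ∈ e.source ∧ IsRepresentation F c Φ G e) ∧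
    (∀ (c : ℝ) (Φ : (Fin 4 → ℝ) → (Fin 4 → ℝ)) (G : ℝ → ℝ → Fin 4 → ℝ)
        (e : OpenPartialHomeomorph M (EuclideanSpace ℝ (Fin 2))),
      IsAmbientIsometry Φ → IsModel c G → IsRepresentation F c Φ G e →
        ∀ q ∈ e.source, angle ξ q = Real.arctan (Real.sqrt (e q 0 ^ 2 + c)) ∨
          angle ξ q = Real.pi - Real.arctan (Real.sqrt (e q 0 ^ 2 + c))) := by
  refine ⟨⟨fun h => exists_representation hF hξ (fun p => normal_three_ne_zero (hθ p).2) h.1 h.2,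
    ?_⟩, fun c Φ G e hΦ hG hrep q hq => hrep.angle_eq hF hξ hΦ hG hq⟩
  rintro ⟨c, Φ, G, hΦ, hG, h⟩
  constructor
  · intro e' he' u hu
    obtain ⟨e, hq, hrep⟩ := h (e'.symm u)
    exact hrep.gaussCurvature_eq_zero hF hξ hΦ hG he' hu hq
  · intro p
    obtain ⟨e, hp, hrep⟩ := h p
    exact hrep.principal hF hξ hΦ hG hp
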